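/- Let $k$ be a number field, let $n\ge 2$, and let $q_1,q_2\in k[x_0,\dots,x_n]$ be quadratic forms such that the scheme $X=\{q_1=q_2=0\}\subset\mathbf P^n_k$ is smooth over $k$ and of codimension $2$ in $\mathbf P^n_k$. Let $D\simeq\mathbf P^1_k$ be the pencil of quadrics $\lambda q_1+\mu q_2=0$ (the quadrics containing $X$), let $(\mathbf P^n_k)^\star$ be the dual projective space, and let $$Z=\{(q,h)\in D\times_k(\mathbf P^n_k)^\star : q\cap h \text{ is singular}\},$$ where "$q\cap h$ is singular" means that the scheme $q\cap h$ is not smooth of dimension $n-2$. Then $Z$ is a closed subset of $D\times_k(\mathbf P^n_k)^\star$. Endowed with its reduced scheme structure, $Z$ is integral, and the second projection $Z\to(\mathbf P^n_k)^\star$ is finite and flat, with geometric generic fibre consisting of exactly $n$ points. The monodromy group of this cover (the group of permutations of the geometric generic fibre induced by the absolute Galois group of the function field $K$ of $(\mathbf P^n_k)^\star$) is isomorphic to the symmetric group $\mathfrak S_n$; so is its geometric monodromy group (the subgroup induced by the automorphisms of $\overline K$ over $K$ that fix every element of $\overline K$ algebraic over $k$). -/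

import Mathlib

open AlgebraicGeometry CategoryTheory

universe u

noncomputable section

namespace QuadricPencil

/-! ### Projective schemes over a field -/

/-- The structure morphism `Proj A ⟶ Spec k` of an `ℕ`-graded `k`-algebra `A`. -/
def projToSpec {k A : Type u} [Field k] [CommRing A] [Algebra k A]
    (𝒜 : ℕ → Submodule k A) [GradedAlgebra 𝒜] : Proj 𝒜 ⟶ Spec (CommRingCat.of k) :=
  Proj.toSpecZero 𝒜 ≫ Spec.map (CommRingCat.ofHom (algebraMap k (𝒜 0)))

/-- The grading of `k[x₀, …, xₙ]` by the degree. -/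
abbrev polyGrading (n : ℕ) (k : Type u) [Field k] :
    ℕ → Submodule k (MvPolynomial (Fin (n + 1)) k) :=
  MvPolynomial.homogeneousSubmodule (Fin (n + 1)) k

instance gradedAlgebra_polyGrading (n : ℕ) (k : Type u) [Field k] :
    GradedAlgebra (polyGrading n k) :=
  MvPolynomial.gradedAlgebra

/-- Projective `n`-space over `k`. -/
abbrev projSpace (n : ℕ) (k : Type u) [Field k] : Scheme.{u} :=
  Proj (polyGrading n k)

/-- The structure morphism of projective space. -/
abbrev projSpaceToSpec (n : ℕ) (k : Type u) [Field k] :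
    projSpace n k ⟶ Spec (CommRingCat.of k) :=
  projToSpec (polyGrading n k)

instance irreducibleSpace_projSpace (n : ℕ) (k : Type u) [Field k] :
    IrreducibleSpace (projSpace n k) := by
  let η : ProjectiveSpectrum (polyGrading n k) :=
    { asHomogeneousIdeal := ⊥
      isPrime := by
        rw [HomogeneousIdeal.toIdeal_bot]
        exact Ideal.isPrime_bot
      not_irrelevant_le := by
        intro h
        have hX : (MvPolynomial.X 0 : MvPolynomial (Fin (n + 1)) k) ∈
            HomogeneousIdeal.irrelevant (polyGrading n k) := by
          rw [HomogeneousIdeal.mem_irrelevant_iff, GradedRing.proj_apply]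
          exact DirectSum.decompose_of_mem_ne (polyGrading n k)
            (MvPolynomial.isHomogeneous_X k (0 : Fin (n + 1))) one_ne_zero
        have h0 := h hX
        exact MvPolynomial.X_ne_zero (R := k) (0 : Fin (n + 1)) h0 }
  have hη : closure ({η} : Set (ProjectiveSpectrum (polyGrading n k))) = Set.univ := by
    refine Set.eq_univ_of_forall fun x => ?_
    have hle : η ≤ x := by
      change (⊥ : HomogeneousIdeal (polyGrading n k)) ≤ x.asHomogeneousIdeal
      exact bot_le
    exact (ProjectiveSpectrum.le_iff_mem_closure (polyGrading n k) η x).mp hle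
  have hirr : IsIrreducible (Set.univ : Set (ProjectiveSpectrum (polyGrading n k))) :=
    hη ▸ isIrreducible_singleton.closure
  have : IrreducibleSpace (ProjectiveSpectrum (polyGrading n k)) :=
    (irreducibleSpace_def _).mpr hirr
  exact this

/-- The `K`-point `[v₀ : … : vₙ]` of projective `n`-space over `k`, for an extension field `K`
of `k` and a nonzero vector `v` of homogeneous coordinates in `K`. -/
def pointOfCoords {n : ℕ} (k : Type u) [Field k] {K : Type u} [Field K] [Algebra k K]
    (v : Fin (n + 1) → K) (hv : v ≠ 0) : Spec (CommRingCat.of K) ⟶ projSpace n k :=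
  Proj.fromOfGlobalSections (polyGrading n k)
    ((Scheme.ΓSpecIso (CommRingCat.of K)).inv.hom.comp (MvPolynomial.aeval v).toRingHom) (by
      obtain ⟨j, hj⟩ := Function.ne_iff.mp hv
      refine Ideal.eq_top_of_isUnit_mem _ (x := (Scheme.ΓSpecIso (CommRingCat.of K)).inv.hom (v j))
        ?_ ((isUnit_iff_ne_zero.mpr hj).map _)
      have hX : (MvPolynomial.X j : MvPolynomial (Fin (n + 1)) k) ∈
          (HomogeneousIdeal.irrelevant (polyGrading n k)).toIdeal := by
        change _ ∈ HomogeneousIdeal.irrelevant (polyGrading n k)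
        rw [HomogeneousIdeal.mem_irrelevant_iff, GradedRing.proj_apply]
        exact DirectSum.decompose_of_mem_ne (polyGrading n k)
          (MvPolynomial.isHomogeneous_X k j) one_ne_zero
      have := Ideal.mem_map_of_mem
        ((Scheme.ΓSpecIso (CommRingCat.of K)).inv.hom.comp
          (MvPolynomial.aeval (R := k) v).toRingHom) hX
      simpa using this)

/-! ### Closed subschemes of projective space -/

/-- The grading induced on `k[x₀, …, xₙ] / I` by a homogeneous ideal `I`. -/
def quotGrading {n : ℕ} {k : Type u} [Field k] (I : HomogeneousIdeal (polyGrading n k)) (i : ℕ) :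
    Submodule k (MvPolynomial (Fin (n + 1)) k ⧸ I.toIdeal) :=
  (polyGrading n k i).map (Ideal.Quotient.mkₐ k I.toIdeal).toLinearMap

instance gradedMonoid_quotGrading {n : ℕ} {k : Type u} [Field k]
    (I : HomogeneousIdeal (polyGrading n k)) : SetLike.GradedMonoid (quotGrading I) where
  one_mem := ⟨1, SetLike.GradedOne.one_mem, map_one (Ideal.Quotient.mkₐ k I.toIdeal)⟩
  mul_mem := by
    rintro i j _ _ ⟨a, ha, rfl⟩ ⟨b, hb, rfl⟩
    exact ⟨a * b, SetLike.GradedMul.mul_mem ha hb,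
      map_mul (Ideal.Quotient.mkₐ k I.toIdeal) a b⟩

/-- The reduction `k[x₀, …, xₙ]ᵢ → (k[x₀, …, xₙ] / I)ᵢ` in degree `i`. -/
def quotComponent {n : ℕ} {k : Type u} [Field k] (I : HomogeneousIdeal (polyGrading n k)) (i : ℕ) :
    polyGrading n k i →+ quotGrading I i where
  toFun x := ⟨Ideal.Quotient.mk I.toIdeal x.1, x.1, x.2, rfl⟩
  map_zero' := rfl
  map_add' _ _ := rfl

/-- The component-wise reduction `⨁ᵢ k[x₀, …, xₙ]ᵢ → ⨁ᵢ (k[x₀, …, xₙ] / I)ᵢ`. -/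
def quotComponents {n : ℕ} {k : Type u} [Field k] (I : HomogeneousIdeal (polyGrading n k)) :
    DirectSum ℕ (fun i => polyGrading n k i) →+ DirectSum ℕ (fun i => quotGrading I i) :=
  DirectSum.map (quotComponent I)

lemma coe_quotComponents {n : ℕ} {k : Type u} [Field k] (I : HomogeneousIdeal (polyGrading n k))
    (d : DirectSum ℕ (fun i => polyGrading n k i)) :
    DirectSum.coeAddMonoidHom (quotGrading I) (quotComponents I d) =
      Ideal.Quotient.mk I.toIdeal (DirectSum.coeAddMonoidHom (polyGrading n k) d) := by
  induction d using DirectSum.induction_on with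
  | zero => simp only [map_zero]
  | of i x =>
    rw [quotComponents, DirectSum.map_of, DirectSum.coeAddMonoidHom_of,
      DirectSum.coeAddMonoidHom_of]
    rfl
  | add x y hx hy => simp only [map_add, hx, hy]

lemma quotComponents_decompose_of_mem {n : ℕ} {k : Type u} [Field k]
    (I : HomogeneousIdeal (polyGrading n k)) (x : MvPolynomial (Fin (n + 1)) k)
    (hx : x ∈ I.toIdeal) : quotComponents I (DirectSum.decompose (polyGrading n k) x) = 0 := by
  refine DFinsupp.ext fun i => Subtype.ext ?_
  exact Ideal.Quotient.eq_zero_iff_mem.mpr (I.isHomogeneous i hx)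

/-- The decomposition of a class modulo `I` into its homogeneous components. -/
def quotDecompose {n : ℕ} {k : Type u} [Field k] (I : HomogeneousIdeal (polyGrading n k)) :
    (MvPolynomial (Fin (n + 1)) k ⧸ I.toIdeal) →+ DirectSum ℕ (fun i => quotGrading I i) :=
  QuotientAddGroup.lift I.toIdeal.toAddSubgroup
    ((quotComponents I).comp (DirectSum.decomposeAddEquiv (polyGrading n k)).toAddMonoidHom)
    (fun x hx => quotComponents_decompose_of_mem I x hx)

lemma quotDecompose_mk {n : ℕ} {k : Type u} [Field k] (I : HomogeneousIdeal (polyGrading n k))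
    (x : MvPolynomial (Fin (n + 1)) k) :
    quotDecompose I (Ideal.Quotient.mk I.toIdeal x) =
      quotComponents I (DirectSum.decompose (polyGrading n k) x) := rfl

instance decomposition_quotGrading {n : ℕ} {k : Type u} [Field k]
    (I : HomogeneousIdeal (polyGrading n k)) : DirectSum.Decomposition (quotGrading I) where
  decompose' := quotDecompose I
  left_inv y := by
    obtain ⟨x, rfl⟩ := Ideal.Quotient.mk_surjective y
    rw [quotDecompose_mk, coe_quotComponents]
    exact congrArg _ ((DirectSum.decompose (polyGrading n k)).symm_apply_apply x)
  right_inv d := by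
    induction d using DirectSum.induction_on with
    | zero => simp only [map_zero]
    | of i x =>
      obtain ⟨_, y, hy, rfl⟩ := x
      rw [DirectSum.coeAddMonoidHom_of]
      change quotDecompose I (Ideal.Quotient.mk I.toIdeal y) = _
      rw [quotDecompose_mk, DirectSum.decompose_of_mem (polyGrading n k) hy, quotComponents,
        DirectSum.map_of]
      rfl
    | add x y hx hy => simp only [map_add, hx, hy]

instance gradedAlgebra_quotGrading {n : ℕ} {k : Type u} [Field k]
    (I : HomogeneousIdeal (polyGrading n k)) : GradedAlgebra (quotGrading I) where

/-- The homogeneous ideal `(f, g)` generated by two forms `f`, `g`. -/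
def pairIdeal {n : ℕ} {k : Type u} [Field k] {d e : ℕ} {f g : MvPolynomial (Fin (n + 1)) k}
    (hf : f.IsHomogeneous d) (hg : g.IsHomogeneous e) : HomogeneousIdeal (polyGrading n k) :=
  ⟨Ideal.span {f, g}, Ideal.homogeneous_span _ _ (by
    rintro x (rfl | rfl)
    · exact ⟨d, hf⟩
    · exact ⟨e, hg⟩)⟩

/-- The closed subscheme `f = g = 0` of projective space, namely `Proj (k[x₀, …, xₙ] / (f, g))`. -/
abbrev projIntersection {n : ℕ} {k : Type u} [Field k] {d e : ℕ}
    {f g : MvPolynomial (Fin (n + 1)) k}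
    (hf : f.IsHomogeneous d) (hg : g.IsHomogeneous e) : Scheme.{u} :=
  Proj (quotGrading (pairIdeal hf hg))

/-- `f = g = 0` is a smooth `k`-scheme, of codimension `2` in projective `n`-space
(that is, smooth of relative dimension `n - 2` over `k`; meant for `2 ≤ n`). -/
def IsSmoothIntersection {n : ℕ} {k : Type u} [Field k] {d e : ℕ}
    {f g : MvPolynomial (Fin (n + 1)) k}
    (hf : f.IsHomogeneous d) (hg : g.IsHomogeneous e) : Prop :=
  SmoothOfRelativeDimension (n - 2) (projToSpec (quotGrading (pairIdeal hf hg)))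

/-! ### The pencil and the singular hyperplane sections of its members -/

/-- The member `u₀ q₁ + u₁ q₂` of the pencil spanned by `q₁` and `q₂`, over an extension `K`. -/
def pencilForm {n : ℕ} {k : Type u} [Field k] {K : Type u} [Field K] [Algebra k K]
    (q₁ q₂ : MvPolynomial (Fin (n + 1)) k) (u : Fin 2 → K) : MvPolynomial (Fin (n + 1)) K :=
  MvPolynomial.C (u 0) * MvPolynomial.map (algebraMap k K) q₁ +
    MvPolynomial.C (u 1) * MvPolynomial.map (algebraMap k K) q₂

lemma pencilForm_isHomogeneous {n : ℕ} {k : Type u} [Field k] {K : Type u} [Field K] [Algebra k K]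
    {q₁ q₂ : MvPolynomial (Fin (n + 1)) k} (h₁ : q₁.IsHomogeneous 2) (h₂ : q₂.IsHomogeneous 2)
    (u : Fin 2 → K) : (pencilForm q₁ q₂ u).IsHomogeneous 2 :=
  ((h₁.map _).C_mul _).add ((h₂.map _).C_mul _)

/-- The equation `a₀ x₀ + … + aₙ xₙ` of the hyperplane with dual coordinates `a`. -/
def hyperplaneForm {n : ℕ} {K : Type u} [Field K] (a : Fin (n + 1) → K) :
    MvPolynomial (Fin (n + 1)) K :=
  ∑ i, MvPolynomial.C (a i) * MvPolynomial.X i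

lemma hyperplaneForm_isHomogeneous {n : ℕ} {K : Type u} [Field K] (a : Fin (n + 1) → K) :
    (hyperplaneForm a).IsHomogeneous 1 :=
  MvPolynomial.IsHomogeneous.sum _ _ _ fun i _ => (MvPolynomial.isHomogeneous_X K i).C_mul _

/-- The product `D ×ₖ (ℙⁿ)^*`, where the pencil `D` is identified with the projective line through
`[u₀ : u₁] ↦ (u₀ q₁ + u₁ q₂ = 0)`, and the dual space `(ℙⁿ)^*` with projective `n`-space through
`[a₀ : … : aₙ] ↦ (a₀ x₀ + … + aₙ xₙ = 0)`. -/
abbrev pencilProd (n : ℕ) (k : Type u) [Field k] : Scheme.{u} :=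
  Limits.pullback (projSpaceToSpec 1 k) (projSpaceToSpec n k)

/-- The set of points `(q, h)` of `D ×ₖ (ℙⁿ)^*` such that the quadric `q ∩ h` of `h` is singular,
i.e. is not smooth of dimension `n - 2`. A point belongs to this set when it is the image of a
`K`-point `([u₀ : u₁], [a₀ : … : aₙ])`, `K` an extension field of `k`, with `q ∩ h` singular. -/
def singularSections {n : ℕ} {k : Type u} [Field k] {q₁ q₂ : MvPolynomial (Fin (n + 1)) k}
    (h₁ : q₁.IsHomogeneous 2) (h₂ : q₂.IsHomogeneous 2) : Set (pencilProd n k) :=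
  {z | ∃ (K : Type u) (_ : Field K) (_ : Algebra k K)
      (u : Fin 2 → K) (hu : u ≠ 0) (a : Fin (n + 1) → K) (ha : a ≠ 0)
      (p : Spec (CommRingCat.of K) ⟶ pencilProd n k),
      p ≫ Limits.pullback.fst _ _ = pointOfCoords k u hu ∧
      p ≫ Limits.pullback.snd _ _ = pointOfCoords k a ha ∧
      z ∈ Set.range p ∧
      ¬ IsSmoothIntersection (pencilForm_isHomogeneous h₁ h₂ u) (hyperplaneForm_isHomogeneous a)}

/-- The ideal sheaf of `Z`, the set of singular sections with its reduced scheme structure.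
(This set is in fact closed when `q₁ = q₂ = 0` is smooth of codimension `2`; the closure is only
taken in order to have a definition in all cases.) -/
def singularIdeal {n : ℕ} {k : Type u} [Field k] {q₁ q₂ : MvPolynomial (Fin (n + 1)) k}
    (h₁ : q₁.IsHomogeneous 2) (h₂ : q₂.IsHomogeneous 2) :
    (pencilProd n k).IdealSheafData :=
  Scheme.IdealSheafData.vanishingIdeal ⟨closure (singularSections h₁ h₂), isClosed_closure⟩

/-- The scheme `Z = {(q, h) : q ∩ h is singular}`. -/
abbrev singularScheme {n : ℕ} {k : Type u} [Field k] {q₁ q₂ : MvPolynomial (Fin (n + 1)) k}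
    (h₁ : q₁.IsHomogeneous 2) (h₂ : q₂.IsHomogeneous 2) : Scheme.{u} :=
  (singularIdeal h₁ h₂).subscheme

/-- The second projection `Z ⟶ (ℙⁿ)^*`. -/
def singularProj {n : ℕ} {k : Type u} [Field k] {q₁ q₂ : MvPolynomial (Fin (n + 1)) k}
    (h₁ : q₁.IsHomogeneous 2) (h₂ : q₂.IsHomogeneous 2) :
    singularScheme h₁ h₂ ⟶ projSpace n k :=
  (singularIdeal h₁ h₂).subschemeι ≫ Limits.pullback.snd _ _

/-! ### Monodromy -/

/-- The function field of an irreducible scheme `Y`: the residue field at its generic point. -/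
abbrev genericField (Y : Scheme.{u}) [IrreducibleSpace Y] : CommRingCat.{u} :=
  Y.residueField (genericPoint Y)

/-- An algebraic closure of the function field. -/
abbrev genericClosure (Y : Scheme.{u}) [IrreducibleSpace Y] : Type u :=
  AlgebraicClosure (genericField Y)

/-- The absolute Galois group of the function field. -/
abbrev genericGalois (Y : Scheme.{u}) [IrreducibleSpace Y] : Type u :=
  genericClosure Y ≃ₐ[genericField Y] genericClosure Y

/-- The geometric generic point of `Y`. -/
def geometricGenericPoint (Y : Scheme.{u}) [IrreducibleSpace Y] :
    Spec (CommRingCat.of (genericClosure Y)) ⟶ Y :=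
  Spec.map (CommRingCat.ofHom (algebraMap (genericField Y) (genericClosure Y))) ≫
    Y.fromSpecResidueField (genericPoint Y)

/-- The set of geometric points of `Z` above the geometric generic point of `Y`. -/
def GenericFibre {Z Y : Scheme.{u}} [IrreducibleSpace Y] (f : Z ⟶ Y) : Type u :=
  {x : Spec (CommRingCat.of (genericClosure Y)) ⟶ Z // x ≫ f = geometricGenericPoint Y}

lemma specMap_galois_comp (Y : Scheme.{u}) [IrreducibleSpace Y] (σ : genericGalois Y) :
    Spec.map (CommRingCat.ofHom (σ : genericClosure Y →+* genericClosure Y)) ≫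
      geometricGenericPoint Y = geometricGenericPoint Y := by
  rw [geometricGenericPoint, ← Category.assoc, ← Spec.map_comp, ← CommRingCat.ofHom_comp]
  congr 3
  exact RingHom.ext fun x => σ.commutes x

/-- The Galois action on the geometric generic fibre of a morphism. -/
instance genericFibreAction {Z Y : Scheme.{u}} [IrreducibleSpace Y] (f : Z ⟶ Y) :
    MulAction (genericGalois Y) (GenericFibre f) where
  smul σ x := ⟨Spec.map (CommRingCat.ofHom (σ : genericClosure Y →+* genericClosure Y)) ≫ x.1, by
    rw [Category.assoc, x.2, specMap_galois_comp]⟩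
  one_smul x := by
    refine Subtype.ext ?_
    change Spec.map (𝟙 (CommRingCat.of (genericClosure Y))) ≫ x.1 = x.1
    rw [Spec.map_id, Category.id_comp]
  mul_smul σ τ x := by
    refine Subtype.ext ?_
    change Spec.map (CommRingCat.ofHom (τ : genericClosure Y →+* genericClosure Y) ≫
        CommRingCat.ofHom (σ : genericClosure Y →+* genericClosure Y)) ≫ x.1 =
      Spec.map (CommRingCat.ofHom (σ : genericClosure Y →+* genericClosure Y)) ≫
        Spec.map (CommRingCat.ofHom (τ : genericClosure Y →+* genericClosure Y)) ≫ x.1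
    rw [Spec.map_comp, Category.assoc]

/-- The monodromy group of a (generically finite étale) cover `f : Z ⟶ Y`: the group of
permutations of the geometric generic fibre induced by the absolute Galois group of the function
field of `Y`, or equivalently by the fundamental group of the open set over which `f` is étale. -/
def monodromyGroup {Z Y : Scheme.{u}} [IrreducibleSpace Y] (f : Z ⟶ Y) :
    Subgroup (Equiv.Perm (GenericFibre f)) :=
  (MulAction.toPermHom (genericGalois Y) (GenericFibre f)).range

/-- For `Y` over a field `k`, the automorphisms fixing every element which is algebraic over `k`:
the absolute Galois group of the compositum of the function field and an algebraic closure
of `k`. -/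
def geometricGalois {Y : Scheme.{u}} [IrreducibleSpace Y] {k : Type u} [Field k]
    (s : Y ⟶ Spec (CommRingCat.of k)) : Subgroup (genericGalois Y) where
  carrier := {σ | ∀ x : genericClosure Y,
    (Spec.preimage (geometricGenericPoint Y ≫ s)).hom.IsIntegralElem x → σ x = x}
  one_mem' _ _ := rfl
  mul_mem' {σ τ} hσ hτ x hx := by
    rw [AlgEquiv.mul_apply, hτ x hx, hσ x hx]
  inv_mem' {σ} hσ x hx := by
    change σ.symm x = x
    rw [AlgEquiv.symm_apply_eq, hσ x hx]

/-- The geometric monodromy group of `f : Z ⟶ Y`, for `Y` over a field `k`: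
the monodromy group over an algebraic closure of `k`. -/
def geometricMonodromyGroup {Z Y : Scheme.{u}} [IrreducibleSpace Y] (f : Z ⟶ Y)
    {k : Type u} [Field k] (s : Y ⟶ Spec (CommRingCat.of k)) :
    Subgroup (Equiv.Perm (GenericFibre f)) :=
  (geometricGalois s).map (MulAction.toPermHom (genericGalois Y) (GenericFibre f))

end QuadricPencil

end

open QuadricPencil

/-! Let A, B be the Gram matrices of q₁, q₂ and M = u₀A + u₁B. By the Jacobian criterion
(`isSmoothIntersection_iff`) the section of M by a·x = 0 is singular exactly when some x ≠ 0
satisfies a·x = 0 and Mx is proportional to a. This is the vanishing of a bordered determinant,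
which is up to sign the dual form aᵗ adj(M) a (`dualForm_eq_zero_iff`,
`isSmoothIntersection_pencilForm_iff`). So Z is the zero locus of a form of degree n in u and 2 in
a.

Smoothness of X means that Ax and Bx are independent at every base point x of the pencil. Hence the
general member S = lA + B is nondegenerate, and over an algebraically closed field S and A become 1
and diag(θ) with distinct θᵢ (`TransversePencil.exists_diagonalization`). In the new coordinates b
of the hyperplane, the equation for A + tS reads g(t) = ∑ bᵢ² ∏_{j≠i} (t + θⱼ), which is nonzero if
b ≠ 0. So every hyperplane is non-tangent to some S with l in k. Where the dual form F of S does not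
vanish, no singular section has u = [l : 1], so t = u₁/(u₀ − l u₁) is a coordinate, and the equation
divided by F is monic of degree n in t (`monic_chartPoly`).

For the monodromy, let L be an algebraic closure of the function field, E the algebraic closure of k
in L, and ρ₁, …, ρₙ the roots of g at the generic hyperplane. Evaluating g at −θᵢ shows that bᵢ² is
∏ⱼ (ρⱼ + θᵢ) up to a constant of E and a factor independent of i. Hence the ratios bᵢ/b₀ are
algebraic over E(ρ); counting transcendence degrees, the ρⱼ are independent, and each permutation of
them extends to an E-automorphism of L. It preserves the squares of the ratios, so it moves the
ratios only by signs. The ρⱼ + θᵢ are distinct primes of E[ρ], so these square roots are independent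
modulo E(ρ), and Kummer theory repairs the signs without moving ρ
(`exists_algEquiv_roots_secularPoly`). The result fixes the function field and all constants and
induces the given permutation. Thus the geometric monodromy group is already the full symmetric
group.

Transitivity on n distinct roots makes the monic equation irreducible over the function field, hence
prime over the coordinate ring of the base (`GoodParam.isPrime_span_poly`). So the reduced scheme Z
is, over the chart F ≠ 0, the spectrum of a free algebra of finite rank which is a domain. This
gives finiteness and flatness; the charts all meet above the generic point, so Z is integral. -/

noncomputable section

namespace QuadricPencil

/-! ### The dual of a quadratic form -/

section LinearAlgebra

open Matrix Polynomial

variable {n : ℕ}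

/-- The quadratic form of the adjugate of `M`: up to a factor, the dual of the quadric of `M`. -/
def dualForm {ι R : Type*} [Fintype ι] [DecidableEq ι] [CommRing R] (M : Matrix ι ι R)
    (a : ι → R) : R :=
  a ⬝ᵥ (M.adjugate *ᵥ a)

lemma map_dualForm {ι R S : Type*} [Fintype ι] [DecidableEq ι] [CommRing R] [CommRing S]
    (f : R →+* S) (M : Matrix ι ι R) (a : ι → R) :
    f (dualForm M a) = dualForm (M.map f) (f ∘ a) := by
  have h := f.map_adjugate M
  simp only [RingHom.mapMatrix_apply] at h
  have h' : f ∘ (M.adjugate *ᵥ a) = M.adjugate.map f *ᵥ (f ∘ a) :=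
    funext fun i => RingHom.map_mulVec f _ _ i
  rw [dualForm, dualForm, ← h, RingHom.map_dotProduct, h']

/-- The adjugate reverses products, and the adjugates of `Q` and `Qᵀ` cancel the coordinate change
on both sides, each at the cost of one `det Q`. -/
lemma dualForm_congr {ι R : Type*} [Fintype ι] [DecidableEq ι] [CommRing R] (M Q : Matrix ι ι R)
    (a : ι → R) : dualForm (Qᵀ * M * Q) (Qᵀ *ᵥ a) = Q.det ^ 2 * dualForm M a := by
  have h1 : (Qᵀ).adjugate *ᵥ (Qᵀ *ᵥ a) = Q.det • a := by
    rw [mulVec_mulVec, adjugate_mul, det_transpose, smul_mulVec, one_mulVec]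
  have h2 : (Qᵀ *ᵥ a) ᵥ* Q.adjugate = Q.det • a := by
    rw [← mulVec_transpose, adjugate_transpose, h1]
  rw [dualForm, adjugate_mul_distrib, adjugate_mul_distrib, ← mulVec_mulVec, ← mulVec_mulVec, h1,
    dotProduct_mulVec, h2, dualForm, mulVec_smul, smul_dotProduct, dotProduct_smul, smul_smul,
    smul_eq_mul, sq]

lemma dualForm_diagonal {ι R : Type*} [Fintype ι] [DecidableEq ι] [CommRing R] (d a : ι → R) :
    dualForm (diagonal d) a = ∑ i, a i ^ 2 * ∏ j ∈ Finset.univ.erase i, d j := by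
  rw [dualForm, adjugate_diagonal, dotProduct]
  refine Finset.sum_congr rfl fun i _ => ?_
  rw [mulVec_diagonal]
  ring

lemma dualForm_smul {R : Type*} [CommRing R] (c : R) (M : Matrix (Fin (n + 1)) (Fin (n + 1)) R)
    (a : Fin (n + 1) → R) : dualForm (c • M) a = c ^ n * dualForm M a := by
  rw [dualForm, adjugate_smul, smul_mulVec, dotProduct_smul, smul_eq_mul, dualForm,
    Fintype.card_fin, Nat.add_sub_cancel]

/-- Schur complement of the invertible block, together with `adj M = det M • M⁻¹`. -/
lemma det_bordered_of_isUnit {ι R : Type*} [Fintype ι] [DecidableEq ι] [CommRing R]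
    (M : Matrix ι ι R) (a : ι → R) (hM : IsUnit M.det) :
    (fromBlocks M (replicateCol Unit a) (replicateRow Unit a) 0).det = - dualForm M a := by
  let := M.invertibleOfIsUnitDet hM
  have h : M.adjugate = M.det • ⅟M := by
    rw [invOf_eq_nonsing_inv, inv_def, smul_smul, Ring.mul_inverse_cancel _ hM, one_smul]
  rw [det_fromBlocks₁₁, dualForm, h, det_unique (n := Unit), smul_mulVec, dotProduct_smul,
    smul_eq_mul]
  simp [Matrix.mul_apply, dotProduct, mulVec, Finset.sum_mul, Finset.mul_sum]
  rw [Finset.sum_comm]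
  refine Finset.sum_congr rfl fun i _ => Finset.sum_congr rfl fun j _ => by ring

/-- Invertibility is removed by deformation: `X • 1 + M` has monic determinant, so it is invertible
over `K(X)`; the identity then holds in `K[X]` and specializes at `X = 0`. -/
lemma det_bordered {ι K : Type*} [Fintype ι] [DecidableEq ι] [Field K]
    (M : Matrix ι ι K) (a : ι → K) :
    (fromBlocks M (replicateCol Unit a) (replicateRow Unit a) 0).det = - dualForm M a := by
  let M' : Matrix ι ι K[X] := (X : K[X]) • (1 : Matrix ι ι K).map C + M.map C
  have hM' : M'.det ≠ 0 := by
    intro h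
    have := coeff_det_X_add_C_card (1 : Matrix ι ι K) M
    rw [det_one] at this
    change M'.det.coeff _ = 1 at this
    rw [h, coeff_zero] at this
    exact zero_ne_one this
  have key : (fromBlocks M' (replicateCol Unit (C ∘ a)) (replicateRow Unit (C ∘ a)) 0).det =
      - dualForm M' (C ∘ a) := by
    apply IsFractionRing.injective K[X] (RatFunc K)
    rw [RingHom.map_det, map_neg, map_dualForm, ← det_bordered_of_isUnit]
    · congr 1
      ext i j
      rcases i with i | i <;> rcases j with j | j <;> simp
    · rw [← RingHom.mapMatrix_apply, ← RingHom.map_det]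
      exact isUnit_iff_ne_zero.mpr
        ((map_ne_zero_iff _ (IsFractionRing.injective K[X] (RatFunc K))).mpr hM')
  have h0 := congrArg (evalRingHom (0 : K)) key
  have hM0 : M'.map (evalRingHom (0 : K)) = M := by
    ext i j
    simp [M']
  rw [RingHom.map_det, map_neg, map_dualForm, hM0] at h0
  convert h0 using 2
  · ext i j
    rcases i with i | i <;> rcases j with j | j <;> simp [M']
  · congr 1
  · congr 1
    exact funext fun i => eval_C.symm

/-- A kernel vector of the bordered matrix is a pair `(x, -s)`. Since `a ≠ 0`, its first component
cannot vanish. Geometrically, `x` is a singular point of the hyperplane section. -/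
lemma dualForm_eq_zero_iff {ι K : Type*} [Fintype ι] [DecidableEq ι] [Field K]
    (M : Matrix ι ι K) (a : ι → K) (ha : a ≠ 0) :
    dualForm M a = 0 ↔ ∃ x ≠ 0, ∃ s : K, M *ᵥ x = s • a ∧ a ⬝ᵥ x = 0 := by
  rw [← neg_eq_zero, ← det_bordered, ← exists_mulVec_eq_zero_iff]
  constructor
  · rintro ⟨v, hv, h⟩
    have h1 : M *ᵥ (v ∘ Sum.inl) + v (Sum.inr ()) • a = 0 := by
      ext i
      have := congrFun h (Sum.inl i)
      simpa [mulVec, dotProduct, Fintype.sum_sum_type, mul_comm] using this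
    have h2 : a ⬝ᵥ (v ∘ Sum.inl) = 0 := by
      have := congrFun h (Sum.inr ())
      simpa [mulVec, dotProduct, Fintype.sum_sum_type] using this
    refine ⟨v ∘ Sum.inl, ?_, - v (Sum.inr ()), ?_, h2⟩
    · intro h0
      rw [h0, mulVec_zero, zero_add] at h1
      refine hv (funext fun i => ?_)
      rcases i with i | i
      · exact congrFun h0 i
      · exact (smul_eq_zero.mp h1).resolve_right ha
    · rw [neg_smul, eq_neg_iff_add_eq_zero, h1]
  · rintro ⟨x, hx, s, h1, h2⟩
    refine ⟨Sum.elim x fun _ => -s, fun h0 => hx (funext fun i => congrFun h0 (Sum.inl i)), ?_⟩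
    ext i
    rcases i with i | i
    · have := congrFun h1 i
      simp only [mulVec, dotProduct, Pi.smul_apply, smul_eq_mul] at this
      simp [mulVec, dotProduct, Fintype.sum_sum_type, this]
      ring
    · simpa [mulVec, dotProduct, Fintype.sum_sum_type] using h2

/-! ### Pencils of quadratic forms -/

/-- The quadrics of two symmetric matrices intersect transversally: the pencil they span has a
smooth base locus. -/
def TransversePencil {ι K : Type*} [Fintype ι] [Field K] (A B : Matrix ι ι K) : Prop :=
  ∀ x ≠ 0, x ⬝ᵥ A *ᵥ x = 0 → x ⬝ᵥ B *ᵥ x = 0 → LinearIndependent K ![A *ᵥ x, B *ᵥ x]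

lemma dotProduct_mulVec_comm_of_isSymm {ι R : Type*} [Fintype ι] [CommRing R] {A : Matrix ι ι R}
    (hA : A.IsSymm) (x y : ι → R) : x ⬝ᵥ A *ᵥ y = y ⬝ᵥ A *ᵥ x := by
  rw [dotProduct_mulVec, ← mulVec_transpose, hA.eq, dotProduct_comm]

/-- A subspace without nonzero isotropic vectors has dimension at most one. -/
lemma exists_eq_smul_of_anisotropic {ι E : Type*} [Fintype ι] [Field E] [IsAlgClosed E]
    {S : Matrix ι ι E} (hS : S.IsSymm) (W : Submodule E (ι → E))
    (hW : ∀ x ∈ W, x ≠ 0 → x ⬝ᵥ S *ᵥ x ≠ 0) {x y : ι → E} (hx : x ∈ W) (hy : y ∈ W)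
    (hx0 : x ≠ 0) : ∃ c : E, c • x = y := by
  set α := x ⬝ᵥ S *ᵥ x with hα
  have hα0 : α ≠ 0 := hW x hx hx0
  set c := (x ⬝ᵥ S *ᵥ y) / α with hc
  refine ⟨c, ?_⟩
  by_contra hne
  set y' := y - c • x with hy'
  have hy'W : y' ∈ W := W.sub_mem hy (W.smul_mem _ hx)
  have hy'0 : y' ≠ 0 := fun h => hne (sub_eq_zero.mp h).symm
  have horth : x ⬝ᵥ S *ᵥ y' = 0 := by
    rw [hy', mulVec_sub, dotProduct_sub, mulVec_smul, dotProduct_smul, smul_eq_mul, hc,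
      div_mul_cancel₀ _ hα0, sub_self]
  have horth' : y' ⬝ᵥ S *ᵥ x = 0 := by rw [dotProduct_mulVec_comm_of_isSymm hS, horth]
  set β := y' ⬝ᵥ S *ᵥ y' with hβ
  have hβ0 : β ≠ 0 := hW y' hy'W hy'0
  -- As `x` and `y'` are orthogonal with values `α`, `β`, the condition `d² = -α/β` makes `x + d y'`
  -- isotropic.
  obtain ⟨d, hd⟩ := IsAlgClosed.exists_pow_nat_eq (-α / β) (n := 2) two_pos
  set z := x + d • y' with hz
  have hxz : x ⬝ᵥ S *ᵥ z = α := by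
    rw [hz, mulVec_add, dotProduct_add, mulVec_smul, dotProduct_smul, horth, smul_zero, add_zero]
  have hz0 : z ≠ 0 := by
    intro h
    rw [h, mulVec_zero, dotProduct_zero] at hxz
    exact hα0 hxz.symm
  refine hW z (W.add_mem hx (W.smul_mem _ hy'W)) hz0 ?_
  have h1 : y' ⬝ᵥ S *ᵥ z = d * β := by
    rw [hz, mulVec_add, dotProduct_add, mulVec_smul, dotProduct_smul, horth', zero_add, smul_eq_mul]
  have h2 : z ⬝ᵥ S *ᵥ z = α + d * (d * β) := by
    conv_lhs => rw [hz, add_dotProduct, smul_dotProduct, ← hz, hxz, h1, smul_eq_mul]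
  rw [h2, ← mul_assoc, ← sq, hd, div_mul_cancel₀ _ hβ0, add_neg_cancel]

section Diagonalization

variable {ι E : Type*} [Fintype ι] [DecidableEq ι] [Field E] {A S : Matrix ι ι E}

omit [DecidableEq ι] in
-- An isotropic eigenvector would be a base point of the pencil at which the two gradients are
-- proportional.
lemma TransversePencil.dotProduct_ne_zero_of_eigen (h : TransversePencil A S) {θ : E} {x : ι → E}
    (hx : x ≠ 0) (hθ : A *ᵥ x = θ • S *ᵥ x) : x ⬝ᵥ S *ᵥ x ≠ 0 := by
  intro h0
  have hA0 : x ⬝ᵥ A *ᵥ x = 0 := by rw [hθ, dotProduct_smul, h0, smul_zero]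
  have := LinearIndependent.pair_iff.mp (h x hx hA0 h0) 1 (-θ)
    (by rw [hθ, one_smul, neg_smul, add_neg_cancel])
  exact one_ne_zero this.1

variable [IsAlgClosed E]

/-- There are no Jordan blocks: if `x = (f - θ) y` is an eigenvector, then by symmetry `x ⬝ S x = y
⬝ (A - θ S) x = 0`, which is excluded. So the generalized eigenspace consists of eigenvectors, is
anisotropic for `S`, and has dimension at most one. -/
lemma TransversePencil.rootMultiplicity_charpoly_le_one (hA : A.IsSymm) (hS : S.IsSymm)
    (hdet : IsUnit S.det) (h : TransversePencil A S) (θ : E) :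
    (S⁻¹ * A).charpoly.rootMultiplicity θ ≤ 1 := by
  set f : Module.End E (ι → E) := toLin' (S⁻¹ * A) with hf
  have hST : ∀ x, S *ᵥ (f x) = A *ᵥ x := fun x => by
    rw [hf, toLin'_apply, mulVec_mulVec, ← mul_assoc, mul_nonsing_inv _ hdet, one_mul]
  have heig : ∀ x, (f - θ • 1) x = 0 → A *ᵥ x = θ • S *ᵥ x := fun x hx => by
    have : f x = θ • x := by simpa [sub_eq_zero] using hx
    rw [← hST, this, mulVec_smul]
  have hsq : ∀ y, (f - θ • 1) ((f - θ • 1) y) = 0 → (f - θ • 1) y = 0 := by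
    intro y hy
    by_contra hne
    have h1 := heig _ hy
    refine h.dotProduct_ne_zero_of_eigen hne h1 ?_
    set x := (f - θ • 1) y with hx
    have h2 : S *ᵥ x = A *ᵥ y - θ • S *ᵥ y := by
      rw [hx, ← hST]
      simp [mulVec_sub, mulVec_smul]
    rw [h2, dotProduct_sub, dotProduct_smul, dotProduct_mulVec_comm_of_isSymm hA,
      dotProduct_mulVec_comm_of_isSymm hS x y, h1, dotProduct_smul, sub_self]
  have hker : ∀ (k : ℕ) (y), ((f - θ • 1) ^ k) y = 0 → (f - θ • 1) y = 0 := by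
    intro k
    induction k with
    | zero => intro y hy; rw [pow_zero, Module.End.one_apply] at hy; rw [hy, map_zero]
    | succ k ih =>
      intro y hy
      rw [pow_succ, Module.End.mul_apply] at hy
      exact hsq _ (ih _ hy)
  have hgen : ∀ y ∈ f.maxGenEigenspace θ, (f - θ • 1) y = 0 := fun y hy => by
    obtain ⟨k, hk⟩ := Module.End.mem_maxGenEigenspace f θ y |>.mp hy
    exact hker k y hk
  rw [← charpoly_toLin', ← LinearMap.finrank_maxGenEigenspace_eq]
  by_cases hbot : f.maxGenEigenspace θ = ⊥
  · rw [← hf, hbot, finrank_bot]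
    exact zero_le_one
  obtain ⟨x, hx, hx0⟩ := (Submodule.ne_bot_iff _).mp hbot
  refine finrank_le_one (⟨x, hx⟩ : f.maxGenEigenspace θ) fun y => ?_
  obtain ⟨c, hc⟩ := exists_eq_smul_of_anisotropic hS (f.maxGenEigenspace θ)
    (fun z hz hz0 => h.dotProduct_ne_zero_of_eigen hz0 (heig z (hgen z hz))) hx y.2 hx0
  exact ⟨c, Subtype.ext hc⟩

/-- Simultaneous diagonalization of a pencil with smooth base locus. -/
theorem TransversePencil.exists_diagonalization {n : ℕ} {A S : Matrix (Fin n) (Fin n) E}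
    (hA : A.IsSymm) (hS : S.IsSymm) (hdet : IsUnit S.det) (h : TransversePencil A S) :
    ∃ (Q : Matrix (Fin n) (Fin n) E) (θ : Fin n → E), Function.Injective θ ∧
      Qᵀ * S * Q = 1 ∧ Qᵀ * A * Q = diagonal θ := by
  classical
  set p := (S⁻¹ * A).charpoly with hp
  have hp0 : p ≠ 0 := (charpoly_monic _).ne_zero
  have hnodup : p.roots.Nodup := Multiset.nodup_iff_count_le_one.mpr fun θ => by
    rw [count_roots]
    exact h.rootMultiplicity_charpoly_le_one hA hS hdet θ
  have hcard : p.roots.toFinset.card = n := by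
    rw [Multiset.toFinset_card_of_nodup hnodup,
      ← (IsAlgClosed.splits p).natDegree_eq_card_roots, hp, charpoly_natDegree_eq_dim,
      Fintype.card_fin]
  let e := (p.roots.toFinset.equivFinOfCardEq hcard).symm
  let θ : Fin n → E := fun i => e i
  have hθ : Function.Injective θ := Subtype.val_injective.comp e.injective
  have hex : ∀ i, ∃ x : Fin n → E, x ⬝ᵥ S *ᵥ x = 1 ∧ A *ᵥ x = θ i • S *ᵥ x := by
    intro i
    have hroot : p.IsRoot (θ i) := (mem_roots hp0).mp (Multiset.mem_toFinset.mp (e i).2)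
    rw [hp, ← charpoly_toLin', ← Module.End.hasEigenvalue_iff_isRoot_charpoly] at hroot
    obtain ⟨x, hx⟩ := hroot.exists_hasEigenvector
    have h1 : A *ᵥ x = θ i • S *ᵥ x := by
      have := hx.apply_eq_smul
      rw [toLin'_apply] at this
      rw [← mulVec_smul, ← this, mulVec_mulVec, ← mul_assoc, mul_nonsing_inv _ hdet, one_mul]
    have h2 := h.dotProduct_ne_zero_of_eigen hx.2 h1
    -- The scalar `c` normalizes the eigenvector to length one for `S`.
    obtain ⟨c, hc⟩ := IsAlgClosed.exists_pow_nat_eq (x ⬝ᵥ S *ᵥ x)⁻¹ (n := 2) two_pos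
    refine ⟨c • x, ?_, by rw [mulVec_smul, mulVec_smul, h1, smul_comm]⟩
    rw [mulVec_smul, dotProduct_smul, smul_dotProduct, smul_smul, ← sq, hc, smul_eq_mul,
      inv_mul_cancel₀ h2]
  choose v hv1 hv2 using hex
  have happly : ∀ (M : Matrix (Fin n) (Fin n) E) i j,
      ((of v) * M * (of v)ᵀ) i j = v i ⬝ᵥ M *ᵥ v j := by
    intro M i j
    rw [mul_assoc, mul_apply, dotProduct]
    refine Finset.sum_congr rfl fun r _ => ?_
    rw [of_apply, mul_apply, mulVec, dotProduct]
    rfl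
  have horth : ∀ i j, i ≠ j → v i ⬝ᵥ S *ᵥ v j = 0 := by
    intro i j hij
    have h1 : v i ⬝ᵥ A *ᵥ v j = θ j * (v i ⬝ᵥ S *ᵥ v j) := by
      rw [hv2, dotProduct_smul, smul_eq_mul]
    have h2 : v i ⬝ᵥ A *ᵥ v j = θ i * (v i ⬝ᵥ S *ᵥ v j) := by
      rw [dotProduct_mulVec_comm_of_isSymm hA, hv2, dotProduct_smul, smul_eq_mul,
        dotProduct_mulVec_comm_of_isSymm hS]
    have h3 : (θ j - θ i) * (v i ⬝ᵥ S *ᵥ v j) = 0 := by rw [sub_mul, ← h1, ← h2, sub_self]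
    exact (mul_eq_zero.mp h3).resolve_left (sub_ne_zero.mpr fun h => hij (hθ h).symm)
  refine ⟨(of v)ᵀ, θ, hθ, ?_, ?_⟩
  · rw [transpose_transpose]
    ext i j
    rw [happly, one_apply]
    split_ifs with hij
    · rw [← hij, hv1]
    · exact horth i j hij
  · rw [transpose_transpose]
    ext i j
    rw [happly, diagonal_apply, hv2, dotProduct_smul, smul_eq_mul]
    split_ifs with hij
    · rw [← hij, hv1, mul_one]
    · rw [horth i j hij, mul_zero]

end Diagonalization

lemma eval_pencil {ι R : Type*} [CommRing R] (A B : Matrix ι ι R) (t : R) :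
    (((X : R[X]) • A.map C + B.map C).map (evalRingHom t)) = t • A + B := by
  ext i j
  simp [-X_mul_C]

/-- The general member of a pencil with smooth base locus is nondegenerate. -/
lemma TransversePencil.det_ne_zero {ι K : Type*} [Fintype ι] [DecidableEq ι] [Field K] [Infinite K]
    {A B : Matrix ι ι K} (hA : A.IsSymm) (h : TransversePencil A B) :
    ((X : K[X]) • A.map C + B.map C).det ≠ 0 := by
  by_cases hA0 : A.det = 0
  swap
  · intro h0
    have := coeff_det_X_add_C_card A B
    rw [h0, coeff_zero] at this
    exact hA0 this.symm
  have key : ((X : K[X]) • B.map C + A.map C).det ≠ 0 := by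
    intro h0
    -- A polynomial kernel vector has coefficients with `A c₀ = 0` and `B cₘ + A cₘ₊₁ = 0`. If `A cₘ
    -- = 0`, then `cₘ` is isotropic for both forms, so transversality forces `cₘ = 0`, hence `A cₘ₊₁
    -- = 0`; inductively all coefficients vanish.
    obtain ⟨y, hy0, hy⟩ := exists_mulVec_eq_zero_iff.mpr h0
    let c : ℕ → ι → K := fun m i => (y i).coeff m
    have hmap : ∀ (M : Matrix ι ι K) (m : ℕ) (i : ι),
        ((M.map C *ᵥ y) i).coeff m = (M *ᵥ c m) i := by
      intro M m i
      simp [mulVec, dotProduct, finsetSum_coeff, c]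
    have hz : A *ᵥ c 0 = 0 := by
      ext i
      have := congrArg (fun p => p.coeff 0) (congrFun hy i)
      simpa [add_mulVec, smul_mulVec, hmap] using this
    have hs : ∀ m, B *ᵥ c m + A *ᵥ c (m + 1) = 0 := by
      intro m
      ext i
      have := congrArg (fun p => p.coeff (m + 1)) (congrFun hy i)
      simpa [add_mulVec, smul_mulVec, hmap] using this
    have hstep : ∀ m, A *ᵥ c m = 0 → c m = 0 := by
      intro m hm
      by_contra hne
      have h1 : c m ⬝ᵥ B *ᵥ c m = 0 := by
        rw [eq_neg_of_add_eq_zero_left (hs m), dotProduct_neg,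
          dotProduct_mulVec_comm_of_isSymm hA, hm, dotProduct_zero, neg_zero]
      have := LinearIndependent.pair_iff.mp (h (c m) hne (by rw [hm, dotProduct_zero]) h1) 1 0
        (by rw [hm, smul_zero, zero_smul, add_zero])
      exact one_ne_zero this.1
    have hc : ∀ m, c m = 0 := by
      intro m
      induction m with
      | zero => exact hstep 0 hz
      | succ m ih =>
        refine hstep _ ?_
        have := hs m
        rwa [ih, mulVec_zero, zero_add] at this
    refine hy0 (funext fun i => Polynomial.ext fun m => congrFun (hc m) i)
  obtain ⟨t, ht⟩ : ∃ t, ((X : K[X]) • B.map C + A.map C).det.eval t ≠ 0 := by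
    by_contra! hall
    exact key (Polynomial.funext fun t => by rw [hall t, eval_zero])
  have hdet : (t • B + A).det ≠ 0 := by
    rwa [← coe_evalRingHom, RingHom.map_det, RingHom.mapMatrix_apply, eval_pencil] at ht
  -- `A` is singular in this case, so the good parameter is not `0` and `t B + A` can be rescaled to
  -- `t⁻¹ A + B`.
  have ht0 : t ≠ 0 := by
    rintro rfl
    rw [zero_smul, zero_add] at hdet
    exact hdet hA0
  intro h0
  have h1 : (t⁻¹ • A + B).det = 0 := by
    rw [← eval_pencil, ← RingHom.mapMatrix_apply, ← RingHom.map_det, h0, map_zero]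
  have h2 : t • B + A = t • (t⁻¹ • A + B) := by
    rw [smul_add, smul_smul, mul_inv_cancel₀ ht0, one_smul, add_comm]
  rw [h2, det_smul, h1, mul_zero] at hdet
  exact hdet rfl

lemma TransversePencil.smul_add {ι K : Type*} [Fintype ι] [Field K]
    {A B : Matrix ι ι K} (h : TransversePencil A B) (t : K) : TransversePencil A (t • A + B) := by
  intro x hx hA hS
  have hB : x ⬝ᵥ B *ᵥ x = 0 := by
    rwa [add_mulVec, smul_mulVec, dotProduct_add, dotProduct_smul, hA, smul_zero, zero_add] at hS
  rw [LinearIndependent.pair_iff]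
  intro c d hcd
  have := LinearIndependent.pair_iff.mp (h x hx hA hB) (c + d * t) d (by
    rw [← hcd, add_mulVec, smul_mulVec, _root_.smul_add, smul_smul, add_smul, add_assoc])
  have hd : d = 0 := this.2
  have hc : c + d * t = 0 := this.1
  rw [hd, zero_mul, add_zero] at hc
  exact ⟨hc, hd⟩

/-- The polynomial `∑ᵢ bᵢ² ∏_{j ≠ i} (X + θⱼ)`. -/
def secularPoly {ι L : Type*} [Fintype ι] [DecidableEq ι] [CommRing L] (θ b : ι → L) : L[X] :=
  ∑ i, C (b i ^ 2) * ∏ j ∈ Finset.univ.erase i, (X + C (θ j))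

lemma eval_secularPoly {ι L : Type*} [Fintype ι] [DecidableEq ι] [CommRing L] (θ b : ι → L)
    (t : L) : (secularPoly θ b).eval t = ∑ i, b i ^ 2 * ∏ j ∈ Finset.univ.erase i, (θ j + t) := by
  simp [secularPoly, eval_finsetSum, eval_prod, add_comm]

/-- Every summand but the `i`-th contains the factor `X + θᵢ`. -/
lemma eval_secularPoly_neg {ι L : Type*} [Fintype ι] [DecidableEq ι] [CommRing L] (θ b : ι → L)
    (i : ι) : (secularPoly θ b).eval (-θ i) =
      b i ^ 2 * ∏ j ∈ Finset.univ.erase i, (θ j - θ i) := by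
  rw [eval_secularPoly, Finset.sum_eq_single i]
  · simp [sub_eq_add_neg]
  · intro j _ hj
    rw [Finset.prod_eq_zero (Finset.mem_erase.mpr ⟨hj.symm, Finset.mem_univ i⟩) (add_neg_cancel _),
      mul_zero]
  · simp

/-- In the diagonalizing basis `A + t S` is the diagonal matrix with entries `θⱼ + t`, whose
adjugate is explicit. -/
lemma dualForm_smul_add_eq_eval_secularPoly {ι L : Type*} [Fintype ι] [DecidableEq ι] [CommRing L]
    {A S Q : Matrix ι ι L} {θ : ι → L} (hS : Qᵀ * S * Q = 1) (hA : Qᵀ * A * Q = diagonal θ)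
    (a : ι → L) (t : L) :
    Q.det ^ 2 * dualForm (A + t • S) a = (secularPoly θ (Qᵀ *ᵥ a)).eval t := by
  rw [← dualForm_congr, eval_secularPoly, ← dualForm_diagonal]
  congr 1
  rw [mul_add, add_mul, hA, mul_smul_comm, smul_mul_assoc, hS]
  ext i j
  by_cases hij : i = j
  · simp [hij]
  · simp [hij]

lemma isUnit_det_of_transpose_mul_mul_eq_one {ι R : Type*} [Fintype ι] [DecidableEq ι] [CommRing R]
    {S Q : Matrix ι ι R} (hS : Qᵀ * S * Q = 1) : IsUnit Q.det := by
  refine isUnit_of_mul_isUnit_right (x := Qᵀ.det * S.det) ?_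
  rw [← det_mul, ← det_mul, hS, det_one]
  exact isUnit_one

/-- A hyperplane is not tangent to all the members of a pencil with smooth base locus. -/
lemma TransversePencil.dualForm_ne_zero {E : Type*} [Field E] [IsAlgClosed E]
    {A B : Matrix (Fin (n + 1)) (Fin (n + 1)) E} (hA : A.IsSymm) (hB : B.IsSymm)
    (h : TransversePencil A B) {a : Fin (n + 1) → E} (ha : a ≠ 0) :
    dualForm ((X : E[X]) • A.map C + B.map C) (C ∘ a) ≠ 0 := by
  obtain ⟨l, hl⟩ : ∃ l, (l • A + B).det ≠ 0 := by
    by_contra! hall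
    refine h.det_ne_zero hA (Polynomial.funext fun t => ?_)
    rw [← coe_evalRingHom, RingHom.map_det, RingHom.mapMatrix_apply, eval_pencil, hall t, map_zero]
  have hS : (l • A + B).IsSymm := (hA.smul l).add hB
  obtain ⟨Q, θ, hθ, hQ1, hQ2⟩ :=
    (h.smul_add l).exists_diagonalization hA hS (isUnit_iff_ne_zero.mpr hl)
  have hQ := isUnit_det_of_transpose_mul_mul_eq_one hQ1
  set b := Qᵀ *ᵥ a with hb
  have hb0 : b ≠ 0 := by
    intro h0
    apply ha
    have : (Qᵀ)⁻¹ *ᵥ b = a := by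
      rw [hb, mulVec_mulVec, nonsing_inv_mul _ (by rwa [det_transpose]), one_mulVec]
    rw [← this, h0, mulVec_zero]
  obtain ⟨i, hi⟩ := Function.ne_iff.mp hb0
  -- The value at `-θᵢ`, with `bᵢ ≠ 0`, shows that the secular polynomial is nonzero. The extra
  -- factor `X` guarantees `t ≠ 0` below, so that `A + t (l A + B)` can be rescaled to `(t⁻¹ + l) A
  -- + B`.
  have hg : secularPoly θ b * X ≠ 0 := by
    refine mul_ne_zero (fun h0 => ?_) X_ne_zero
    have := eval_secularPoly_neg θ b i
    rw [h0, eval_zero] at this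
    refine mul_ne_zero (pow_ne_zero 2 hi) (Finset.prod_ne_zero_iff.mpr fun j hj => ?_) this.symm
    exact sub_ne_zero.mpr fun hij => (Finset.mem_erase.mp hj).1 (hθ hij)
  obtain ⟨t, ht⟩ : ∃ t, (secularPoly θ b * X).eval t ≠ 0 := by
    by_contra! hall
    exact hg (Polynomial.funext fun t => by rw [hall t, eval_zero])
  rw [eval_mul, eval_X, hb, ← dualForm_smul_add_eq_eval_secularPoly hQ1 hQ2 a t] at ht
  have ht0 : t ≠ 0 := right_ne_zero_of_mul ht
  have h1 : dualForm (A + t • (l • A + B)) a ≠ 0 := right_ne_zero_of_mul (left_ne_zero_of_mul ht)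
  have h2 : A + t • (l • A + B) = t • ((t⁻¹ + l) • A + B) := by
    rw [_root_.smul_add, _root_.smul_add, smul_smul, smul_smul, mul_add, mul_inv_cancel₀ ht0,
      add_smul, one_smul,
      add_assoc]
  rw [h2, dualForm_smul] at h1
  intro h0
  refine right_ne_zero_of_mul h1 ?_
  have := congrArg (evalRingHom (t⁻¹ + l)) h0
  rw [map_dualForm, eval_pencil, map_zero] at this
  rw [← this]
  congr 1
  ext i
  simp

section Degree

variable {R : Type*} [CommRing R] (A S : Matrix (Fin (n + 1)) (Fin (n + 1)) R)

lemma natDegree_adjugate_pencil_le (i j : Fin (n + 1)) :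
    (((X : R[X]) • S.map C + A.map C).adjugate i j).natDegree ≤ n := by
  rw [adjugate_fin_succ_eq_det_submatrix]
  have h : (((X : R[X]) • S.map C + A.map C).submatrix j.succAbove i.succAbove) =
      (X : R[X]) • (S.submatrix j.succAbove i.succAbove).map C +
        (A.submatrix j.succAbove i.succAbove).map C := rfl
  rw [h]
  refine natDegree_mul_le.trans ?_
  have h1 : ((-1 : R[X]) ^ ((j : ℕ) + i)).natDegree = 0 := by
    rcases neg_one_pow_eq_or R[X] ((j : ℕ) + i) with h | h <;> simp [h]
  rw [h1, zero_add]
  exact (natDegree_det_X_add_C_le _ _).trans_eq (Fintype.card_fin n)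

/-- The cofactors are minors of size `n`, so their top coefficient in the parameter only sees `S`.
This makes the chart equation monic after division by the dual form of `S`. -/
lemma coeff_adjugate_pencil (i j : Fin (n + 1)) :
    (((X : R[X]) • S.map C + A.map C).adjugate i j).coeff n = S.adjugate i j := by
  rw [adjugate_fin_succ_eq_det_submatrix, adjugate_fin_succ_eq_det_submatrix]
  have h : (((X : R[X]) • S.map C + A.map C).submatrix j.succAbove i.succAbove) =
      (X : R[X]) • (S.submatrix j.succAbove i.succAbove).map C +
        (A.submatrix j.succAbove i.succAbove).map C := rfl
  have h2 := coeff_det_X_add_C_card (S.submatrix j.succAbove i.succAbove)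
    (A.submatrix j.succAbove i.succAbove)
  rw [Fintype.card_fin] at h2
  have h3 : ((-1 : R[X]) ^ ((j : ℕ) + i)) = C ((-1) ^ ((j : ℕ) + i)) := by simp
  rw [h, h3, coeff_C_mul, h2]

end Degree

end LinearAlgebra

/-! ### The Galois group of the secular polynomial -/

section Galois

open Polynomial

section SecularDegree

variable {n : ℕ} {L : Type*} [CommRing L] [Nontrivial L] (θ b : Fin (n + 1) → L)

lemma natDegree_prod_erase_X_add_C (i : Fin (n + 1)) :
    (∏ j ∈ Finset.univ.erase i, (X + C (θ j))).natDegree = n := by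
  rw [natDegree_prod_of_monic _ _ fun j _ => monic_X_add_C (θ j)]
  simp

lemma natDegree_secularPoly_le : (secularPoly θ b).natDegree ≤ n :=
  natDegree_sum_le_of_forall_le _ _ fun i _ =>
    (natDegree_C_mul_le _ _).trans (natDegree_prod_erase_X_add_C θ i).le

lemma coeff_secularPoly : (secularPoly θ b).coeff n = ∑ i, b i ^ 2 := by
  rw [secularPoly, finsetSum_coeff]
  refine Finset.sum_congr rfl fun i _ => ?_
  have h := (monic_prod_of_monic (Finset.univ.erase i) (fun j => X + C (θ j))
    fun j _ => monic_X_add_C (θ j)).coeff_natDegree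
  rw [natDegree_prod_erase_X_add_C] at h
  rw [coeff_C_mul, h, mul_one]

end SecularDegree

lemma exists_fin_map_eq_of_card {α : Type*} (s : Multiset α) {n : ℕ} (hs : s.card = n) :
    ∃ ρ : Fin n → α, (Finset.univ : Finset (Fin n)).val.map ρ = s := by
  subst hs
  induction s using Quotient.inductionOn with
  | h l =>
    refine ⟨l.get, ?_⟩
    exact (Fin.univ_val_map l.get).trans (congrArg _ (List.ofFn_get l))

/-- The permutation acts on the polynomial algebra `E[ρ]`, and `L` is an algebraic closure of that
ring, so the action extends. -/
lemma exists_algEquiv_of_perm {E L ι : Type*} [Field E] [Field L] [Algebra E L] [IsAlgClosed L]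
    {ρ : ι → L} (h : IsTranscendenceBasis E ρ) (π : Equiv.Perm ι) :
    ∃ σ : L ≃ₐ[E] L, ∀ j, σ (ρ j) = ρ (π j) := by
  let A := Algebra.adjoin E (Set.range ρ)
  have : IsAlgClosure A L := IsAlgClosed.isAlgClosure_of_transcendence_basis ρ h
  let e : A ≃ₐ[E] A := h.1.aevalEquiv.symm.trans
    ((MvPolynomial.renameEquiv E π).trans h.1.aevalEquiv)
  let σ : L ≃+* L := IsAlgClosure.equivOfEquiv L L e.toRingEquiv
  have hσ : ∀ a : A, σ (algebraMap A L a) = algebraMap A L (e a) := fun a =>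
    IsAlgClosure.equivOfEquiv_algebraMap L L e.toRingEquiv a
  have haev : ∀ p, e (h.1.aevalEquiv p) = h.1.aevalEquiv (MvPolynomial.rename π p) := fun p => by
    simp [e]
  refine ⟨AlgEquiv.ofRingEquiv (f := σ) fun r => ?_, fun j => ?_⟩
  · have := hσ (algebraMap E A r)
    rwa [e.commutes, ← IsScalarTower.algebraMap_apply] at this
  · have h1 := hσ (h.1.aevalEquiv (MvPolynomial.X j))
    rw [haev, MvPolynomial.rename_X] at h1
    simpa using h1

section Prime

variable {E ι : Type*} [Field E]

lemma prime_X_add_C (j : ι) (a : E) :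
    Prime (MvPolynomial.X j + MvPolynomial.C a : MvPolynomial ι E) := by
  classical
  let f : MvPolynomial ι E →ₐ[E] MvPolynomial ι E :=
    MvPolynomial.aeval fun i => MvPolynomial.X i + if i = j then MvPolynomial.C a else 0
  let g : MvPolynomial ι E →ₐ[E] MvPolynomial ι E :=
    MvPolynomial.aeval fun i => MvPolynomial.X i - if i = j then MvPolynomial.C a else 0
  let e : MvPolynomial ι E ≃ₐ[E] MvPolynomial ι E := AlgEquiv.ofAlgHom f g
    (by
      ext i : 1
      by_cases h : i = j
      · simp [f, g, h, MvPolynomial.algHom_C]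
      · simp [f, g, h])
    (by
      ext i : 1
      by_cases h : i = j
      · simp [f, g, h, MvPolynomial.algHom_C]
      · simp [f, g, h])
  have h := (MulEquiv.prime_iff e.toMulEquiv (p := MvPolynomial.X j)).mpr MvPolynomial.X_prime
  convert h using 1
  simp [e, f]

lemma X_add_C_dvd_iff (i j : ι) (a c : E) :
    (MvPolynomial.X j + MvPolynomial.C a : MvPolynomial ι E) ∣
      MvPolynomial.X i + MvPolynomial.C c ↔ i = j ∧ c = a := by
  classical
  refine ⟨fun ⟨q, hq⟩ => ?_, fun ⟨h1, h2⟩ => by rw [h1, h2]⟩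
  -- At this point the divisor vanishes, whereas `Xᵢ + c` takes the value `1` if `i ≠ j` and `c - a`
  -- if `i = j`.
  have h := congrArg (MvPolynomial.eval fun l => if l = j then -a else 1 - c) hq
  by_cases hij : i = j
  · refine ⟨hij, ?_⟩
    simpa [hij, neg_add_eq_zero, eq_comm] using h
  · simp [hij] at h

/-- A product of the `∏ⱼ (Xⱼ + θᵢ)` over a nonempty set of indices `i` is not a square, even up to
a factor `∏ⱼ (Xⱼ + θ₀)`. -/
lemma mul_prod_X_add_C_ne [Fintype ι] [Nonempty ι] {κ : Type*} {θ₀ : E} {θ : κ → E}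
    (hθ : Function.Injective θ) (hθ₀ : ∀ i, θ i ≠ θ₀) {S : Finset κ} (hS : S.Nonempty)
    {c d : E} (hc : c ≠ 0) (hd : d ≠ 0) {p q : MvPolynomial ι E} (hp : p ≠ 0) (hq : q ≠ 0) (m : ℕ) :
    MvPolynomial.C c * p ^ 2 * (∏ j, (MvPolynomial.X j + MvPolynomial.C θ₀)) ^ m ≠
      MvPolynomial.C d * q ^ 2 *
        ∏ i ∈ S, ∏ j, (MvPolynomial.X j + MvPolynomial.C (θ i)) := by
  classical
  intro h
  obtain ⟨i₀, hi₀⟩ := hS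
  obtain ⟨j₀⟩ := ‹Nonempty ι›
  -- The multiplicity of the prime `P` is even on the left and odd on the right: the squares
  -- contribute even numbers, the factors with `θ₀` none, and the product over `S` exactly one.
  set P : MvPolynomial ι E := MvPolynomial.X j₀ + MvPolynomial.C (θ i₀) with hP
  have hPp : Prime P := prime_X_add_C j₀ (θ i₀)
  have hC : ∀ {c : E}, c ≠ 0 → emultiplicity P (MvPolynomial.C c) = 0 := fun {c} hc =>
    emultiplicity_eq_zero.mpr fun hdvd => hPp.not_isUnit
      (isUnit_of_dvd_unit hdvd ((isUnit_iff_ne_zero.mpr hc).map _))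
  have h0 : emultiplicity P ((∏ j, (MvPolynomial.X j + MvPolynomial.C θ₀)) ^ m) = 0 := by
    refine emultiplicity_eq_zero.mpr fun hdvd => ?_
    obtain ⟨j, _, hj⟩ := (hPp.dvd_finsetProd_iff _).mp (hPp.dvd_of_dvd_pow hdvd)
    exact hθ₀ i₀ ((X_add_C_dvd_iff _ _ _ _).mp hj).2.symm
  have h1 : emultiplicity P
      (∏ i ∈ S, ∏ j, (MvPolynomial.X j + MvPolynomial.C (θ i))) = 1 := by
    rw [← Finset.prod_product',
      ← Finset.mul_prod_erase _ _ (Finset.mk_mem_product hi₀ (Finset.mem_univ j₀)),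
      emultiplicity_mul hPp]
    have hPP : emultiplicity P P = 1 := by
      have := emultiplicity_pow_self hPp.ne_zero hPp.not_isUnit 1
      rwa [pow_one] at this
    rw [← hP, hPP]
    have h' : emultiplicity P (∏ x ∈ (S ×ˢ Finset.univ).erase (i₀, j₀),
        (MvPolynomial.X x.2 + MvPolynomial.C (θ x.1))) = 0 := by
      refine emultiplicity_eq_zero.mpr fun hdvd => ?_
      obtain ⟨⟨i, j⟩, hij, hdvd⟩ := (hPp.dvd_finsetProd_iff _).mp hdvd
      obtain ⟨h2, h3⟩ := (X_add_C_dvd_iff _ _ _ _).mp hdvd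
      exact (Finset.mem_erase.mp hij).1 (Prod.ext (hθ h3) h2)
    rw [h', add_zero]
  have h2 := congrArg (emultiplicity P) h
  rw [emultiplicity_mul hPp, emultiplicity_mul hPp, emultiplicity_mul hPp, emultiplicity_mul hPp,
    hC hc, hC hd, h0, h1, emultiplicity_pow hPp, emultiplicity_pow hPp, zero_add, zero_add,
    add_zero] at h2
  have hpf : FiniteMultiplicity P p := FiniteMultiplicity.of_prime_left hPp hp
  have hqf : FiniteMultiplicity P q := FiniteMultiplicity.of_prime_left hPp hq
  rw [hpf.emultiplicity_eq_multiplicity, hqf.emultiplicity_eq_multiplicity] at h2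
  norm_cast at h2
  omega

end Prime

end Galois

/-! ### Kummer theory and permutations of the secular roots -/

section Galois

open Polynomial

/-- If every element of `s` is algebraic over `F`, and `L` over `E(s)`, then `L` is algebraic
over `F`. -/
lemma isAlgebraic_of_isAlgebraic_adjoin {E L : Type*} [Field E] [Field L] [Algebra E L]
    (F : IntermediateField E L) (s : Set L)
    [Algebra.IsAlgebraic (IntermediateField.adjoin E s) L] (hs : ∀ x ∈ s, IsAlgebraic F x) :
    Algebra.IsAlgebraic F L := by
  let M := algebraicClosure F L
  have hle : IntermediateField.adjoin E s ≤ M.restrictScalars E :=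
    IntermediateField.adjoin_le_iff.mpr fun x hx => mem_algebraicClosure_iff.mpr (hs x hx)
  let := (IntermediateField.inclusion hle).toRingHom.toAlgebra
  have : Algebra.IsAlgebraic M L := by
    have : IsScalarTower (IntermediateField.adjoin E s) (M.restrictScalars E) L :=
      IsScalarTower.of_algebraMap_eq fun _ => rfl
    exact Algebra.IsAlgebraic.tower_top (K := IntermediateField.adjoin E s)
      (M.restrictScalars E) (A := L)
  exact Algebra.IsAlgebraic.trans F M L

open IntermediateField.algebraAdjoinAdjoin in
-- A family generating `L` up to algebraic elements contains a transcendence basis; having only `n`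
-- members in transcendence degree `n`, it is itself one.
lemma isTranscendenceBasis_of_isAlgebraic_adjoin {E L : Type*} [Field E] [Field L] [Algebra E L]
    {n : ℕ} (htr : Algebra.trdeg E L = n) (ρ : Fin n → L)
    [Algebra.IsAlgebraic (IntermediateField.adjoin E (Set.range ρ)) L] :
    IsTranscendenceBasis E ρ := by
  have : Algebra.IsAlgebraic (Algebra.adjoin E (Set.range ρ)) L :=
    (IsFractionRing.comap_isAlgebraic_iff
      (K := IntermediateField.adjoin E (Set.range ρ))).mpr inferInstance
  refine Algebra.IsAlgebraic.isTranscendenceBasis_of_lift_le_trdeg_of_finite E ρ ?_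
  rw [htr]
  simp

/-- The sign `±1` attached to an element of `𝔽₂`. -/
def signOf (L : Type*) [Ring L] (a : ZMod 2) : L := if a = 0 then 1 else -1

lemma signOf_add (L : Type*) [Ring L] (a b : ZMod 2) :
    signOf L (a + b) = signOf L a * signOf L b := by
  have : ∀ a : ZMod 2, a = 0 ∨ a = 1 := by decide
  rcases this a with rfl | rfl <;> rcases this b with rfl | rfl <;>
    simp [signOf, (by decide : (1 + 1 : ZMod 2) = 0)]

lemma signOf_sum (L : Type*) [CommRing L] {ι : Type*} (s : Finset ι) (a : ι → ZMod 2) :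
    signOf L (∑ i ∈ s, a i) = ∏ i ∈ s, signOf L (a i) := by
  classical
  induction s using Finset.induction_on with
  | empty => simp [signOf]
  | insert i s hi ih => rw [Finset.sum_insert hi, Finset.prod_insert hi, signOf_add, ih]

lemma signOf_mul_self (L : Type*) [Ring L] (a : ZMod 2) : signOf L a * signOf L a = 1 := by
  rw [signOf]
  split_ifs <;> simp

lemma exists_signOf_mul_eq {L : Type*} [CommRing L] [IsDomain L] {x y : L} (h : x ^ 2 = y ^ 2) :
    ∃ a : ZMod 2, x = signOf L a * y := by
  rcases sq_eq_sq_iff_eq_or_eq_neg.mp h with h | h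
  · exact ⟨0, by simp [signOf, h]⟩
  · exact ⟨1, by simp [signOf, h]⟩

lemma map_signOf {L L' : Type*} [Ring L] [Ring L'] (f : L →+* L') (a : ZMod 2) :
    f (signOf L a) = signOf L' a := by
  rw [signOf, signOf]
  split_ifs <;> simp

/-- Kummer theory for square roots: if no nonempty product of the `wᵢ` lies in the perfect field
`F`, but all squares `wᵢ²` do, then the signs of the `wᵢ` can be changed independently. -/
lemma exists_algEquiv_signs {F L : Type*} [Field F] [Field L] [Algebra F L] [IsGalois F L]
    {ι : Type*} [Fintype ι] (w : ι → L) (hw : ∀ i, w i ^ 2 ∈ Set.range (algebraMap F L))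
    (hprod : ∀ S : Finset ι, S.Nonempty → ∏ i ∈ S, w i ∉ Set.range (algebraMap F L))
    (x : ι → ZMod 2) : ∃ τ : L ≃ₐ[F] L, ∀ i, τ (w i) = signOf L (x i) * w i := by
  classical
  -- The sign changes that do occur form an `𝔽₂`-subspace, since signs lie in `F` and composing
  -- automorphisms adds them.
  let V : Submodule (ZMod 2) (ι → ZMod 2) :=
    { carrier := {x | ∃ τ : L ≃ₐ[F] L, ∀ i, τ (w i) = signOf L (x i) * w i}
      add_mem' := by
        rintro x y ⟨τ, hτ⟩ ⟨τ', hτ'⟩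
        refine ⟨τ * τ', fun i => ?_⟩
        rw [AlgEquiv.mul_apply, hτ', map_mul, hτ, Pi.add_apply, signOf_add,
          show τ (signOf L (y i)) = signOf L (y i) from map_signOf (τ : L →+* L) _]
        ring
      zero_mem' := ⟨1, fun i => by simp [signOf]⟩
      smul_mem' := by
        rintro c x ⟨τ, hτ⟩
        have : ∀ a : ZMod 2, a = 0 ∨ a = 1 := by decide
        rcases this c with rfl | rfl
        · exact ⟨1, fun i => by simp [signOf]⟩
        · exact ⟨τ, fun i => by rw [one_smul, hτ]⟩ }
  suffices hV : V = ⊤ by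
    have : x ∈ V := hV ▸ Submodule.mem_top
    exact this
  by_contra hne
  -- A nonzero functional killing a proper subspace is the sum of the coordinates in a nonempty set
  -- `S`. So every automorphism changes an even number of signs in `S` and fixes `∏_{i ∈ S} wᵢ`,
  -- which therefore lies in `F`.
  obtain ⟨f, hf0, hf⟩ := Submodule.exists_le_ker_of_lt_top V (lt_top_iff_ne_top.mpr hne)
  let S : Finset ι := Finset.univ.filter fun i => f (Pi.single i 1) ≠ 0
  have hS : S.Nonempty := by
    by_contra hempty
    rw [Finset.not_nonempty_iff_eq_empty, Finset.filter_eq_empty_iff] at hempty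
    refine hf0 (LinearMap.pi_ext' fun i => LinearMap.ext_ring ?_)
    simpa using hempty (Finset.mem_univ i)
  have hfx : ∀ x : ι → ZMod 2, f x = ∑ i ∈ S, x i := by
    intro x
    have h01 : ∀ a : ZMod 2, a ≠ 0 → a = 1 := by decide
    conv_lhs => rw [← Finset.univ_sum_single x, map_sum]
    rw [Finset.sum_filter]
    refine Finset.sum_congr rfl fun i _ => ?_
    have : Pi.single i (x i) = x i • (Pi.single i 1 : ι → ZMod 2) := by
      rw [← Pi.single_smul, smul_eq_mul, mul_one]
    rw [this, map_smul, smul_eq_mul]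
    split_ifs with h
    · rw [h01 _ h, mul_one]
    · rw [not_not.mp h, mul_zero]
  refine hprod S hS ((InfiniteGalois.mem_range_algebraMap_iff_fixed _).mpr fun τ => ?_)
  have hsign : ∀ i, ∃ a : ZMod 2, τ (w i) = signOf L a * w i := fun i => by
    obtain ⟨z, hz⟩ := hw i
    exact exists_signOf_mul_eq (by rw [← map_pow, ← hz, τ.commutes])
  choose y hy using hsign
  have h0 : f y = 0 := hf (show y ∈ V from ⟨τ, hy⟩)
  rw [map_prod, Finset.prod_congr rfl fun i _ => hy i, Finset.prod_mul_distrib, ← signOf_sum,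
    ← hfx, h0]
  simp [signOf]

/-- Over a field `E` over which `L` has transcendence degree `n`, if the ratios of the `bᵢ` generate
`L` up to algebraic elements, the secular polynomial has `n` distinct roots, which can be permuted
arbitrarily by automorphisms fixing the ratios of the `bᵢ`. -/
theorem exists_algEquiv_roots_secularPoly {E L : Type*} [Field E] [Field L] [Algebra E L]
    [CharZero L] [IsAlgClosed L] {n : ℕ} (htr : Algebra.trdeg E L = n) {θ : Fin (n + 1) → E}
    (hθ : Function.Injective θ) {b : Fin (n + 1) → L} (hb : b 0 ≠ 0)
    [Algebra.IsAlgebraic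
      (IntermediateField.adjoin E (Set.range fun i : Fin n => b i.succ / b 0)) L]
    (hlead : ∑ i, b i ^ 2 ≠ 0) :
    ∃ ρ : Fin n → L, Function.Injective ρ ∧
      (∀ x, (secularPoly (algebraMap E L ∘ θ) b).eval x = 0 ↔ ∃ j, ρ j = x) ∧
      ∀ π : Equiv.Perm (Fin n), ∃ σ : L ≃ₐ[E] L,
        (∀ i, σ (b i / b 0) = b i / b 0) ∧ ∀ j, σ (ρ j) = ρ (π j) := by
  classical
  set g := secularPoly (algebraMap E L ∘ θ) b with hg
  set c := ∑ i, b i ^ 2 with hc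
  have hcoeff : g.coeff n = c := coeff_secularPoly _ _
  have hdeg : g.natDegree = n := le_antisymm (natDegree_secularPoly_le _ _)
    (le_natDegree_of_ne_zero (hcoeff ▸ hlead))
  have hg0 : g ≠ 0 := by
    intro h
    rw [h, coeff_zero] at hcoeff
    exact hlead hcoeff.symm
  have hsplit := IsAlgClosed.splits g
  obtain ⟨ρ, hρ⟩ := exists_fin_map_eq_of_card g.roots
    (hsplit.natDegree_eq_card_roots.symm.trans hdeg)
  have hfac : g = C c * ∏ j, (X - C (ρ j)) := by
    rw [← hcoeff]
    conv_lhs => rw [hsplit.eq_prod_roots, leadingCoeff, hdeg, ← hρ, Multiset.map_map]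
    rfl
  set d : Fin (n + 1) → E := fun i => ∏ j ∈ Finset.univ.erase i, (θ j - θ i) with hd
  have hd0 : ∀ i, d i ≠ 0 := fun i => Finset.prod_ne_zero_iff.mpr fun j hj =>
    sub_ne_zero.mpr fun hij => (Finset.mem_erase.mp hj).1 (hθ hij)
  set r : Fin (n + 1) → L := fun i => ∏ j, (ρ j + algebraMap E L (θ i)) with hr
  -- The factorization of `g` and its defining sum are compared at `-θᵢ`.
  have heval : ∀ i, c * (-1) ^ n * r i = b i ^ 2 * algebraMap E L (d i) := by
    intro i
    have h1 := eval_secularPoly_neg (algebraMap E L ∘ θ) b i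
    rw [← hg, hfac, eval_mul, eval_C, eval_prod] at h1
    rw [hd, map_prod]
    simp only [Function.comp_apply] at h1
    rw [Finset.prod_congr rfl fun j _ => (algebraMap E L).map_sub _ _, ← h1, hr, mul_assoc]
    congr 1
    have hcard : (-1 : L) ^ n = ∏ _j : Fin n, (-1 : L) := by simp
    rw [hcard, ← Finset.prod_mul_distrib]
    refine Finset.prod_congr rfl fun j _ => ?_
    simp
    ring
  have hr0 : r 0 ≠ 0 := by
    intro h
    have := heval 0
    rw [h, mul_zero] at this
    exact mul_ne_zero (pow_ne_zero 2 hb)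
      ((map_ne_zero_iff _ (algebraMap E L).injective).mpr (hd0 0)) this.symm
  set w : Fin (n + 1) → L := fun i => b i / b 0 with hw
  -- Passing to ratios eliminates the leading coefficient `c`, which need not lie in `E(ρ)`.
  have hwsq : ∀ i, w i ^ 2 * (algebraMap E L (d i) * r 0) = algebraMap E L (d 0) * r i := by
    intro i
    have h1 := heval i
    have h2 := heval 0
    have hc' : c * (-1) ^ n ≠ 0 := mul_ne_zero hlead (pow_ne_zero _ (by simp))
    refine mul_left_cancel₀ hc' ?_
    have hb2 : b i ^ 2 = w i ^ 2 * b 0 ^ 2 := by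
      rw [hw, div_pow, div_mul_cancel₀ _ (pow_ne_zero 2 hb)]
    calc _ = w i ^ 2 * algebraMap E L (d i) * (c * (-1) ^ n * r 0) := by ring
      _ = algebraMap E L (d 0) * (b i ^ 2 * algebraMap E L (d i)) := by rw [h2, hb2]; ring
      _ = _ := by rw [← h1]; ring
  have hwsq' : ∀ i, w i ^ 2 = algebraMap E L (d 0) * r i / (algebraMap E L (d i) * r 0) := fun i =>
    by
    rw [eq_div_iff, hwsq]
    exact mul_ne_zero ((map_ne_zero_iff _ (algebraMap E L).injective).mpr (hd0 i)) hr0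
  set F := IntermediateField.adjoin E (Set.range ρ) with hF
  have hρF : ∀ j, ρ j ∈ F := fun j => IntermediateField.subset_adjoin _ _ ⟨j, rfl⟩
  have hrF : ∀ i, r i ∈ F := fun i => prod_mem fun j _ => add_mem (hρF j) (F.algebraMap_mem _)
  have hwF : ∀ i, w i ^ 2 ∈ F := fun i => by
    rw [hwsq']
    exact div_mem (mul_mem (F.algebraMap_mem _) (hrF i)) (mul_mem (F.algebraMap_mem _) (hrF 0))
  -- Each `wᵢ` is a square root of an element of `E(ρ)`, and `L` is algebraic over the field
  -- generated by the `wᵢ`. This makes the `n` roots a transcendence basis, and in particular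
  -- distinct.
  have hFL : Algebra.IsAlgebraic F L := by
    refine isAlgebraic_of_isAlgebraic_adjoin F (Set.range fun i : Fin n => b i.succ / b 0) ?_
    rintro _ ⟨i, rfl⟩
    refine IsAlgebraic.of_pow two_pos (r := w i.succ) ?_
    exact isAlgebraic_algebraMap (⟨_, hwF i.succ⟩ : F)
  have hbasis : IsTranscendenceBasis E ρ := isTranscendenceBasis_of_isAlgebraic_adjoin htr ρ
  have hCZ : CharZero F := charZero_of_injective_algebraMap (algebraMap ℚ F).injective
  have hgal : IsGalois F L := by
    have : IsAlgClosure F L := ⟨inferInstance, inferInstance⟩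
    exact {}
  refine ⟨ρ, hbasis.1.injective, fun x => ?_, fun π => ?_⟩
  · rw [hfac, eval_mul, eval_C, eval_prod, mul_eq_zero, or_iff_right hlead,
      Finset.prod_eq_zero_iff]
    simp [sub_eq_zero, eq_comm]
  obtain ⟨σ₀, hσ₀⟩ := exists_algEquiv_of_perm hbasis π
  -- `r i` is symmetric in the roots, so `σ₀` fixes each `wᵢ²` and can only change signs of the
  -- `wᵢ`.
  have hσr : ∀ i, σ₀ (r i) = r i := fun i => by
    change σ₀ (∏ j, (ρ j + algebraMap E L (θ i))) = ∏ j, (ρ j + algebraMap E L (θ i))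
    rw [map_prod, ← Equiv.prod_comp π fun j => ρ j + algebraMap E L (θ i)]
    simp [hσ₀]
  have hsign : ∀ i, ∃ a : ZMod 2, σ₀ (w i) = signOf L a * w i := fun i =>
    exists_signOf_mul_eq (by
      rw [← map_pow, hwsq', map_div₀, map_mul, map_mul, hσr, hσr, σ₀.commutes, σ₀.commutes])
  choose x hx using hsign
  have hprod : ∀ S : Finset (Fin n), S.Nonempty →
      ∏ i ∈ S, w i.succ ∉ Set.range (algebraMap F L) := by
    rintro S hS ⟨⟨z, hzF⟩, hz⟩
    change z = _ at hz
    -- If the product were `p/q`, squaring and clearing denominators would give a polynomial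
    -- identity, by independence of the roots, which `mul_prod_X_add_C_ne` rules out.
    obtain ⟨p, q, hpq⟩ := (IntermediateField.mem_adjoin_range_iff E ρ z).mp hzF
    have hinj : Function.Injective (MvPolynomial.aeval (R := E) ρ) := hbasis.1
    have hri : ∀ i, MvPolynomial.aeval ρ
        (∏ j, (MvPolynomial.X j + MvPolynomial.C (θ i)) : MvPolynomial (Fin n) E) = r i := fun i =>
          by
      simp [hr, map_prod]
    have hrne : ∀ i, r i ≠ 0 := fun i => by
      rw [← hri, Ne, map_eq_zero_iff _ hinj]
      exact Finset.prod_ne_zero_iff.mpr fun j _ => (prime_X_add_C j (θ i)).ne_zero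
    have hz2 : z ^ 2 * (algebraMap E L (∏ i ∈ S, d i.succ) * r 0 ^ S.card) =
        algebraMap E L (d 0 ^ S.card) * ∏ i ∈ S, r i.succ := by
      rw [hz, ← Finset.prod_pow, map_prod, ← Finset.prod_const, ← Finset.prod_mul_distrib,
        ← Finset.prod_mul_distrib, Finset.prod_congr rfl fun i _ => hwsq i.succ,
        Finset.prod_mul_distrib, Finset.prod_const, map_pow]
    have hz0 : z ≠ 0 := by
      rintro rfl
      rw [zero_pow two_ne_zero, zero_mul] at hz2
      exact mul_ne_zero ((map_ne_zero_iff _ (algebraMap E L).injective).mpr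
        (pow_ne_zero _ (hd0 0))) (Finset.prod_ne_zero_iff.mpr fun i _ => hrne _) hz2.symm
    have hp : p ≠ 0 := by
      rintro rfl
      exact hz0 (by rw [hpq, map_zero, zero_div])
    have hq : q ≠ 0 := by
      rintro rfl
      exact hz0 (by rw [hpq, map_zero, div_zero])
    have hq' : MvPolynomial.aeval ρ q ≠ 0 := (map_ne_zero_iff _ hinj).mpr hq
    have : Nonempty (Fin n) := ⟨hS.choose⟩
    refine mul_prod_X_add_C_ne (c := ∏ i ∈ S, d i.succ) (d := d 0 ^ S.card)
      (hθ.comp (Fin.succ_injective n))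
      (fun i => hθ.ne (Fin.succ_ne_zero i)) hS
      (Finset.prod_ne_zero_iff.mpr fun i _ => hd0 (Fin.succ i)) (pow_ne_zero S.card (hd0 0)) hp hq
      S.card (hinj ?_)
    have hprodr : MvPolynomial.aeval ρ (∏ i ∈ S, ∏ j, (MvPolynomial.X j +
        MvPolynomial.C ((θ ∘ Fin.succ) i)) : MvPolynomial (Fin n) E) = ∏ i ∈ S, r i.succ := by
      rw [map_prod]
      exact Finset.prod_congr rfl fun i _ => hri (Fin.succ i)
    have hCa : ∀ e : E, MvPolynomial.aeval ρ (MvPolynomial.C e : MvPolynomial (Fin n) E) =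
        algebraMap E L e := fun e => MvPolynomial.aeval_C ρ e
    simp only [map_mul (MvPolynomial.aeval ρ), map_pow (MvPolynomial.aeval ρ), hprodr, hri, hCa]
    rw [hpq, div_pow] at hz2
    field_simp at hz2
    linear_combination hz2
  -- `τ` fixes the roots and undoes the signs introduced by `σ₀`. The index `0` is left out because
  -- `w 0 = 1`.
  obtain ⟨τ, hτ⟩ := exists_algEquiv_signs (F := F) (fun i : Fin n => w i.succ)
    (fun i => ⟨⟨_, hwF i.succ⟩, rfl⟩) hprod (fun i => x i.succ)
  refine ⟨σ₀.trans (τ.restrictScalars E), fun i => ?_, fun j => ?_⟩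
  · change τ (σ₀ (w i)) = w i
    rcases Fin.eq_zero_or_eq_succ i with rfl | ⟨i, rfl⟩
    · rw [show w 0 = 1 from div_self hb, map_one, map_one]
    · rw [hx, map_mul, show τ (signOf L (x i.succ)) = _ from map_signOf (τ : L →+* L) _, hτ,
        ← mul_assoc, signOf_mul_self, one_mul]
  · change τ (σ₀ (ρ j)) = ρ (π j)
    rw [hσ₀]
    exact τ.commutes (⟨_, hρF (π j)⟩ : F)

end Galois

/-! ### The Jacobian criterion for affine complete intersections -/

section AffineJacobian

open Matrix

/-- Row rank equals column rank, so a basis can be chosen among the columns. The choice tells which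
variables to pair with the equations in a submersive presentation. -/
lemma exists_det_submatrix_ne_zero {K ι σ : Type*} [Field K] [Fintype ι] [DecidableEq ι]
    [Fintype σ] (M : Matrix ι σ K) (h : LinearIndependent K M.row) :
    ∃ a : ι → σ, Function.Injective a ∧ (M.submatrix id a).det ≠ 0 := by
  have hspan : Submodule.span K (Set.range M.col) = ⊤ := by
    apply Submodule.eq_top_of_finrank_eq
    rw [← Matrix.rank_eq_finrank_span_cols, h.rank_matrix, Module.finrank_pi]
  obtain ⟨κ, a, ha, hs, hl⟩ := exists_linearIndependent' K M.col
  rw [hspan] at hs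
  let b : Module.Basis κ K (ι → K) := Module.Basis.mk hl hs.ge
  let e : ι ≃ κ := (Pi.basisFun K ι).indexEquiv b
  refine ⟨a ∘ e, ha.comp e.injective, ?_⟩
  rw [← isUnit_iff_ne_zero, ← Matrix.isUnit_iff_isUnit_det,
    ← Matrix.linearIndependent_cols_iff_isUnit]
  exact hl.comp e e.injective

variable {k : Type u} [Field k] {ι σ : Type}

/-- The quotient of a polynomial ring by the ideal generated by a family of polynomials. -/
abbrev AffineQuotient (v : ι → MvPolynomial σ k) : Type u :=
  MvPolynomial σ k ⧸ Ideal.span (Set.range v)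

/-- Tangent vectors are points over the dual numbers: `x + ε w` satisfies the equations because `w`
is killed by the Jacobian matrix, by Taylor expansion to first order. -/
lemma exists_algHom_dualNumber [Fintype σ] (v : ι → MvPolynomial σ k) {Ω : Type u} [Field Ω]
  [Algebra k Ω]
    (x : σ → Ω) (hx : ∀ i, MvPolynomial.aeval x (v i) = 0) (w : σ → Ω)
    (hw : ∀ i, ∑ j, MvPolynomial.aeval x (MvPolynomial.pderiv j (v i)) * w j = 0) :
    ∃ ψ : AffineQuotient v →ₐ[k] DualNumber Ω, 
      ∀ j, ψ (Ideal.Quotient.mk _ (MvPolynomial.X j)) =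
        TrivSqZeroExt.inl (x j) + TrivSqZeroExt.inr (w j) := by
  let ψ₀ : MvPolynomial σ k →ₐ[k] DualNumber Ω :=
    MvPolynomial.aeval fun j => TrivSqZeroExt.inl (x j) + TrivSqZeroExt.inr (w j)
  have hfst : ∀ p, (ψ₀ p).fst = MvPolynomial.aeval x p := fun p => by
    have : (TrivSqZeroExt.fstHom k Ω Ω).comp ψ₀ = MvPolynomial.aeval x :=
      MvPolynomial.algHom_ext fun j => by simp [ψ₀]
    exact DFunLike.congr_fun this p
  have hsnd : ∀ p, (ψ₀ p).snd =
      ∑ j, MvPolynomial.aeval x (MvPolynomial.pderiv j p) * w j := fun p => by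
    classical
    induction p using MvPolynomial.induction_on with
    | C a =>
      rw [MvPolynomial.algHom_C, TrivSqZeroExt.algebraMap_eq_inl']
      simp
    | add p q hp hq => simp [hp, hq, add_mul, Finset.sum_add_distrib]
    | mul_X p i hp =>
      rw [map_mul, TrivSqZeroExt.snd_mul, hp, hfst, hfst]
      have hX : (ψ₀ (MvPolynomial.X i)).snd = w i := by simp [ψ₀]
      have (j : σ) : MvPolynomial.aeval x (MvPolynomial.pderiv j (p * MvPolynomial.X i)) * w j =
          (if i = j then MvPolynomial.aeval x p * w j else 0) +
            x i * (MvPolynomial.aeval x (MvPolynomial.pderiv j p) * w j) := by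
        rw [Derivation.leibniz, MvPolynomial.pderiv_X, Pi.single_apply]
        split_ifs with h <;> simp [h, add_mul, mul_assoc]
      rw [Finset.sum_congr rfl fun j _ => this j, Finset.sum_add_distrib, Finset.sum_ite_eq,
        ← Finset.mul_sum, hX]
      simp [mul_comm]
  have hv : ∀ i, ψ₀ (v i) = 0 := fun i => TrivSqZeroExt.ext (by simp [hfst, hx]) (by
    simp [hsnd, hw])
  refine ⟨Ideal.Quotient.liftₐ _ ψ₀ fun a ha => ?_, fun j => ?_⟩
  · have : Ideal.span (Set.range v) ≤ RingHom.ker ψ₀ := by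
      rw [Ideal.span_le]
      rintro _ ⟨i, rfl⟩
      exact hv i
    exact this ha
  · exact MvPolynomial.aeval_X (R := k) _ j

/-- A dual number is a unit if its constant part is one, so the point extends to the localization;
its `ε`-part is then a derivation. -/
lemma exists_derivation_of_dualNumber {R T Ω : Type u} [CommRing R] [Algebra k R] [CommRing T]
    [Algebra k T] [Algebra R T] [IsScalarTower k R T] [Field Ω] [Algebra k Ω] [Algebra T Ω]
    [IsScalarTower k T Ω] (r : R) [IsLocalization.Away r T] (ψ : R →ₐ[k] DualNumber Ω)
    (hψ : ∀ a, (ψ a).fst = algebraMap T Ω (algebraMap R T a)) :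
    ∃ δ : Derivation k T Ω, ∀ a, δ (algebraMap R T a) = (ψ a).snd := by
  have hψr : ∀ m : Submonoid.powers r, IsUnit (ψ m) := fun m =>
    TrivSqZeroExt.isUnit_iff_isUnit_fst.mpr (by
      rw [hψ]
      exact (IsLocalization.map_units T m).map _)
  let ψT : T →ₐ[k] DualNumber Ω := IsLocalization.liftAlgHom (M := Submonoid.powers r) hψr
  have hψT : ∀ a : R, ψT (algebraMap R T a) = ψ a := fun a => IsLocalization.lift_eq _ a
  have hfst : ∀ t, (ψT t).fst = algebraMap T Ω t := by
    have : (TrivSqZeroExt.fstHom k Ω Ω).comp ψT = IsScalarTower.toAlgHom k T Ω := by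
      refine IsLocalization.algHom_ext (Submonoid.powers r) (AlgHom.ext fun a => ?_)
      exact (congrArg TrivSqZeroExt.fst (hψT a)).trans (hψ a)
    exact fun t => DFunLike.congr_fun this t
  refine ⟨Derivation.mk' ((TrivSqZeroExt.sndHom Ω Ω).restrictScalars k ∘ₗ ψT.toLinearMap)
    (fun a c => ?_), fun a => congrArg TrivSqZeroExt.snd (hψT a)⟩
  change (ψT (a * c)).snd = a • (ψT c).snd + c • (ψT a).snd
  rw [map_mul, TrivSqZeroExt.snd_mul, hfst, hfst, Algebra.smul_def a, Algebra.smul_def c,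
    smul_eq_mul, MulOpposite.smul_eq_mul_unop, MulOpposite.unop_op,
    mul_comm (algebraMap T Ω c)]

open scoped KaehlerDifferential in
-- Derivations factor through the Kähler differentials, which are free of rank `d`, so `W` lies in
-- the image of a space of dimension `d`.
lemma finrank_le_of_forall_exists_derivation {T Ω : Type u} [CommRing T] [Algebra k T] [Field Ω]
    [Algebra k Ω] [Algebra T Ω] [IsScalarTower k T Ω] {d : ℕ}
    [Algebra.IsStandardSmoothOfRelativeDimension d k T] (y : σ → T)
    (W : Submodule Ω (σ → Ω)) (hW : ∀ w ∈ W, ∃ δ : Derivation k T Ω, ∀ j, δ (y j) = w j) :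
    Module.finrank Ω W ≤ d := by
  have : Nontrivial T := (algebraMap T Ω).domain_nontrivial
  have := Algebra.IsStandardSmoothOfRelativeDimension.isStandardSmooth (R := k) (S := T) d
  let b := Module.Free.chooseBasis T (Ω[T⁄k])
  have hb : Module.finrank T (Ω[T⁄k]) = d :=
    Module.finrank_eq_of_rank_eq
      (Algebra.IsStandardSmoothOfRelativeDimension.rank_kaehlerDifferential d)
  let Φ : (Module.Free.ChooseBasisIndex T (Ω[T⁄k]) → Ω) →ₗ[Ω] (σ → Ω) :=
    { toFun := fun c j => b.constr Ω c (KaehlerDifferential.D k T (y j))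
      map_add' := fun c c' => by ext j; simp
      map_smul' := fun c c' => by ext j; simp }
  have hle : W ≤ LinearMap.range Φ := by
    intro w hw
    obtain ⟨δ, hδ⟩ := hW w hw
    refine ⟨δ.liftKaehlerDifferential ∘ b, ?_⟩
    ext j
    change b.constr Ω _ _ = _
    rw [show δ.liftKaehlerDifferential ∘ b = fun i => δ.liftKaehlerDifferential (b i) from rfl,
      Module.Basis.constr_self b Ω, Derivation.liftKaehlerDifferential_comp_D, hδ]
  refine (Submodule.finrank_mono hle).trans ((LinearMap.finrank_range_le Φ).trans ?_)
  rw [Module.finrank_pi, ← Module.finrank_eq_card_chooseBasisIndex, hb]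

/-- The kernel of the Jacobian matrix at `x` is the tangent space, of dimension at most `d` by
smoothness; rank-nullity then leaves full row rank. -/
lemma linearIndependent_pderiv_of_locally_isStandardSmooth [Fintype ι] [Fintype σ]
    (v : ι → MvPolynomial σ k) {d : ℕ}
    (hd : d + Fintype.card ι = Fintype.card σ)
    (h : RingHom.Locally (RingHom.IsStandardSmoothOfRelativeDimension d)
      (algebraMap k (AffineQuotient v)))
    {Ω : Type u} [Field Ω] [Algebra k Ω] (x : σ → Ω) (hx : ∀ i, MvPolynomial.aeval x (v i) = 0) :
    LinearIndependent Ω fun i j => MvPolynomial.aeval x (MvPolynomial.pderiv j (v i)) := by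
  classical
  let R := AffineQuotient v
  let χ : R →ₐ[k] Ω := Ideal.Quotient.liftₐ _ (MvPolynomial.aeval x) (by
    intro a ha
    have : Ideal.span (Set.range v) ≤ RingHom.ker (MvPolynomial.aeval (R := k) x) := by
      rw [Ideal.span_le]
      rintro _ ⟨i, rfl⟩
      exact hx i
    exact this ha)
  obtain ⟨s, hs, hsm⟩ := h
  -- The elements of `s` generate the unit ideal, so one of the standard smooth localizations
  -- contains the point `x`.
  obtain ⟨r, hrs, hr⟩ : ∃ r ∈ s, χ r ≠ 0 := by
    by_contra! hcon
    have : Ideal.span s ≤ RingHom.ker χ := Ideal.span_le.mpr hcon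
    rw [hs] at this
    exact one_ne_zero (α := Ω) ((map_one χ).symm.trans (this (Submodule.mem_top (x := 1))))
  let T := Localization.Away r
  have hsmr := hsm r hrs
  rw [← IsScalarTower.algebraMap_eq k R T] at hsmr
  have hT : Algebra.IsStandardSmoothOfRelativeDimension d k T := by
    have := hsmr
    rwa [RingHom.IsStandardSmoothOfRelativeDimension, toAlgebra_algebraMap] at this
  let χT : T →ₐ[k] Ω := IsLocalization.liftAlgHom (M := Submonoid.powers r) (f := χ) (by
    rintro ⟨_, m, rfl⟩
    rw [map_pow]
    exact (isUnit_iff_ne_zero.mpr hr).pow m)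
  have hχT : ∀ a : R, χT (algebraMap R T a) = χ a := fun a => by
    exact IsLocalization.lift_eq _ a
  let : Algebra T Ω := χT.toRingHom.toAlgebra
  have : IsScalarTower k T Ω := IsScalarTower.of_algebraMap_eq fun a => (χT.commutes a).symm
  let M : Matrix ι σ Ω :=
    Matrix.of fun i j => MvPolynomial.aeval x (MvPolynomial.pderiv j (v i))
  have hker : Module.finrank Ω (LinearMap.ker M.mulVecLin) ≤ d := by
    refine finrank_le_of_forall_exists_derivation (k := k)
      (fun j => algebraMap R T (Ideal.Quotient.mk _ (MvPolynomial.X j))) _ fun w hw => ?_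
    obtain ⟨ψ, hψ⟩ := exists_algHom_dualNumber v x hx w fun i => by
      have := congrFun (LinearMap.mem_ker.mp hw) i
      simpa [M, Matrix.mulVec, dotProduct] using this
    have hψf : (TrivSqZeroExt.fstHom k Ω Ω).comp ψ = χ := by
      refine Ideal.Quotient.algHom_ext _ (MvPolynomial.algHom_ext fun j => ?_)
      refine (congrArg TrivSqZeroExt.fst (hψ j)).trans ?_
      refine Eq.trans ?_ (MvPolynomial.aeval_X (R := k) x j).symm
      simp
    obtain ⟨δ, hδ⟩ := exists_derivation_of_dualNumber r ψ fun a =>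
      (DFunLike.congr_fun hψf a).trans (hχT a).symm
    refine ⟨δ, fun j => ?_⟩
    rw [hδ, hψ]
    simp
  have h3 := M.mulVecLin.finrank_range_add_finrank_ker
  rw [Module.finrank_pi] at h3
  change LinearIndependent Ω M.row
  rw [linearIndependent_iff_card_le_finrank_span, Set.finrank, ← Matrix.rank_eq_finrank_span_row]
  change _ ≤ Module.finrank _ (LinearMap.range M.mulVecLin)
  omega

/-- The maximal minors of the Jacobian matrix generate the unit ideal, since at the residue field of
any maximal ideal one of them is nonzero. Inverting one minor gives a submersive presentation. -/
lemma locally_isStandardSmooth_of_forall_linearIndependent_pderiv [Fintype ι] [Fintype σ]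
    (v : ι → MvPolynomial σ k)
    {d : ℕ} (hd : d + Fintype.card ι = Fintype.card σ)
    (h : ∀ (Ω : Type u) [Field Ω] [Algebra k Ω] (x : σ → Ω),
      (∀ i, MvPolynomial.aeval x (v i) = 0) →
      LinearIndependent Ω fun i j => MvPolynomial.aeval x (MvPolynomial.pderiv j (v i))) :
    RingHom.Locally (RingHom.IsStandardSmoothOfRelativeDimension d)
      (algebraMap k (AffineQuotient v)) := by
  classical
  let R := AffineQuotient v
  let N (a : ι → σ) : Matrix ι ι (MvPolynomial σ k) :=
    Matrix.of fun i j => MvPolynomial.pderiv (a i) (v j)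
  let s (a : {a : ι → σ // Function.Injective a}) : R := Ideal.Quotient.mk _ (N a).det
  refine RingHom.locally_of_exists
    RingHom.isStandardSmoothOfRelativeDimension_respectsIso _ s ?_
    (fun a => Localization.Away (s a)) fun a => ?_
  · by_contra hne
    obtain ⟨m, hm, hle⟩ := Ideal.exists_le_maximal _ hne
    let : Field (R ⧸ m) := Ideal.Quotient.field m
    let x (j : σ) : R ⧸ m := Ideal.Quotient.mk m (Ideal.Quotient.mk _ (MvPolynomial.X j))
    have hx : ∀ p, MvPolynomial.aeval x p = Ideal.Quotient.mk m (Ideal.Quotient.mk _ p) := by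
      have : MvPolynomial.aeval x = (Ideal.Quotient.mkₐ k m).comp (Ideal.Quotient.mkₐ k _) :=
        MvPolynomial.algHom_ext fun j => by simp [x]
      exact fun p => DFunLike.congr_fun this p
    obtain ⟨a, ha, hdet⟩ := exists_det_submatrix_ne_zero _ (h (R ⧸ m) x fun i => by
      rw [hx, Ideal.Quotient.eq_zero_iff_mem.mpr (Ideal.subset_span (Set.mem_range_self i)),
        map_zero])
    refine hdet ?_
    have hmem : s ⟨a, ha⟩ ∈ m := hle (Ideal.subset_span ⟨_, rfl⟩)
    rw [← Ideal.Quotient.eq_zero_iff_mem] at hmem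
    rw [← hmem, ← hx, AlgHom.map_det, ← Matrix.det_transpose]
    rfl
  · let P := Algebra.PreSubmersivePresentation.naive (R := k) (v := v) a.1 a.2
    let Q := Algebra.PreSubmersivePresentation.localizationAway (Localization.Away (s a)) (s a)
    rw [← IsScalarTower.algebraMap_eq k R (Localization.Away (s a)),
      RingHom.isStandardSmoothOfRelativeDimension_algebraMap]
    have hP : P.jacobian = s a := by
      rw [P.jacobian_eq_jacobiMatrix_det]
      have hN : P.jacobiMatrix = N a.1 := by
        ext i j : 1
        exact Algebra.PreSubmersivePresentation.jacobiMatrix_naive ..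
      rw [hN]
      rfl
    -- Inverting the minor adds one variable and one equation, so the dimension is unchanged; both
    -- factors of the composed Jacobian are images of `s a`, hence units.
    let S : Algebra.SubmersivePresentation k (Localization.Away (s a)) (Unit ⊕ σ) (Unit ⊕ ι) :=
      { toPreSubmersivePresentation := Q.comp P
        jacobian_isUnit := by
          rw [Algebra.PreSubmersivePresentation.comp_jacobian_eq_jacobian_smul_jacobian, hP,
            Algebra.PreSubmersivePresentation.localizationAway_jacobian]
          have := IsLocalization.Away.algebraMap_isUnit (S := Localization.Away (s a)) (s a)
          rw [Algebra.smul_def]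
          exact this.mul this }
    refine S.isStandardSmoothOfRelativeDimension ?_
    change Nat.card (Unit ⊕ σ) - Nat.card (Unit ⊕ ι) = d
    simp
    omega

end AffineJacobian

/-! ### Degree-zero localizations as algebras over the base field -/

section Away

open HomogeneousLocalization

variable {k A : Type u} [Field k] [CommRing A] [Algebra k A] (𝒜 : ℕ → Submodule k A)
  [GradedAlgebra 𝒜]

/-- The degree zero part of a localization of a graded `k`-algebra is a `k`-algebra. -/
instance algebraAway (x : A) : Algebra k (Away 𝒜 x) where
  algebraMap := (fromZeroRingHom 𝒜 _).comp (algebraMap k (𝒜 0))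
  commutes' _ _ := mul_comm _ _
  smul_def' c a := by
    refine HomogeneousLocalization.val_injective _ ?_
    rw [val_smul, val_mul, Algebra.smul_def]
    rfl

instance isScalarTower_away (x : A) : IsScalarTower k (Away 𝒜 x) (Localization.Away x) :=
  IsScalarTower.of_algebraMap_eq (R := k) (S := Away 𝒜 x) (A := Localization.Away x) fun _ => rfl

lemma awayι_projToSpec {x : A} {m : ℕ} (hx : x ∈ 𝒜 m) (hm : 0 < m) :
    Proj.awayι 𝒜 x hx hm ≫ projToSpec 𝒜 =
      Spec.map (CommRingCat.ofHom (algebraMap k (Away 𝒜 x))) := by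
  rw [projToSpec, Proj.awayι_toSpecZero_assoc, ← Spec.map_comp, ← CommRingCat.ofHom_comp,
    algebraAway]

variable {𝒜} {S : Type*} [CommRing S] [Algebra k S]

/-- The evaluation of homogeneous fractions `a / x ^ m` along a homomorphism which maps `x` to a
unit. -/
def awayEval (φ : A →ₐ[k] S) {x : A} (hx : IsUnit (φ x)) : Away 𝒜 x →ₐ[k] S :=
  (IsLocalization.liftAlgHom (M := Submonoid.powers x) (f := φ) (S := Localization.Away x) (by
    rintro ⟨_, m, rfl⟩
    rw [map_pow]
    exact hx.pow m)).comp (IsScalarTower.toAlgHom k (Away 𝒜 x) (Localization.Away x))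

lemma awayEval_mk (φ : A →ₐ[k] S) {x : A} (hx : IsUnit (φ x)) {d : ℕ} (hxd : x ∈ 𝒜 d) (m : ℕ)
    (a : A) (ha : a ∈ 𝒜 (m • d)) :
    awayEval φ hx (Away.mk 𝒜 hxd m a ha) * φ x ^ m = φ a := by
  have hφ : ∀ y : Submonoid.powers x, IsUnit (φ y) := by
    rintro ⟨_, m, rfl⟩
    rw [map_pow]
    exact hx.pow m
  let L := IsLocalization.liftAlgHom (M := Submonoid.powers x) (S := Localization.Away x) hφ
  have hL : ∀ b, L (algebraMap A _ b) = φ b := fun b => IsLocalization.lift_eq _ b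
  change L (Away.mk 𝒜 hxd m a ha).val * _ = _
  rw [← map_pow, ← hL (x ^ m), ← hL a, ← map_mul, Away.val_mk, Localization.mk_eq_mk']
  exact congrArg L (IsLocalization.mk'_spec (M := Submonoid.powers x) _ a ⟨x ^ m, m, rfl⟩)

lemma awayEval_unique (φ : A →ₐ[k] S) {x : A} (hx : IsUnit (φ x)) {d : ℕ} (hxd : x ∈ 𝒜 d)
    (g : Away 𝒜 x →+* S) (hg : ∀ m a ha, g (Away.mk 𝒜 hxd m a ha) * φ x ^ m = φ a) :
    g = (awayEval (𝒜 := 𝒜) φ hx).toRingHom := by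
  ext z
  obtain ⟨m, a, ha, rfl⟩ := Away.mk_surjective 𝒜 hxd z
  exact (hx.pow m).mul_right_cancel ((hg m a ha).trans (awayEval_mk φ hx hxd m a ha).symm)

end Away

lemma aeval_smul_of_isHomogeneous {σ R S : Type*} [CommRing R] [CommRing S] [Algebra R S]
    {p : MvPolynomial σ R} {m : ℕ} (hp : p.IsHomogeneous m) (c : S) (x : σ → S) :
    MvPolynomial.aeval (c • x) p = c ^ m * MvPolynomial.aeval x p := by
  rw [MvPolynomial.aeval_def, MvPolynomial.aeval_def, MvPolynomial.eval₂_eq, MvPolynomial.eval₂_eq,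
    Finset.mul_sum]
  refine Finset.sum_congr rfl fun d hd => ?_
  have := hp (MvPolynomial.mem_support_iff.mp hd)
  rw [← this, Finsupp.weight_apply, Finsupp.sum]
  simp [mul_pow, Finset.prod_mul_distrib, Finset.prod_pow_eq_pow_sum]
  ring

/-! ### Affine charts and the projective Jacobian criterion -/

section Chart

open HomogeneousLocalization

variable {n : ℕ} {k : Type u} [Field k] (I : HomogeneousIdeal (polyGrading n k))
  (i : Fin (n + 1))

lemma mk_mem_quotGrading {m : ℕ} {a : MvPolynomial (Fin (n + 1)) k} (ha : a.IsHomogeneous m) :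
    Ideal.Quotient.mk I.toIdeal a ∈ quotGrading I m :=
  ⟨a, ha, rfl⟩

/-- The standard coordinate `x_j / x_i` on the chart `x_i ≠ 0` of a closed subscheme of
projective space. -/
def chartCoord (j : Fin (n + 1)) :
    Away (quotGrading I) (Ideal.Quotient.mk I.toIdeal (MvPolynomial.X i)) :=
  Away.mk (quotGrading I) (mk_mem_quotGrading I (MvPolynomial.isHomogeneous_X k i)) 1
    (Ideal.Quotient.mk I.toIdeal (MvPolynomial.X j))
    (mk_mem_quotGrading I (MvPolynomial.isHomogeneous_X k j))

/-- In the full localization the vector of the `zⱼ / x` is `z` scaled by `1 / x`, so homogeneity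
pulls out `1 / x ^ m`. -/
lemma aeval_awayMk {R A : Type u} [Field R] [CommRing A] [Algebra R A] {𝒜 : ℕ → Submodule R A}
    [GradedAlgebra 𝒜] {τ : Type*} {x : A} (hx : x ∈ 𝒜 1) (z : τ → A) (hz : ∀ j, z j ∈ 𝒜 (1 • 1))
    {m : ℕ} {a : MvPolynomial τ R} (ha : a.IsHomogeneous m)
    (hza : MvPolynomial.aeval z a ∈ 𝒜 (m • 1)) :
    MvPolynomial.aeval (fun j => Away.mk 𝒜 hx 1 (z j) (hz j)) a =
      Away.mk 𝒜 hx m (MvPolynomial.aeval z a) hza := by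
  let T := Localization.Away x
  refine HomogeneousLocalization.val_injective _ ?_
  rw [Away.val_mk, ← HomogeneousLocalization.algebraMap_apply,
    ← MvPolynomial.aeval_algebraMap_apply]
  have h : algebraMap _ T ∘ (fun j => Away.mk 𝒜 hx 1 (z j) (hz j)) =
      (Localization.mk 1 ⟨x, 1, pow_one _⟩ : T) • (algebraMap A T ∘ z) := by
    ext j
    change (Away.mk 𝒜 hx 1 (z j) (hz j)).val = _
    rw [Away.val_mk, Pi.smul_apply, smul_eq_mul, Function.comp_apply,
      ← Localization.mk_one_eq_algebraMap, Localization.mk_mul]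
    simp
  refine (congrArg (fun z => MvPolynomial.aeval z a) h).trans ?_
  rw [aeval_smul_of_isHomogeneous ha]
  refine (congrArg _ (MvPolynomial.aeval_algebraMap_apply T z a)).trans ?_
  rw [← Localization.mk_one_eq_algebraMap, Localization.mk_pow, Localization.mk_mul, one_pow,
    one_mul, mul_one]
  rfl

lemma aeval_mk_X (a : MvPolynomial (Fin (n + 1)) k) :
    MvPolynomial.aeval (fun j => Ideal.Quotient.mk I.toIdeal (MvPolynomial.X j)) a =
      Ideal.Quotient.mk I.toIdeal a := by
  have : MvPolynomial.aeval (fun j => Ideal.Quotient.mk I.toIdeal (MvPolynomial.X j)) =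
      Ideal.Quotient.mkₐ k I.toIdeal := MvPolynomial.algHom_ext fun j => by simp
  exact DFunLike.congr_fun this a

lemma aeval_chartCoord {m : ℕ} {a : MvPolynomial (Fin (n + 1)) k} (ha : a.IsHomogeneous m) :
    MvPolynomial.aeval (chartCoord I i) a =
      Away.mk (quotGrading I) (mk_mem_quotGrading I (MvPolynomial.isHomogeneous_X k i)) m
        (Ideal.Quotient.mk I.toIdeal a) (mk_mem_quotGrading I (by simpa using ha)) := by
  have h := aeval_mk_X I a
  have := aeval_awayMk (mk_mem_quotGrading I (MvPolynomial.isHomogeneous_X k i))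
    (fun j => Ideal.Quotient.mk I.toIdeal (MvPolynomial.X j))
    (fun j => mk_mem_quotGrading I (MvPolynomial.isHomogeneous_X k j)) ha
    (by rw [h]; exact mk_mem_quotGrading I (by simpa using ha))
  refine this.trans ?_
  congr 1

lemma mem_span_X_of_isHomogeneous {σ : Type*} {m : ℕ} (hm : m ≠ 0) {a : MvPolynomial σ k}
    (ha : a.IsHomogeneous m) : a ∈ Ideal.span (Set.range (MvPolynomial.X (R := k) (σ := σ))) := by
  rw [← Set.image_univ, MvPolynomial.mem_ideal_span_X_image]
  intro d hd
  have hw := ha (MvPolynomial.mem_support_iff.mp hd)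
  by_contra! hcon
  have : d = 0 := Finsupp.ext fun j => hcon j (Set.mem_univ j)
  simp only [this, map_zero] at hw
  exact hm hw.symm

lemma irrelevant_le_span_X :
    (HomogeneousIdeal.irrelevant (quotGrading I)).toIdeal ≤
      Ideal.span (Set.range fun i => Ideal.Quotient.mk I.toIdeal (MvPolynomial.X i)) := by
  rw [HomogeneousIdeal.toIdeal_irrelevant_le]
  rintro m hm _ ⟨a, ha, rfl⟩
  have := mem_span_X_of_isHomogeneous hm.ne' ha
  have := Ideal.mem_map_of_mem (Ideal.Quotient.mk I.toIdeal) this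
  rwa [Ideal.map_span, ← Set.range_comp] at this

/-- The equations of the affine chart `x_i = 1` of `f = g = 0`. -/
def chartEquations (f g : MvPolynomial (Fin (n + 1)) k) (i : Fin (n + 1)) :
    Fin 3 → MvPolynomial (Fin (n + 1)) k :=
  ![f, g, MvPolynomial.X i - 1]

/-- The chart `x_i ≠ 0` of the projective scheme `f = g = 0` is the affine scheme
`f = g = x_i - 1 = 0`. -/
lemma exists_chart_algEquiv {d e : ℕ} {f g : MvPolynomial (Fin (n + 1)) k}
    (hf : f.IsHomogeneous d) (hg : g.IsHomogeneous e) :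
    Nonempty (AffineQuotient (chartEquations f g i) ≃ₐ[k]
      Away (quotGrading (pairIdeal hf hg))
        (Ideal.Quotient.mk (pairIdeal hf hg).toIdeal (MvPolynomial.X i))) := by
  set I := pairIdeal hf hg with hI
  have hfI : f ∈ I.toIdeal := Ideal.subset_span (by simp)
  have hgI : g ∈ I.toIdeal := Ideal.subset_span (by simp)
  have hmk0 : ∀ {m : ℕ} {a : MvPolynomial (Fin (n + 1)) k}, a.IsHomogeneous m → a ∈ I.toIdeal →
      MvPolynomial.aeval (chartCoord I i) a = 0 := fun ha haI => by
    refine (aeval_chartCoord I i ha).trans (HomogeneousLocalization.val_injective _ ?_)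
    rw [Away.val_mk, Ideal.Quotient.eq_zero_iff_mem.mpr haI, Localization.mk_zero, val_zero]
  have hi : chartCoord I i i = 1 := by
    refine HomogeneousLocalization.val_injective _ ?_
    rw [chartCoord, Away.val_mk, val_one, Localization.mk_eq_mk', IsLocalization.mk'_eq_iff_eq_mul]
    simp
  have hker : Ideal.span (Set.range (chartEquations f g i)) ≤
      RingHom.ker (MvPolynomial.aeval (R := k) (chartCoord I i)) := by
    rw [Ideal.span_le]
    rintro _ ⟨j, rfl⟩
    change MvPolynomial.aeval (chartCoord I i) _ = 0
    fin_cases j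
    · exact hmk0 hf hfI
    · exact hmk0 hg hgI
    · simp [chartEquations, hi]
  let ψ : AffineQuotient (chartEquations f g i) →ₐ[k] Away (quotGrading I)
      (Ideal.Quotient.mk I.toIdeal (MvPolynomial.X i)) :=
    Ideal.Quotient.liftₐ _ (MvPolynomial.aeval (chartCoord I i)) fun a ha => hker ha
  have hψ : ∀ p, ψ (Ideal.Quotient.mk _ p) = MvPolynomial.aeval (chartCoord I i) p := fun p => rfl
  let Q := AffineQuotient (chartEquations f g i)
  have hX1 : Ideal.Quotient.mk _ (MvPolynomial.X i) = (1 : Q) := by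
    rw [← map_one (Ideal.Quotient.mk _), Ideal.Quotient.mk_eq_mk_iff_sub_mem]
    exact Ideal.subset_span ⟨2, rfl⟩
  let φ : (MvPolynomial (Fin (n + 1)) k ⧸ I.toIdeal) →ₐ[k] Q :=
    Ideal.Quotient.liftₐ _ (Ideal.Quotient.mkₐ k _) fun a ha => by
      refine Ideal.Quotient.eq_zero_iff_mem.mpr ((Ideal.span_mono ?_ : Ideal.span {f, g} ≤ _) ha)
      rintro _ (rfl | rfl)
      · exact ⟨0, rfl⟩
      · exact ⟨1, rfl⟩
  have hφ : ∀ p, φ (Ideal.Quotient.mk _ p) = Ideal.Quotient.mk _ p := fun p => rfl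
  -- Evaluating homogeneous fractions at `xᵢ = 1` gives the inverse; only the left-inverse identity
  -- is needed, surjectivity coming from `aeval_chartCoord`.
  let χ := awayEval (𝒜 := quotGrading I) φ
    (x := Ideal.Quotient.mk I.toIdeal (MvPolynomial.X i)) (by rw [hφ, hX1]; exact isUnit_one)
  refine ⟨AlgEquiv.ofBijective ψ ⟨?_, ?_⟩⟩
  · refine Function.LeftInverse.injective (g := χ) fun q => ?_
    have : χ.comp ψ = AlgHom.id k Q := by
      refine Ideal.Quotient.algHom_ext _ (MvPolynomial.algHom_ext fun j => ?_)
      change χ (ψ (Ideal.Quotient.mk _ (MvPolynomial.X j))) = Ideal.Quotient.mk _ (MvPolynomial.X j)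
      have := awayEval_mk φ (by rw [hφ, hX1]; exact isUnit_one)
        (mk_mem_quotGrading I (MvPolynomial.isHomogeneous_X k i)) 1 _
        (mk_mem_quotGrading I (MvPolynomial.isHomogeneous_X k j))
      rw [show φ (Ideal.Quotient.mk I.toIdeal (MvPolynomial.X i)) ^ 1 = 1 from
        (pow_one _).trans hX1, mul_one] at this
      rw [hψ, MvPolynomial.aeval_X]
      exact this
    exact DFunLike.congr_fun this q
  · intro z
    obtain ⟨m, _, ⟨a, ha, rfl⟩, rfl⟩ := Away.mk_surjective (quotGrading I)
      (mk_mem_quotGrading I (MvPolynomial.isHomogeneous_X k i)) z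
    exact ⟨Ideal.Quotient.mk _ a, (hψ a).trans (aeval_chartCoord I i (by simpa using ha))⟩

lemma isSmoothIntersection_iff_locally {d e : ℕ} {f g : MvPolynomial (Fin (n + 1)) k}
    (hf : f.IsHomogeneous d) (hg : g.IsHomogeneous e) :
    IsSmoothIntersection hf hg ↔ ∀ i,
      RingHom.Locally (RingHom.IsStandardSmoothOfRelativeDimension (n - 2))
        (algebraMap k (AffineQuotient (chartEquations f g i))) := by
  set I := pairIdeal hf hg with hI
  let c := Proj.affineOpenCoverOfIrrelevantLESpan (quotGrading I)
    (fun i : Fin (n + 1) => Ideal.Quotient.mk I.toIdeal (MvPolynomial.X i))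
    (fun i => mk_mem_quotGrading I (MvPolynomial.isHomogeneous_X k i)) (fun _ => one_pos)
    (irrelevant_le_span_X I)
  have := HasRingHomProperty.instIsZariskiLocalAtSource
    (P := @SmoothOfRelativeDimension.{u} (n - 2))
  rw [IsSmoothIntersection, IsZariskiLocalAtSource.iff_of_openCover
    (P := @SmoothOfRelativeDimension.{u} (n - 2)) c.openCover]
  refine forall_congr' fun i => ?_
  change SmoothOfRelativeDimension (n - 2) (Proj.awayι _ _ _ _ ≫ _) ↔ _
  rw [awayι_projToSpec, HasRingHomProperty.Spec_iff (P := @SmoothOfRelativeDimension.{u} (n - 2))]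
  obtain ⟨e⟩ := exists_chart_algEquiv i hf hg
  have hiso := RingHom.locally_respectsIso
    (RingHom.isStandardSmoothOfRelativeDimension_respectsIso (n := n - 2))
  constructor
  · intro h
    rw [← e.symm.toAlgHom.comp_algebraMap]
    exact hiso.1 _ e.symm.toRingEquiv h
  · intro h
    rw [CommRingCat.hom_ofHom, ← e.toAlgHom.comp_algebraMap]
    exact hiso.1 _ e.toRingEquiv h

/-- The Jacobian criterion for the intersection of two hypersurfaces. -/
theorem isSmoothIntersection_iff (hn : 2 ≤ n) {d e : ℕ} {f g : MvPolynomial (Fin (n + 1)) k}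
    (hf : f.IsHomogeneous d) (hg : g.IsHomogeneous e) :
    IsSmoothIntersection hf hg ↔ ∀ (Ω : Type u) [Field Ω] [Algebra k Ω] (x : Fin (n + 1) → Ω),
      x ≠ 0 → MvPolynomial.aeval x f = 0 → MvPolynomial.aeval x g = 0 →
      LinearIndependent Ω ![fun j => MvPolynomial.aeval x (MvPolynomial.pderiv j f),
        fun j => MvPolynomial.aeval x (MvPolynomial.pderiv j g)] := by
  -- Each chart has three equations in `n + 1` variables; `2 ≤ n` makes the natural subtraction
  -- honest.
  have hcard : n - 2 + Fintype.card (Fin 3) = Fintype.card (Fin (n + 1)) := by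
    simp
    omega
  rw [isSmoothIntersection_iff_locally]
  constructor
  · intro h Ω _ _ x hx hfx hgx
    obtain ⟨i, hi⟩ := Function.ne_iff.mp hx
    have hi : x i ≠ 0 := hi
    -- The point is rescaled to lie on `xᵢ = 1`; this only multiplies the two gradients by nonzero
    -- scalars.
    have key := linearIndependent_pderiv_of_locally_isStandardSmooth (chartEquations f g i) hcard
      (h i) ((x i)⁻¹ • x) (by
        intro j
        fin_cases j
        · exact (aeval_smul_of_isHomogeneous hf _ x).trans (by rw [hfx, mul_zero])
        · exact (aeval_smul_of_isHomogeneous hg _ x).trans (by rw [hgx, mul_zero])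
        · simp [chartEquations, hi])
    have key2 : LinearIndependent Ω
        ![fun j => MvPolynomial.aeval ((x i)⁻¹ • x) (MvPolynomial.pderiv j f),
          fun j => MvPolynomial.aeval ((x i)⁻¹ • x) (MvPolynomial.pderiv j g)] := by
      convert key.comp ![0, 1] (by decide) using 1
      ext j l
      fin_cases j <;> rfl
    have hsm : ∀ {m : ℕ} {p : MvPolynomial (Fin (n + 1)) k} (hp : p.IsHomogeneous m),
        (fun j => MvPolynomial.aeval ((x i)⁻¹ • x) (MvPolynomial.pderiv j p)) =
        ((x i)⁻¹ ^ (m - 1)) • fun j => MvPolynomial.aeval x (MvPolynomial.pderiv j p) :=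
      fun hp => funext fun j => aeval_smul_of_isHomogeneous hp.pderiv _ x
    rw [hsm hf, hsm hg, LinearIndependent.pair_iff] at key2
    have hc : ∀ m, (x i)⁻¹ ^ m ≠ 0 := fun m => pow_ne_zero m (inv_ne_zero hi)
    refine LinearIndependent.pair_iff.mpr fun s t hst => ?_
    have := key2 (s / (x i)⁻¹ ^ (d - 1)) (t / (x i)⁻¹ ^ (e - 1)) (by
      rw [smul_smul, smul_smul, div_mul_cancel₀ _ (hc _), div_mul_cancel₀ _ (hc _), hst])
    simpa [div_eq_zero_iff, hc, hi] using this
  · intro h i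
    refine locally_isStandardSmooth_of_forall_linearIndependent_pderiv _ hcard
      fun Ω _ _ x hx => ?_
    have hxi : x i = 1 := by simpa [chartEquations, sub_eq_zero] using hx 2
    have key := h Ω x (fun h0 => by simp [h0] at hxi) (hx 0) (hx 1)
    have heuler : ∀ {m : ℕ} {p : MvPolynomial (Fin (n + 1)) k}, p.IsHomogeneous m →
        MvPolynomial.aeval x p = 0 →
        ∑ j, x j * MvPolynomial.aeval x (MvPolynomial.pderiv j p) = 0 := fun hp h0 => by
      have := congrArg (MvPolynomial.aeval x) hp.sum_X_mul_pderiv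
      simpa [h0] using this
    refine Fintype.linearIndependent_iff.mpr fun c hc => ?_
    have hc' : ∀ j, c 0 * MvPolynomial.aeval x (MvPolynomial.pderiv j f) +
        c 1 * MvPolynomial.aeval x (MvPolynomial.pderiv j g) + c 2 *
          (Pi.single i 1 : Fin (n + 1) → Ω) j = 0 := by
      intro j
      have := congrFun hc j
      simpa [Fin.sum_univ_three, chartEquations, MvPolynomial.pderiv_X, Pi.single_apply, apply_ite,
        eq_comm] using this
    -- Pairing the relation with `x` kills both gradients by Euler's formula and leaves `c 2 * xᵢ =
    -- c 2`.
    have h2 : c 2 = 0 := by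
      have : ∑ j, x j * (c 0 * MvPolynomial.aeval x (MvPolynomial.pderiv j f) +
        c 1 * MvPolynomial.aeval x (MvPolynomial.pderiv j g) + c 2 *
          (Pi.single i 1 : Fin (n + 1) → Ω) j) = 0 := by
        simp only [hc', mul_zero, Finset.sum_const_zero]
      have h3 : ∀ j, x j * (c 0 * MvPolynomial.aeval x (MvPolynomial.pderiv j f) +
          c 1 * MvPolynomial.aeval x (MvPolynomial.pderiv j g) + c 2 *
            (Pi.single i 1 : Fin (n + 1) → Ω) j) =
          c 0 * (x j * MvPolynomial.aeval x (MvPolynomial.pderiv j f)) +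
          c 1 * (x j * MvPolynomial.aeval x (MvPolynomial.pderiv j g)) +
          c 2 * (x j * (Pi.single i 1 : Fin (n + 1) → Ω) j) := fun j => by ring
      rw [Finset.sum_congr rfl fun j _ => h3 j, Finset.sum_add_distrib, Finset.sum_add_distrib,
        ← Finset.mul_sum, ← Finset.mul_sum, ← Finset.mul_sum, heuler hf (hx 0),
        heuler hg (hx 1)] at this
      simpa [Pi.single_apply, hxi] using this
    have h01 := LinearIndependent.pair_iff.mp key (c 0) (c 1) (funext fun j => by
      simpa [h2] using hc' j)
    intro j
    fin_cases j
    exacts [h01.1, h01.2, h2]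

end Chart

/-! ### Gram matrices and singular hyperplane sections -/

section SectionPoints

open Matrix

section GramMatrix

variable {k : Type u} [Field k] {n : ℕ}

/-- The symmetric matrix of a quadratic form. -/
def gramMatrix (q : MvPolynomial (Fin (n + 1)) k) : Matrix (Fin (n + 1)) (Fin (n + 1)) k :=
  Matrix.of fun i j =>
    2⁻¹ * MvPolynomial.constantCoeff (MvPolynomial.pderiv i (MvPolynomial.pderiv j q))

/-- Partial derivatives commute: their commutator is a derivation that vanishes on the variables. -/
lemma gramMatrix_isSymm (q : MvPolynomial (Fin (n + 1)) k) : (gramMatrix q).IsSymm := by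
  ext i j
  have h : ⁅MvPolynomial.pderiv (R := k) j, MvPolynomial.pderiv i⁆ = 0 :=
    MvPolynomial.derivation_ext fun l => by
      change MvPolynomial.pderiv j (MvPolynomial.pderiv i (MvPolynomial.X (R := k) l)) -
        MvPolynomial.pderiv i (MvPolynomial.pderiv j (MvPolynomial.X (R := k) l)) = 0
      simp [MvPolynomial.pderiv_X, Pi.single_apply, apply_ite]
  have h' : MvPolynomial.pderiv j (MvPolynomial.pderiv i q) -
      MvPolynomial.pderiv i (MvPolynomial.pderiv j q) = 0 := DFunLike.congr_fun h q
  simp only [gramMatrix, Matrix.transpose_apply, Matrix.of_apply, sub_eq_zero.mp h']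

variable [CharZero k] {q : MvPolynomial (Fin (n + 1)) k} (hq : q.IsHomogeneous 2)
  {Ω : Type*} [Field Ω] [Algebra k Ω] (x : Fin (n + 1) → Ω)

include hq in
lemma aeval_pderiv_eq_gramMatrix_mulVec (j : Fin (n + 1)) :
    MvPolynomial.aeval x (MvPolynomial.pderiv j q) =
      2 * ((gramMatrix q).map (algebraMap k Ω) *ᵥ x) j := by
  have h1 : (MvPolynomial.pderiv j q).IsHomogeneous 1 := hq.pderiv
  have h2 : ∀ i, MvPolynomial.pderiv i (MvPolynomial.pderiv j q) =
      MvPolynomial.C (2 * gramMatrix q j i) := fun i => by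
    have h0 : (MvPolynomial.pderiv i (MvPolynomial.pderiv j q)).IsHomogeneous 0 := h1.pderiv
    rw [← (gramMatrix_isSymm q).apply]
    simp only [gramMatrix, Matrix.of_apply]
    rw [mul_inv_cancel_left₀ two_ne_zero]
    exact MvPolynomial.totalDegree_eq_zero_iff_eq_C.mp (Nat.le_zero.mp h0.totalDegree_le)
  have := congrArg (MvPolynomial.aeval x) h1.sum_X_mul_pderiv
  rw [one_smul] at this
  rw [← this, map_sum, Matrix.mulVec, dotProduct, Finset.mul_sum]
  refine Finset.sum_congr rfl fun i _ => ?_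
  rw [map_mul, MvPolynomial.aeval_X, h2, MvPolynomial.aeval_C, map_mul, map_ofNat]
  simp only [Matrix.map_apply]
  ring

include hq in
lemma aeval_eq_dotProduct_gramMatrix_mulVec :
    MvPolynomial.aeval x q = x ⬝ᵥ ((gramMatrix q).map (algebraMap k Ω) *ᵥ x) := by
  have := congrArg (MvPolynomial.aeval x) hq.sum_X_mul_pderiv
  have hC : CharZero Ω := charZero_of_injective_algebraMap (algebraMap k Ω).injective
  refine mul_left_cancel₀ (two_ne_zero (α := Ω)) ?_
  rw [dotProduct, Finset.mul_sum]
  rw [map_nsmul, nsmul_eq_mul, Nat.cast_ofNat] at this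
  rw [← this, map_sum]
  refine Finset.sum_congr rfl fun i _ => ?_
  rw [map_mul, MvPolynomial.aeval_X, aeval_pderiv_eq_gramMatrix_mulVec hq]
  ring

end GramMatrix

section Sections

variable {n : ℕ} {k : Type u} [Field k] [CharZero k] {q₁ q₂ : MvPolynomial (Fin (n + 1)) k}

lemma IsSmoothIntersection.transversePencil (hn : 2 ≤ n) {h₁ : q₁.IsHomogeneous 2}
    {h₂ : q₂.IsHomogeneous 2} (hX : IsSmoothIntersection h₁ h₂) (Ω : Type u) [Field Ω]
    [Algebra k Ω] :
    TransversePencil ((gramMatrix q₁).map (algebraMap k Ω))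
      ((gramMatrix q₂).map (algebraMap k Ω)) := by
  have hC : CharZero Ω := charZero_of_injective_algebraMap (algebraMap k Ω).injective
  intro x hx h1 h2
  have := (isSmoothIntersection_iff hn h₁ h₂).mp hX Ω x hx
    ((aeval_eq_dotProduct_gramMatrix_mulVec h₁ x).trans h1)
    ((aeval_eq_dotProduct_gramMatrix_mulVec h₂ x).trans h2)
  simp only [aeval_pderiv_eq_gramMatrix_mulVec h₁, aeval_pderiv_eq_gramMatrix_mulVec h₂] at this
  rw [LinearIndependent.pair_iff] at this ⊢
  intro s t hst
  exact this s t (by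
    have h := congrArg (fun z => (2 : Ω) • z) hst
    rw [smul_zero, smul_add, smul_comm _ s, smul_comm _ t] at h
    exact h)

variable (q₁ q₂) in
/-- The symmetric matrix of the member `u₀ q₁ + u₁ q₂` of the pencil. -/
def pencilMatrix {K : Type*} [Field K] [Algebra k K] (u : Fin 2 → K) :
    Matrix (Fin (n + 1)) (Fin (n + 1)) K :=
  u 0 • (gramMatrix q₁).map (algebraMap k K) + u 1 • (gramMatrix q₂).map (algebraMap k K)

/-- A hyperplane section of a member of the pencil is smooth if and only if the hyperplane is not
tangent to it, in the sense of the dual form. -/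
theorem isSmoothIntersection_pencilForm_iff (hn : 2 ≤ n) (h₁ : q₁.IsHomogeneous 2)
    (h₂ : q₂.IsHomogeneous 2) {K : Type u} [Field K] [Algebra k K] (u : Fin 2 → K)
    {a : Fin (n + 1) → K} (ha : a ≠ 0) :
    IsSmoothIntersection (pencilForm_isHomogeneous h₁ h₂ u) (hyperplaneForm_isHomogeneous a) ↔
      dualForm (pencilMatrix q₁ q₂ u) a ≠ 0 := by
  rw [isSmoothIntersection_iff hn]
  have hmap : ∀ (Ω : Type u) [Field Ω] [Algebra K Ω] [Algebra k Ω] [IsScalarTower k K Ω],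
      (pencilMatrix q₁ q₂ u).map (algebraMap K Ω) =
        algebraMap K Ω (u 0) • (gramMatrix q₁).map (algebraMap k Ω) +
          algebraMap K Ω (u 1) • (gramMatrix q₂).map (algebraMap k Ω) := by
    intro Ω _ _ _ _
    ext i j
    change algebraMap K Ω (u 0 * algebraMap k K (gramMatrix q₁ i j) +
      u 1 * algebraMap k K (gramMatrix q₂ i j)) =
        algebraMap K Ω (u 0) * algebraMap k Ω (gramMatrix q₁ i j) +
          algebraMap K Ω (u 1) * algebraMap k Ω (gramMatrix q₂ i j)
    rw [map_add, map_mul, map_mul, ← IsScalarTower.algebraMap_apply,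
      ← IsScalarTower.algebraMap_apply]
  have hgrad : ∀ (Ω : Type u) [Field Ω] [Algebra K Ω] (x : Fin (n + 1) → Ω) (j : Fin (n + 1)),
      MvPolynomial.aeval x (MvPolynomial.pderiv j (pencilForm q₁ q₂ u)) =
        2 * ((pencilMatrix q₁ q₂ u).map (algebraMap K Ω) *ᵥ x) j := by
    intro Ω _ _ x j
    let : Algebra k Ω := ((algebraMap K Ω).comp (algebraMap k K)).toAlgebra
    have : IsScalarTower k K Ω := IsScalarTower.of_algebraMap_eq fun _ => rfl
    have hp : ∀ q : MvPolynomial (Fin (n + 1)) k, MvPolynomial.aeval x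
        (MvPolynomial.map (algebraMap k K) q) = MvPolynomial.aeval x q := fun q =>
      MvPolynomial.aeval_map_algebraMap K x q
    rw [hmap, pencilForm, map_add, map_add, MvPolynomial.pderiv_C_mul, MvPolynomial.pderiv_C_mul,
      map_mul, map_mul,
      MvPolynomial.aeval_C, MvPolynomial.aeval_C, MvPolynomial.pderiv_map, MvPolynomial.pderiv_map,
      hp, hp, aeval_pderiv_eq_gramMatrix_mulVec h₁, aeval_pderiv_eq_gramMatrix_mulVec h₂,
      add_mulVec, smul_mulVec, smul_mulVec]
    simp only [Pi.add_apply, Pi.smul_apply, smul_eq_mul]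
    ring
  have hval : ∀ (Ω : Type u) [Field Ω] [Algebra K Ω] (x : Fin (n + 1) → Ω),
      MvPolynomial.aeval x (pencilForm q₁ q₂ u) =
        x ⬝ᵥ ((pencilMatrix q₁ q₂ u).map (algebraMap K Ω) *ᵥ x) := by
    intro Ω _ _ x
    let : Algebra k Ω := ((algebraMap K Ω).comp (algebraMap k K)).toAlgebra
    have : IsScalarTower k K Ω := IsScalarTower.of_algebraMap_eq fun _ => rfl
    have hp : ∀ q : MvPolynomial (Fin (n + 1)) k, MvPolynomial.aeval x
        (MvPolynomial.map (algebraMap k K) q) = MvPolynomial.aeval x q := fun q =>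
      MvPolynomial.aeval_map_algebraMap K x q
    rw [hmap, pencilForm, map_add, map_mul, map_mul, MvPolynomial.aeval_C, MvPolynomial.aeval_C,
      hp, hp, aeval_eq_dotProduct_gramMatrix_mulVec h₁, aeval_eq_dotProduct_gramMatrix_mulVec h₂,
      add_mulVec, smul_mulVec, smul_mulVec, dotProduct_add, dotProduct_smul, dotProduct_smul,
      smul_eq_mul, smul_eq_mul]
  have hlin : ∀ (Ω : Type u) [Field Ω] [Algebra K Ω] (x : Fin (n + 1) → Ω),
      MvPolynomial.aeval x (hyperplaneForm a) = (algebraMap K Ω ∘ a) ⬝ᵥ x := by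
    intro Ω _ _ x
    simp [hyperplaneForm, dotProduct]
  have hlin' : ∀ (Ω : Type u) [Field Ω] [Algebra K Ω] (x : Fin (n + 1) → Ω) (j : Fin (n + 1)),
      MvPolynomial.aeval x (MvPolynomial.pderiv j (hyperplaneForm a)) = (algebraMap K Ω ∘ a) j := by
    intro Ω _ _ x j
    simp [hyperplaneForm, MvPolynomial.pderiv_X, Pi.single_apply]
  have hC : CharZero K := charZero_of_injective_algebraMap (algebraMap k K).injective
  constructor
  · intro h h0
    obtain ⟨x, hx, s, hs, hax⟩ := (dualForm_eq_zero_iff _ _ ha).mp h0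
    have hax' : (algebraMap K K ∘ a) ⬝ᵥ x = 0 := hax
    have hs' : (pencilMatrix q₁ q₂ u).map (algebraMap K K) *ᵥ x = s • a := hs
    have := h K x hx (by rw [hval, hs', dotProduct_smul, dotProduct_comm, hax, smul_zero])
      (by rw [hlin, hax'])
    -- The gradient of the quadric at `x` is twice `M x = s a`, and that of the hyperplane is `a`.
    have h2 := (LinearIndependent.pair_iff.mp this 1 (-(2 * s)) (funext fun j => by
      change (1 : K) * MvPolynomial.aeval x (MvPolynomial.pderiv j (pencilForm q₁ q₂ u)) +
        -(2 * s) * MvPolynomial.aeval x (MvPolynomial.pderiv j (hyperplaneForm a)) = 0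
      rw [hgrad, hlin', hs']
      change (1 : K) * (2 * (s * a j)) + -(2 * s) * a j = 0
      ring)).1
    exact one_ne_zero h2
  · intro h Ω _ _ x hx h1 h2
    have hCΩ : CharZero Ω := charZero_of_injective_algebraMap (algebraMap K Ω).injective
    have haΩ : algebraMap K Ω ∘ a ≠ 0 := fun h0 => ha (funext fun j =>
      (map_eq_zero (algebraMap K Ω)).mp (congrFun h0 j))
    by_contra hdep
    refine h ((map_eq_zero (algebraMap K Ω)).mp ?_)
    rw [map_dualForm, dualForm_eq_zero_iff _ _ haΩ]
    rw [LinearIndependent.pair_iff] at hdep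
    push Not at hdep
    obtain ⟨s, t, hst, hne⟩ := hdep
    have hj : ∀ j, s * (2 * ((pencilMatrix q₁ q₂ u).map (algebraMap K Ω) *ᵥ x) j) +
        t * algebraMap K Ω (a j) = 0 := fun j => by
      simpa [hgrad, hlin'] using congrFun hst j
    -- A relation not involving the quadric would force `a = 0`. Hence `M x` is a multiple of `a`,
    -- and `x` witnesses the vanishing of the dual form.
    have hs : s ≠ 0 := by
      rintro rfl
      refine hne rfl ?_
      by_contra ht
      exact haΩ (funext fun j => by simpa [ht] using hj j)
    refine ⟨x, hx, -(t / (2 * s)), funext fun j => ?_, (hlin Ω x).symm.trans h2⟩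
    have := hj j
    simp only [Pi.smul_apply, Function.comp_apply, smul_eq_mul]
    field_simp
    linear_combination this

end Sections

end SectionPoints

/-! ### Field-valued points of projective space -/

section Coordinates

open HomogeneousLocalization

lemma isoOfEq_inv_morphismRestrict_ι {X Y Z : Scheme.{u}} (g : X ⟶ Y) {U : Y.Opens} {V : X.Opens}
    (e : g ⁻¹ᵁ U = V) (h : Y ⟶ Z) :
    (X.isoOfEq e).inv ≫ g ∣_ U ≫ U.ι ≫ h = V.ι ≫ g ≫ h := by
  subst e
  rw [morphismRestrict_ι_assoc]
  simp

/-- When `f x` is a unit, its basic open set is all of `X`, so a single member of the gluing data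
already determines the morphism, and it factors through the chart `x ≠ 0`. -/
lemma fromOfGlobalSections_eq_of_isUnit {σ A : Type u} [CommRing A] [SetLike σ A]
    [AddSubgroupClass σ A] (𝒜 : ℕ → σ) [GradedRing 𝒜] {X : Scheme.{u}} (f : A →+* Γ(X, ⊤))
    (hf : (HomogeneousIdeal.irrelevant 𝒜).toIdeal.map f = ⊤)
    {x : A} {m : ℕ} (hx : x ∈ 𝒜 m) (hm : 0 < m) (hu : IsUnit (f x)) (g : Away 𝒜 x →+* Γ(X, ⊤))
    (hg : ∀ l a ha, g (Away.mk 𝒜 hx l a ha) * f x ^ l = f a) :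
    Proj.fromOfGlobalSections 𝒜 f hf =
      X.toSpecΓ ≫ Spec.map (CommRingCat.ofHom g) ≫ Proj.awayι 𝒜 x hx hm := by
  have hg' : g = (IsLocalization.Away.lift (S := Localization.Away x) x hu).comp
        (algebraMap (Away 𝒜 x) (Localization.Away x)) := by
    ext z
    obtain ⟨l, a, ha, rfl⟩ := Away.mk_surjective 𝒜 hx z
    refine (hu.pow l).mul_right_cancel ((hg l a ha).trans ?_)
    rw [← IsLocalization.Away.lift_eq (S := Localization.Away x) x hu a,
      ← IsLocalization.Away.lift_eq (S := Localization.Away x) x hu x, RingHom.comp_apply,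
      ← map_pow, ← map_pow, ← map_mul]
    congr 1
    rw [HomogeneousLocalization.algebraMap_apply, Away.val_mk, Localization.mk_eq_mk']
    exact (IsLocalization.mk'_spec (M := Submonoid.powers x) _ a ⟨x ^ l, l, rfl⟩).symm
  rw [hg']
  have htop : X.basicOpen (f x) = ⊤ := X.basicOpen_of_isUnit hu
  have : IsIso (X.basicOpen (f x)).ι := by
    rw [htop]
    change IsIso X.topIso.hom
    infer_instance
  rw [← cancel_epi (X.basicOpen (f x)).ι]
  refine ((Proj.openCoverOfMapIrrelevantEqTop 𝒜 f hf).ι_glueMorphisms _ _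
    ⟨_, _, hm, hx⟩).trans ?_
  change Proj.toBasicOpenOfGlobalSections 𝒜 f rfl hm hx ≫ (Proj.basicOpen 𝒜 x).ι =
    (X.basicOpen (f x)).ι ≫ _
  rw [Proj.toBasicOpenOfGlobalSections]
  simp only [Category.assoc]
  rw [Proj.basicOpenIsoSpec_inv_ι]
  have hle : Submonoid.powers x ≤ (Submonoid.powers (f x)).comap f := by
    rw [← Submonoid.map_le_iff_le_comap, Submonoid.map_powers]
  have hmap : CommRingCat.ofHom ((IsLocalization.map (M := Submonoid.powers x)
      (S := Localization.Away x)
      (T := Submonoid.powers (f x)) (Localization.Away (f x)) f hle).comp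
      (algebraMap (Away 𝒜 x) (Localization.Away x))) =
      CommRingCat.ofHom ((IsLocalization.Away.lift (S := Localization.Away x) x hu).comp
        (algebraMap (Away 𝒜 x) (Localization.Away x))) ≫
        CommRingCat.ofHom (algebraMap Γ(X, ⊤) (Localization.Away (f x))) := by
    rw [← CommRingCat.ofHom_comp, ← RingHom.comp_assoc]
    congr 2
    refine IsLocalization.ringHom_ext (Submonoid.powers x) (RingHom.ext fun a => ?_)
    simp
  rw [hmap]
  simp only [Spec.map_comp, Category.assoc]
  rw [basicOpenIsoSpecAway_hom_SpecMap_assoc]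
  exact isoOfEq_inv_morphismRestrict_ι X.toSpecΓ _ _

section Points

variable {n : ℕ} {k : Type u} [Field k] {K : Type u} [Field K] [Algebra k K]

lemma X_mem_polyGrading (i : Fin (n + 1)) :
    (MvPolynomial.X i : MvPolynomial (Fin (n + 1)) k) ∈ polyGrading n k 1 :=
  MvPolynomial.isHomogeneous_X k i

lemma pointOfCoords_eq {v : Fin (n + 1) → K} (hv : v ≠ 0) {F : MvPolynomial (Fin (n + 1)) k} {m : ℕ}
    (hF : F ∈ polyGrading n k m) (hm : 0 < m) (hFv : IsUnit (MvPolynomial.aeval v F)) :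
    pointOfCoords k v hv = Spec.map (CommRingCat.ofHom
      (awayEval (𝒜 := polyGrading n k) (MvPolynomial.aeval v) hFv).toRingHom) ≫
        Proj.awayι (polyGrading n k) F hF hm := by
  have hg : ∀ l a ha, (Scheme.ΓSpecIso (CommRingCat.of K)).inv.hom
      (awayEval (MvPolynomial.aeval v) hFv (Away.mk (polyGrading n k) hF l a ha)) *
      ((Scheme.ΓSpecIso (CommRingCat.of K)).inv.hom (MvPolynomial.aeval v F)) ^ l =
      (Scheme.ΓSpecIso (CommRingCat.of K)).inv.hom (MvPolynomial.aeval v a) := by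
    intro l a ha
    rw [← map_pow, ← map_mul, awayEval_mk]
  rw [pointOfCoords]
  refine (fromOfGlobalSections_eq_of_isUnit (polyGrading n k) _ _ hF hm
    (hFv.map (Scheme.ΓSpecIso (CommRingCat.of K)).inv.hom)
    ((Scheme.ΓSpecIso (CommRingCat.of K)).inv.hom.comp
      (awayEval (𝒜 := polyGrading n k) (MvPolynomial.aeval v) hFv).toRingHom) hg).trans ?_
  rw [CommRingCat.ofHom_comp, Spec.map_comp, CommRingCat.ofHom_hom, Category.assoc,
    toSpecΓ_SpecMap_ΓSpecIso_inv_assoc]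

lemma specMap_pointOfCoords_mem_basicOpen_iff {v : Fin (n + 1) → K} (hv : v ≠ 0)
    {F : MvPolynomial (Fin (n + 1)) k} {m : ℕ}
    (hF : F ∈ polyGrading n k m) (hm : 0 < m) (x : Spec (CommRingCat.of K)) :
    pointOfCoords k v hv x ∈ Proj.basicOpen (polyGrading n k) F ↔ MvPolynomial.aeval v F ≠ 0 := by
  change x ∈ pointOfCoords k v hv ⁻¹ᵁ Proj.basicOpen (polyGrading n k) F ↔ _
  rw [pointOfCoords, Proj.fromOfGlobalSections_preimage_basicOpen _ _ _ hm hF]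
  change x ∈ (Spec (CommRingCat.of K)).basicOpen
    ((Scheme.ΓSpecIso (CommRingCat.of K)).inv.hom (MvPolynomial.aeval v F)) ↔ _
  by_cases h : MvPolynomial.aeval v F = 0
  · simp [h]
  · rw [Scheme.basicOpen_of_isUnit _ ((isUnit_iff_ne_zero.mpr h).map _)]
    simp [h]

lemma pointOfCoords_projSpaceToSpec {v : Fin (n + 1) → K} (hv : v ≠ 0) :
    pointOfCoords k v hv ≫ projSpaceToSpec n k = Spec.map (CommRingCat.ofHom (algebraMap k K)) := by
  obtain ⟨i, hi⟩ := Function.ne_iff.mp hv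
  rw [pointOfCoords_eq hv (X_mem_polyGrading i) one_pos
    (by simpa using isUnit_iff_ne_zero.mpr hi), Category.assoc, awayι_projToSpec, ← Spec.map_comp,
    ← CommRingCat.ofHom_comp]
  congr 2
  exact AlgHom.comp_algebraMap _

lemma exists_X_notMem (x : projSpace n k) :
    ∃ i, x ∈ Proj.basicOpen (polyGrading n k) (MvPolynomial.X i) := by
  by_contra! hcon
  refine x.not_irrelevant_le ?_
  change (HomogeneousIdeal.irrelevant (polyGrading n k)).toIdeal ≤ x.asHomogeneousIdeal.toIdeal
  rw [HomogeneousIdeal.toIdeal_irrelevant_le]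
  intro m hm a ha
  have hspan : Ideal.span (Set.range (MvPolynomial.X (R := k) (σ := Fin (n + 1)))) ≤
      x.asHomogeneousIdeal.toIdeal := by
    rw [Ideal.span_le]
    rintro _ ⟨i, rfl⟩
    exact not_not.mp (hcon i)
  exact hspan (mem_span_X_of_isHomogeneous hm.ne' ha)

/-- The homogeneous coordinates of a point with values in a field. -/
lemma exists_eq_pointOfCoords_of_mem (p : Spec (CommRingCat.of K) ⟶ projSpace n k)
    (hp : p ≫ projSpaceToSpec n k = Spec.map (CommRingCat.ofHom (algebraMap k K)))
    (i : Fin (n + 1)) (x : Spec (CommRingCat.of K))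
    (hi : p x ∈ Proj.basicOpen (polyGrading n k) (MvPolynomial.X i)) :
    ∃ (v : Fin (n + 1) → K) (hv : v ≠ 0), v i = 1 ∧ p = pointOfCoords k v hv := by
  have hrange : Set.range p ⊆ Set.range (Proj.awayι (polyGrading n k) (MvPolynomial.X i)
      (X_mem_polyGrading i) one_pos) := by
    rintro _ ⟨y, rfl⟩
    rw [Subsingleton.elim y x, ← Scheme.Hom.coe_opensRange, Proj.opensRange_awayι]
    exact hi
  let g := IsOpenImmersion.lift (Proj.awayι (polyGrading n k) (MvPolynomial.X i)
      (X_mem_polyGrading i) one_pos) p hrange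
  have hg : g ≫ Proj.awayι (polyGrading n k) (MvPolynomial.X i) (X_mem_polyGrading i) one_pos = p :=
    IsOpenImmersion.lift_fac _ _ _
  obtain ⟨γ, hγ⟩ := Spec.map_surjective g
  rw [← hg, ← hγ, Category.assoc, awayι_projToSpec, ← Spec.map_comp] at hp
  let γ' : Away (polyGrading n k) (MvPolynomial.X i) →ₐ[k] K :=
    { γ.hom with
      commutes' := fun c => DFunLike.congr_fun (congrArg CommRingCat.Hom.hom
        (Spec.map_injective hp)) c }
  let y (j : Fin (n + 1)) : Away (polyGrading n k) (MvPolynomial.X i) :=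
    Away.mk (polyGrading n k) (X_mem_polyGrading i) 1 (MvPolynomial.X j) (X_mem_polyGrading j)
  -- The coordinates are the values of `xⱼ / xᵢ` at the point.
  let v : Fin (n + 1) → K := γ' ∘ y
  have hvi : v i = 1 := by
    change γ' (y i) = 1
    rw [← map_one γ']
    congr 1
    refine HomogeneousLocalization.val_injective _ ?_
    rw [Away.val_mk, val_one, Localization.mk_eq_mk', IsLocalization.mk'_eq_iff_eq_mul]
    simp
  have hv : v ≠ 0 := fun h => by simp [h] at hvi
  refine ⟨v, hv, hvi, ?_⟩
  have hu : IsUnit (MvPolynomial.aeval (R := k) v (MvPolynomial.X i)) := by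
    rw [MvPolynomial.aeval_X, hvi]
    exact isUnit_one
  rw [pointOfCoords_eq hv (X_mem_polyGrading i) one_pos hu, ← hg, ← hγ]
  congr 2
  refine CommRingCat.hom_ext (awayEval_unique (MvPolynomial.aeval v) hu (X_mem_polyGrading i) γ.hom
    fun l a ha => ?_)
  have h1 := MvPolynomial.aeval_X_left_apply (R := k) a
  have := aeval_awayMk (X_mem_polyGrading i) (MvPolynomial.X (R := k))
    X_mem_polyGrading (m := l) (a := a) (by simpa using ha) (by rw [h1]; exact ha)
  rw [MvPolynomial.aeval_X, hvi, one_pow, mul_one]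
  simp only [h1] at this
  rw [← this]
  exact (MvPolynomial.comp_aeval_apply y γ' a).trans rfl

lemma exists_eq_pointOfCoords (p : Spec (CommRingCat.of K) ⟶ projSpace n k)
    (hp : p ≫ projSpaceToSpec n k = Spec.map (CommRingCat.ofHom (algebraMap k K))) :
    ∃ (v : Fin (n + 1) → K) (hv : v ≠ 0), p = pointOfCoords k v hv := by
  obtain ⟨i, hi⟩ := exists_X_notMem (p default)
  obtain ⟨v, hv, -, h⟩ := exists_eq_pointOfCoords_of_mem p hp i default hi
  exact ⟨v, hv, h⟩

lemma specMap_comp_pointOfCoords {K' : Type u} [Field K'] [Algebra k K'] (σ : K →ₐ[k] K')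
    {v : Fin (n + 1) → K} (hv : v ≠ 0) (hv' : σ ∘ v ≠ 0) :
    Spec.map (CommRingCat.ofHom σ.toRingHom) ≫ pointOfCoords k v hv =
      pointOfCoords k (σ ∘ v) hv' := by
  obtain ⟨i, hi⟩ := Function.ne_iff.mp hv
  have hσ : ∀ a : MvPolynomial (Fin (n + 1)) k,
      MvPolynomial.aeval (σ ∘ v) a = σ (MvPolynomial.aeval v a) := fun a =>
    (MvPolynomial.comp_aeval_apply v σ a).symm
  have hu : IsUnit (MvPolynomial.aeval (R := k) v (MvPolynomial.X i)) := by
    simpa using isUnit_iff_ne_zero.mpr hi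
  have hu' : IsUnit (MvPolynomial.aeval (R := k) (σ ∘ v) (MvPolynomial.X i)) := by
    rw [hσ]
    exact hu.map σ
  rw [pointOfCoords_eq hv (X_mem_polyGrading i) one_pos hu,
    pointOfCoords_eq hv' (X_mem_polyGrading i) one_pos hu', ← Category.assoc, ← Spec.map_comp,
    ← CommRingCat.ofHom_comp]
  congr 3
  refine awayEval_unique (MvPolynomial.aeval (σ ∘ v)) hu' (X_mem_polyGrading i) _ fun l a ha => ?_
  rw [hσ, hσ, ← map_pow]
  change σ _ * σ _ = _
  rw [← map_mul]
  exact congrArg σ (awayEval_mk _ hu (X_mem_polyGrading i) l a ha)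

end Points

end Coordinates

/-! ### The Galois action on the roots of a generic dual form -/

section Monodromy

open Matrix

variable {k K L : Type u} [Field k] [Field K] [Field L] [Algebra k K] [Algebra K L] [Algebra k L]
  [IsScalarTower k K L]

lemma isAlgebraic_of_algebraMap_mem {E : Type*} [Field E] [Algebra E L] [Algebra.IsAlgebraic K L]
    (F : IntermediateField E L) (h : ∀ y : K, algebraMap K L y ∈ F) : Algebra.IsAlgebraic F L := by
  let : Algebra K F := ((algebraMap K L).codRestrict F.toSubalgebra.toSubring h).toAlgebra
  have : IsScalarTower K F L := IsScalarTower.of_algebraMap_eq fun _ => rfl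
  exact Algebra.IsAlgebraic.tower_top (K := K) F

lemma algebraMap_mem_of_adjoin_eq_top {ι : Type*} {v : ι → K}
    (hv : IntermediateField.adjoin k (Set.range v) = ⊤) (F : IntermediateField k L)
    (h : ∀ i, algebraMap K L (v i) ∈ F) (y : K) : algebraMap K L y ∈ F := by
  have : IntermediateField.adjoin k (Set.range v) ≤ F.comap (IsScalarTower.toAlgHom k K L) := by
    rw [IntermediateField.adjoin_le_iff]
    rintro _ ⟨i, rfl⟩
    exact h i
  rw [hv] at this
  exact this (IntermediateField.mem_top (x := y))

open IntermediateField.algebraAdjoinAdjoin in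
lemma trdeg_eq_of_isAlgebraic_adjoin {n : ℕ} {ρ : Fin n → L} (hρ : AlgebraicIndependent k ρ)
    [Algebra.IsAlgebraic (IntermediateField.adjoin k (Set.range ρ)) L] : Algebra.trdeg k L = n := by
  have : Algebra.IsAlgebraic (Algebra.adjoin k (Set.range ρ)) L :=
    (IsFractionRing.comap_isAlgebraic_iff
      (K := IntermediateField.adjoin k (Set.range ρ))).mpr inferInstance
  have := (hρ.isTranscendenceBasis_iff_isAlgebraic.mpr this).lift_cardinalMk_eq_trdeg
  simpa using this.symm

variable {n : ℕ} {v : Fin (n + 1) → K}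

lemma isAlgebraic_adjoin_of_adjoin_eq_top [Algebra.IsAlgebraic K L] {E : Type u} [Field E]
    [Algebra k E] [Algebra E L] [IsScalarTower k E L]
      (hgen : IntermediateField.adjoin k (Set.range v) = ⊤)
    (h0 : v 0 = 1) : Algebra.IsAlgebraic
      (IntermediateField.adjoin E (Set.range fun i : Fin n => algebraMap K L (v i.succ))) L :=
  isAlgebraic_of_algebraMap_mem (K := K) _ (algebraMap_mem_of_adjoin_eq_top hgen
    ((IntermediateField.adjoin E _).restrictScalars k) fun i => by
      rcases Fin.eq_zero_or_eq_succ i with rfl | ⟨i, rfl⟩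
      · rw [h0, map_one]
        exact one_mem _
      · exact IntermediateField.subset_adjoin E _ ⟨i, rfl⟩)

variable [Algebra.IsAlgebraic K L]

/-- Adjoining the constants algebraic over `k` does not lower the transcendence degree, by
additivity in towers. -/
lemma trdeg_algebraicClosure_eq (hi : AlgebraicIndependent k fun i : Fin n => v i.succ)
    (h0 : v 0 = 1) (hgen : IntermediateField.adjoin k (Set.range v) = ⊤) :
    Algebra.trdeg (algebraicClosure k L) L = n := by
  have := isAlgebraic_adjoin_of_adjoin_eq_top (E := k) (L := L) hgen h0
  have h1 : Algebra.trdeg k L = n := trdeg_eq_of_isAlgebraic_adjoin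
    (ρ := fun i : Fin n => algebraMap K L (v i.succ))
      (hi.map' (f := IsScalarTower.toAlgHom k K L) (algebraMap K L).injective)
  have h2 := trdeg_add_eq k (algebraicClosure k L) (A := L)
  rw [trdeg_eq_zero, zero_add, h1] at h2
  exact h2

variable [CharZero k] [IsAlgClosed L]

/-- The Galois group permutes the roots of the dual form of a generic pencil in all possible
ways, even if one only uses automorphisms which fix all the constants. -/
theorem exists_roots_dualForm (hi : AlgebraicIndependent k fun i : Fin n => v i.succ)
    (h0 : v 0 = 1) (hgen : IntermediateField.adjoin k (Set.range v) = ⊤)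
    {A B : Matrix (Fin (n + 1)) (Fin (n + 1)) k} (hA : A.IsSymm) (hB : B.IsSymm)
    (hAB : ∀ (Ω : Type u) [Field Ω] [Algebra k Ω],
      TransversePencil (A.map (algebraMap k Ω)) (B.map (algebraMap k Ω))) (l : k)
    (hdet : (l • A + B).det ≠ 0)
    (hv : dualForm ((l • A + B).map (algebraMap k K)) v ≠ 0) :
    ∃ ρ : Fin n → L, Function.Injective ρ ∧
      (∀ x : L, dualForm (A.map (algebraMap k L) + x • (l • A + B).map (algebraMap k L))
        (algebraMap K L ∘ v) = 0 ↔ ∃ j, ρ j = x) ∧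
      ∀ π : Equiv.Perm (Fin n), ∃ σ : L ≃ₐ[K] L, (∀ x : L, IsIntegral k x → σ x = x) ∧
        ∀ j, σ (ρ j) = ρ (π j) := by
  classical
  let E := algebraicClosure k L
  have hcl : IsAlgClosed E := IsAlgClosure.isAlgClosed k
  have hCL : CharZero L := charZero_of_injective_algebraMap (algebraMap k L).injective
  have htr : Algebra.trdeg E L = n := trdeg_algebraicClosure_eq hi h0 hgen
  have hsymm : ∀ {M : Matrix (Fin (n + 1)) (Fin (n + 1)) k}, M.IsSymm →
      (M.map (algebraMap k E)).IsSymm := fun hM => hM.map _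
  have hS : (l • A + B).IsSymm := (hA.smul l).add hB
  have hmapS : (l • A + B).map (algebraMap k E) =
      algebraMap k E l • A.map (algebraMap k E) + B.map (algebraMap k E) := by
    ext i j
    rw [map_apply, Matrix.add_apply, Matrix.smul_apply, Matrix.add_apply, Matrix.smul_apply,
      map_apply, map_apply, map_add,
      smul_eq_mul, smul_eq_mul, map_mul]
  have hdetE : IsUnit ((l • A + B).map (algebraMap k E)).det := by
    rw [← RingHom.mapMatrix_apply, ← RingHom.map_det]
    exact (isUnit_iff_ne_zero.mpr hdet).map _
  obtain ⟨Q, θ, hθ, hQS, hQA⟩ := TransversePencil.exists_diagonalization (hsymm hA) (hsymm hS)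
    hdetE (by
      rw [hmapS]
      exact (hAB E).smul_add _)
  have hQ := isUnit_det_of_transpose_mul_mul_eq_one hQS
  let f := algebraMap E L
  have hmapL : ∀ M : Matrix (Fin (n + 1)) (Fin (n + 1)) k,
      (M.map (algebraMap k E)).map f = M.map (algebraMap k L) := fun M => by
    ext i j
    simp [f, ← IsScalarTower.algebraMap_apply]
  have hQSL : (Q.map f)ᵀ * (l • A + B).map (algebraMap k L) * Q.map f = 1 := by
    rw [← hmapL, ← transpose_map, ← Matrix.map_mul, ← Matrix.map_mul, hQS, Matrix.map_one _
      f.map_zero f.map_one]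
  have hQAL : (Q.map f)ᵀ * A.map (algebraMap k L) * Q.map f = diagonal (f ∘ θ) := by
    rw [← hmapL, ← transpose_map, ← Matrix.map_mul, ← Matrix.map_mul, hQA, diagonal_map f.map_zero]
    rfl
  have hQL := isUnit_det_of_transpose_mul_mul_eq_one hQSL
  set w := algebraMap K L ∘ v with hw
  have hw0 : w 0 = 1 := by rw [hw, Function.comp_apply, h0, map_one]
  set b := (Q.map f)ᵀ *ᵥ w with hb
  -- The leading coefficient of the secular polynomial is, up to `det Q ^ 2`, the dual form of `S`
  -- at the generic point.
  have hsum : ∑ i, b i ^ 2 ≠ 0 := by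
    have h1 := dualForm_congr ((l • A + B).map (algebraMap k L)) (Q.map f) w
    rw [hQSL, ← diagonal_one, dualForm_diagonal] at h1
    have h2 : dualForm ((l • A + B).map (algebraMap k L)) w ≠ 0 := by
      have h3 : (l • A + B).map (algebraMap k L) =
          ((l • A + B).map (algebraMap k K)).map (algebraMap K L) := by
        ext i j
        simp only [map_apply, ← IsScalarTower.algebraMap_apply]
      rw [h3, hw, ← map_dualForm]
      exact (map_ne_zero_iff _ (algebraMap K L).injective).mpr hv
    have h3 : ∑ i, b i ^ 2 = (Q.map f).det ^ 2 * dualForm ((l • A + B).map (algebraMap k L)) w := by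
      rw [← h1]
      simp [hb]
    rw [h3]
    exact mul_ne_zero (pow_ne_zero 2 hQL.ne_zero) h2
  have hbw : ∀ j, w j = ∑ i, f (Qᵀ⁻¹ j i) * b i := by
    have h1 : (Qᵀ⁻¹).map f * (Q.map f)ᵀ = 1 := by
      rw [← transpose_map, ← Matrix.map_mul, nonsing_inv_mul _ (by rwa [det_transpose]),
        Matrix.map_one _ f.map_zero f.map_one]
    have h2 : (Qᵀ⁻¹).map f *ᵥ b = w := by rw [hb, mulVec_mulVec, h1, one_mulVec]
    intro j
    exact (congrFun h2 j).symm
  -- `b 0` is a linear combination of `1` and independent transcendentals, with the first column of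
  -- the invertible matrix `Q` as coefficients.
  have hb0 : b 0 ≠ 0 := by
    intro h
    have := isAlgebraic_adjoin_of_adjoin_eq_top (E := E) (L := L) hgen h0
    have hind := (isTranscendenceBasis_of_isAlgebraic_adjoin htr
      fun i : Fin n => algebraMap K L (v i.succ)).1
    let p : MvPolynomial (Fin n) E := MvPolynomial.C (Q 0 0) +
      ∑ i : Fin n, MvPolynomial.C (Q i.succ 0) * MvPolynomial.X i
    have hp : p = 0 := by
      refine hind ?_
      rw [map_zero, ← h]
      simp [p, hb, mulVec, dotProduct, Fin.sum_univ_succ, hw0, map_sum, f]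
      rfl
    refine hQ.ne_zero (det_eq_zero_of_column_eq_zero 0 fun i => ?_)
    have h00 : Q 0 0 = 0 := by
      simpa [p] using congrArg MvPolynomial.constantCoeff hp
    rcases Fin.eq_zero_or_eq_succ i with rfl | ⟨i, rfl⟩
    · exact h00
    · simpa [p, h00, Pi.single_apply] using congrArg (MvPolynomial.eval (Pi.single i 1)) hp
  -- The normalization `w 0 = 1` recovers the affine coordinates from the ratios of the `bᵢ`. Hence
  -- an automorphism fixing `E` and these ratios fixes the whole function field.
  have hw' : ∀ j, w j = (∑ i, f (Qᵀ⁻¹ j i) * (b i / b 0)) / ∑ i, f (Qᵀ⁻¹ 0 i) * (b i / b 0) := by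
    intro j
    have h1 : ∀ j, w j / b 0 = ∑ i, f (Qᵀ⁻¹ j i) * (b i / b 0) := fun j => by
      rw [hbw j, Finset.sum_div]
      exact Finset.sum_congr rfl fun i _ => mul_div_assoc _ _ _
    rw [← h1, ← h1, hw0]
    field_simp
  have halg : Algebra.IsAlgebraic
      (IntermediateField.adjoin E (Set.range fun i : Fin n => b i.succ / b 0)) L := by
    refine isAlgebraic_of_algebraMap_mem (K := K) _ (algebraMap_mem_of_adjoin_eq_top hgen
      ((IntermediateField.adjoin E _).restrictScalars k) fun j => ?_)
    have hmem : ∀ i, b i / b 0 ∈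
        IntermediateField.adjoin E (Set.range fun i : Fin n => b i.succ / b 0) := fun i => by
      rcases Fin.eq_zero_or_eq_succ i with rfl | ⟨i, rfl⟩
      · rw [div_self hb0]
        exact one_mem _
      · exact IntermediateField.subset_adjoin E _ ⟨i, rfl⟩
    change w j ∈ IntermediateField.adjoin E _
    rw [hw' j]
    exact div_mem (sum_mem fun i _ => mul_mem (IntermediateField.algebraMap_mem _ _) (hmem i))
      (sum_mem fun i _ => mul_mem (IntermediateField.algebraMap_mem _ _) (hmem i))
  obtain ⟨ρ, hρ, hroots, hperm⟩ := exists_algEquiv_roots_secularPoly htr hθ hb0 hsum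
  refine ⟨ρ, hρ, fun x => ?_, fun π => ?_⟩
  · rw [← hroots, ← dualForm_smul_add_eq_eval_secularPoly hQSL hQAL]
    simp [hQL.ne_zero]
  · obtain ⟨σ, hσ, hσρ⟩ := hperm π
    have hσw : ∀ j, σ (w j) = w j := fun j => by
      rw [hw' j, map_div₀, map_sum, map_sum]
      simp only [map_mul, hσ]
      congr 1 <;> exact Finset.sum_congr rfl fun i _ => by rw [σ.commutes]
    have hσK : ∀ y : K, σ (algebraMap K L y) = algebraMap K L y := fun y =>
      algebraMap_mem_of_adjoin_eq_top hgen
        ((AlgHom.equalizer (σ : L →ₐ[E] L) (AlgHom.id E L)).restrictScalars k |>.toIntermediateField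
          fun x hx => by
            change σ x⁻¹ = x⁻¹
            rw [map_inv₀, show σ x = x from hx]) hσw y
    refine ⟨AlgEquiv.ofRingEquiv (f := (σ : L ≃+* L)) hσK, fun x hx => ?_, hσρ⟩
    exact σ.commutes (⟨x, mem_algebraicClosure_iff.mpr hx.isAlgebraic⟩ : E)

end Monodromy

/-! ### Coordinates of the generic point -/

section GenericPoint

open HomogeneousLocalization

variable (n : ℕ) (k : Type u) [Field k]

/-- The function field of projective space over `k` as an extension of `k`. -/
instance algebraGenericField : Algebra k (genericField (projSpace n k)) :=
  (Spec.preimage ((projSpace n k).fromSpecResidueField (genericPoint (projSpace n k)) ≫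
    projSpaceToSpec n k)).hom.toAlgebra

lemma fromSpecResidueField_projSpaceToSpec :
    (projSpace n k).fromSpecResidueField (genericPoint (projSpace n k)) ≫ projSpaceToSpec n k =
      Spec.map (CommRingCat.ofHom (algebraMap k (genericField (projSpace n k)))) :=
  (Spec.map_preimage _).symm

variable {n k}

/-- The tautological point over the fraction field of the polynomial ring shows that this open set
is nonempty, and the generic point lies in every nonempty open set. -/
lemma genericPoint_mem_basicOpen {F : MvPolynomial (Fin (n + 1)) k} {m : ℕ}
    (hF : F ∈ polyGrading n k m) (hm : 0 < m) (hF0 : F ≠ 0) :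
    genericPoint (projSpace n k) ∈ Proj.basicOpen (polyGrading n k) F := by
  let Q := FractionRing (MvPolynomial (Fin (n + 1)) k)
  let f := IsScalarTower.toAlgHom k (MvPolynomial (Fin (n + 1)) k) Q
  have hf : Function.Injective f := IsFractionRing.injective _ _
  let v : Fin (n + 1) → Q := fun i => f (MvPolynomial.X i)
  have hv : v ≠ 0 := fun h => (map_ne_zero_iff f hf).mpr (MvPolynomial.X_ne_zero (R := k) 0)
    (congrFun h 0)
  have hx := (specMap_pointOfCoords_mem_basicOpen_iff hv hF hm default).mpr (by
    rw [show MvPolynomial.aeval v = f from MvPolynomial.algHom_ext fun i => by simp [v]]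
    exact (map_ne_zero_iff f hf).mpr hF0)
  exact (genericPoint_specializes _).mem_open (Proj.basicOpen (polyGrading n k) F).isOpen hx

variable (n k) in
/-- The homogeneous coordinates of the generic point of projective space. -/
theorem exists_coords_genericPoint :
    ∃ (v : Fin (n + 1) → genericField (projSpace n k)) (hv : v ≠ 0), v 0 = 1 ∧
      (projSpace n k).fromSpecResidueField (genericPoint (projSpace n k)) = pointOfCoords k v hv ∧
      (∀ (m : ℕ) (F : MvPolynomial (Fin (n + 1)) k), F.IsHomogeneous m → F ≠ 0 →
        MvPolynomial.aeval v F ≠ 0) ∧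
      AlgebraicIndependent k (fun i : Fin n => v i.succ) ∧
      IntermediateField.adjoin k (Set.range v) = ⊤ := by
  set η := genericPoint (projSpace n k) with hη
  have hη' : ∀ x : Spec (genericField (projSpace n k)),
      (projSpace n k).fromSpecResidueField η x = η := fun x =>
    (projSpace n k).fromSpecResidueField_apply η x
  obtain ⟨v, hv, hv0, hp⟩ := exists_eq_pointOfCoords_of_mem (K := genericField (projSpace n k))
    ((projSpace n k).fromSpecResidueField η) (fromSpecResidueField_projSpaceToSpec n k) 0 default
    (by
      have := genericPoint_mem_basicOpen (n := n) (k := k) (X_mem_polyGrading 0) one_pos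
        (MvPolynomial.X_ne_zero (R := k) (0 : Fin (n + 1)))
      exact (hη' _).symm ▸ this)
  have hne : ∀ (m : ℕ) (F : MvPolynomial (Fin (n + 1)) k), F.IsHomogeneous m → F ≠ 0 →
      MvPolynomial.aeval v F ≠ 0 := by
    intro m F hF hF0
    -- The factor `X 0` makes the degree positive, to include constants `F`.
    have hX : (MvPolynomial.X 0 * F) ∈ polyGrading n k (1 + m) :=
      (MvPolynomial.isHomogeneous_X k (0 : Fin (n + 1))).mul hF
    have h1 := (specMap_pointOfCoords_mem_basicOpen_iff hv hX (by omega) default).mp (by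
      rw [← hp, hη']
      exact genericPoint_mem_basicOpen hX (by omega) (mul_ne_zero (MvPolynomial.X_ne_zero _) hF0))
    rw [map_mul] at h1
    exact right_ne_zero_of_mul h1
  refine ⟨v, hv, hv0, hp, hne, ?_, ?_⟩
  · rw [algebraicIndependent_iff]
    intro p hp0
    let y (j : Fin (n + 1)) : Away (polyGrading n k) (MvPolynomial.X 0) :=
      Away.mk (polyGrading n k) (X_mem_polyGrading 0) 1 (MvPolynomial.X j) (X_mem_polyGrading j)
    have hev : ∀ {S : Type u} [CommRing S] [Algebra k S] (w : Fin (n + 1) → S) (hw0 : w 0 = 1)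
        (hw : IsUnit (MvPolynomial.aeval (R := k) w (MvPolynomial.X 0))) (j : Fin (n + 1)),
        awayEval (𝒜 := polyGrading n k) (MvPolynomial.aeval w) hw (y j) = w j := by
      intro S _ _ w hw0 hw j
      have := awayEval_mk (𝒜 := polyGrading n k) (MvPolynomial.aeval w) hw (X_mem_polyGrading 0) 1 _
        (X_mem_polyGrading j)
      simpa [hw0] using this
    have hv0' : IsUnit (MvPolynomial.aeval (R := k) v (MvPolynomial.X 0)) := by
      rw [MvPolynomial.aeval_X, hv0]
      exact isUnit_one
    -- A relation `p` is homogenized to a fraction in the `xⱼ / x₀` that vanishes at the generic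
    -- point. Its numerator is then zero, and setting `x₀ = 1` returns `p = 0`.
    let z := MvPolynomial.aeval (R := k) (fun j : Fin n => y j.succ) p
    have hz : awayEval (𝒜 := polyGrading n k) (MvPolynomial.aeval v) hv0' z = 0 := by
      rw [← hp0, MvPolynomial.comp_aeval_apply]
      simp only [hev v hv0]
    have hz0 : z = 0 := by
      obtain ⟨m, a, ha, hza⟩ := Away.mk_surjective (polyGrading n k) (X_mem_polyGrading 0) z
      have h1 := awayEval_mk (𝒜 := polyGrading n k) (MvPolynomial.aeval v) hv0'
        (X_mem_polyGrading 0)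
        m a ha
      rw [hza, hz, zero_mul] at h1
      have ha0 : a = 0 := by
        by_contra h
        exact hne _ a ha h h1.symm
      rw [← hza]
      refine HomogeneousLocalization.val_injective _ ?_
      rw [Away.val_mk, ha0, Localization.mk_zero, val_zero]
    let w : Fin (n + 1) → MvPolynomial (Fin n) k := Fin.cons 1 MvPolynomial.X
    have hw : IsUnit (MvPolynomial.aeval (R := k) w (MvPolynomial.X 0)) := by simp [w]
    have h2 : awayEval (𝒜 := polyGrading n k) (MvPolynomial.aeval w) hw z = p := by
      rw [MvPolynomial.comp_aeval_apply]
      simp only [hev w rfl]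
      exact MvPolynomial.aeval_X_left_apply p
    rw [← h2, hz0, map_zero]
  · let K₀ := IntermediateField.adjoin k (Set.range v)
    let v₀ : Fin (n + 1) → K₀ := fun i => ⟨v i, IntermediateField.subset_adjoin _ _ ⟨i, rfl⟩⟩
    have hv₀ : v₀ ≠ 0 := fun h => by
      have := congrArg Subtype.val (congrFun h 0)
      change v 0 = 0 at this
      rw [hv0] at this
      exact one_ne_zero this
    have hfac : Spec.map (CommRingCat.ofHom K₀.val.toRingHom) ≫ pointOfCoords k v₀ hv₀ =
        (projSpace n k).fromSpecResidueField η :=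
      (specMap_comp_pointOfCoords K₀.val hv₀ hv).trans hp.symm
    obtain ⟨⟨x, f⟩, hf⟩ := (Scheme.SpecToEquivOfField K₀ (projSpace n k)).symm.surjective
      (pointOfCoords k v₀ hv₀)
    change Spec.map f ≫ (projSpace n k).fromSpecResidueField x = _ at hf
    have hx : x = η := by
      rw [← hη' default, ← hfac, ← hf, Scheme.Hom.comp_apply, Scheme.Hom.comp_apply,
        Scheme.fromSpecResidueField_apply]
    rw [hη] at hx
    subst hx
    rw [← hf, ← Category.assoc, ← Spec.map_comp] at hfac
    have h1 := (cancel_mono ((projSpace n k).fromSpecResidueField η)).mp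
      (hfac.trans (Category.id_comp _).symm)
    rw [← Spec.map_id] at h1
    have h2 := Spec.map_injective h1
    rw [eq_top_iff]
    intro z _
    have h3 : (f z : K₀).val = z := DFunLike.congr_fun (congrArg CommRingCat.Hom.hom h2) z
    rw [← h3]
    exact (f z : K₀).2

end GenericPoint

/-! ### Affine charts of the product with the pencil -/

section ProductChart

open HomogeneousLocalization Polynomial

variable {k : Type u} [Field k] (l : k)

/-- The linear form `x₀ - l x₁` on the projective line. -/
def lineForm : MvPolynomial (Fin 2) k := MvPolynomial.X 0 - MvPolynomial.C l * MvPolynomial.X 1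

lemma lineForm_mem : lineForm l ∈ polyGrading 1 k 1 := by
  refine Submodule.sub_mem _ (X_mem_polyGrading 0) ?_
  rw [← MvPolynomial.smul_eq_C_mul]
  exact Submodule.smul_mem _ l (X_mem_polyGrading 1)

/-- The coordinates `[1 + l t : t]` on the locus where `x₀ - l x₁` does not vanish. -/
def lineCoords {R : Type*} [CommRing R] [Algebra k R] (t : R) : Fin 2 → R :=
  ![1 + algebraMap k R l * t, t]

lemma aeval_lineForm {R : Type*} [CommRing R] [Algebra k R] (u : Fin 2 → R) :
    MvPolynomial.aeval u (lineForm l) = u 0 - algebraMap k R l * u 1 := by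
  simp [lineForm]

lemma aeval_lineCoords {R : Type*} [CommRing R] [Algebra k R] (t : R) :
    MvPolynomial.aeval (lineCoords l t) (lineForm l) = 1 := by
  simp [aeval_lineForm, lineCoords]

/-- The coordinate functions `xⱼ / (x₀ - l x₁)`. -/
def lineCoord (j : Fin 2) : Away (polyGrading 1 k) (lineForm l) :=
  Away.mk (polyGrading 1 k) (lineForm_mem l) 1 (MvPolynomial.X j) (X_mem_polyGrading j)

lemma awayMk_lineForm (m : ℕ) (a : MvPolynomial (Fin 2) k) (ha : a ∈ polyGrading 1 k (m • 1)) :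
    Away.mk (polyGrading 1 k) (lineForm_mem l) m a ha = MvPolynomial.aeval (lineCoord l) a := by
  have h1 := MvPolynomial.aeval_X_left_apply (R := k) a
  have := aeval_awayMk (lineForm_mem l) (MvPolynomial.X (R := k))
    X_mem_polyGrading (m := m) (a := a) (by simpa using ha) (by rw [h1]; exact ha)
  simp only [h1] at this
  exact this.symm

lemma lineCoord_eq : lineCoord l = lineCoords l (lineCoord l 1) := by
  have h := awayMk_lineForm l 1 (lineForm l) (by simpa using lineForm_mem l)
  have h1 : Away.mk (polyGrading 1 k) (lineForm_mem l) 1 (lineForm l)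
      (by simpa using lineForm_mem l) = 1 := by
    refine HomogeneousLocalization.val_injective _ ?_
    rw [Away.val_mk, val_one, Localization.mk_eq_mk', IsLocalization.mk'_eq_iff_eq_mul]
    simp
  rw [h1, aeval_lineForm] at h
  ext j : 1
  fin_cases j
  · simp [lineCoords, h]
  · simp [lineCoords]

lemma awayEval_lineCoords {R : Type*} [CommRing R] [Algebra k R] (t : R)
    (ht : IsUnit (MvPolynomial.aeval (lineCoords l t) (lineForm l))) (m : ℕ)
    (a : MvPolynomial (Fin 2) k) (ha : a ∈ polyGrading 1 k (m • 1)) :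
    awayEval (𝒜 := polyGrading 1 k) (MvPolynomial.aeval (lineCoords l t)) ht
      (Away.mk (polyGrading 1 k) (lineForm_mem l) m a ha) =
        MvPolynomial.aeval (lineCoords l t) a := by
  have h := awayEval_mk (𝒜 := polyGrading 1 k) (MvPolynomial.aeval (lineCoords l t)) ht
    (lineForm_mem l) m a ha
  have h1 := congrArg (· ^ m) (aeval_lineCoords l t)
  simp only [one_pow] at h1
  exact (mul_one _).symm.trans ((congrArg _ h1.symm).trans h)

/-- The coordinate ring of the complement of a point in the projective line. -/
def lineAlgEquiv : Away (polyGrading 1 k) (lineForm l) ≃ₐ[k] k[X] :=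
  AlgEquiv.ofAlgHom
    (awayEval (MvPolynomial.aeval (lineCoords l X)) (by rw [aeval_lineCoords]; exact isUnit_one))
    (Polynomial.aeval (lineCoord l 1))
    (by
      refine Polynomial.algHom_ext ?_
      rw [AlgHom.comp_apply, aeval_X, AlgHom.id_apply, lineCoord, awayEval_lineCoords]
      simp [lineCoords])
    (by
      refine AlgHom.ext fun z => ?_
      obtain ⟨m, a, ha, rfl⟩ := Away.mk_surjective (polyGrading 1 k) (lineForm_mem l) z
      rw [AlgHom.comp_apply, awayEval_lineCoords, MvPolynomial.comp_aeval_apply, AlgHom.id_apply,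
        awayMk_lineForm]
      congr 2
      conv_rhs => rw [lineCoord_eq]
      ext j : 1
      fin_cases j <;> simp [lineCoords])

lemma lineAlgEquiv_lineCoord (j : Fin 2) : lineAlgEquiv l (lineCoord l j) = lineCoords l X j :=
  (awayEval_lineCoords l X (by rw [aeval_lineCoords]; exact isUnit_one) 1 _
    (X_mem_polyGrading j)).trans (MvPolynomial.aeval_X _ _)

/-- The chart of the projective line which is the complement of `[l : 1]`. -/
def lineChart : Spec (CommRingCat.of k[X]) ⟶ projSpace 1 k :=
  Spec.map (CommRingCat.ofHom (lineAlgEquiv l).toRingHom) ≫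
    Proj.awayι (polyGrading 1 k) (lineForm l) (lineForm_mem l) one_pos

instance isIso_specMap_lineAlgEquiv :
    IsIso (Spec.map (CommRingCat.ofHom (lineAlgEquiv l).toRingHom)) := by
  have : IsIso (CommRingCat.ofHom (lineAlgEquiv l).toRingHom) :=
    (lineAlgEquiv l).toRingEquiv.toCommRingCatIso.isIso_hom
  infer_instance

instance isOpenImmersion_lineChart : IsOpenImmersion (lineChart l) := by
  rw [lineChart]
  infer_instance

lemma range_lineChart :
    Set.range (lineChart l) = Proj.basicOpen (polyGrading 1 k) (lineForm l) := by
  rw [← Proj.opensRange_awayι (polyGrading 1 k) (lineForm l) (lineForm_mem l) one_pos,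
    Scheme.Hom.coe_opensRange, lineChart, Scheme.Hom.comp_base, TopCat.coe_comp, Set.range_comp,
    Set.range_eq_univ.mpr, Set.image_univ]
  exact Scheme.Hom.surjective _

lemma lineChart_projSpaceToSpec :
    lineChart l ≫ projSpaceToSpec 1 k = Spec.map (CommRingCat.ofHom (algebraMap k k[X])) := by
  rw [lineChart, Category.assoc, awayι_projToSpec, ← Spec.map_comp, ← CommRingCat.ofHom_comp]
  congr 2
  exact (lineAlgEquiv l).toAlgHom.comp_algebraMap

variable {n : ℕ} {F : MvPolynomial (Fin (n + 1)) k} (hF : F ∈ polyGrading n k 2)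

attribute [local instance] Polynomial.algebra

variable (n) in
lemma isPullback_specMap_polynomial (B : Type u) [CommRing B] [Algebra k B] :
    IsPullback (Spec.map (CommRingCat.ofHom (mapRingHom (algebraMap k B))))
      (Spec.map (CommRingCat.ofHom (C : B →+* B[X])))
      (Spec.map (CommRingCat.ofHom (algebraMap k k[X])))
      (Spec.map (CommRingCat.ofHom (algebraMap k B))) :=
  isPullback_SpecMap_of_isPushout _ _ _ _ (CommRingCat.isPushout_of_isPushout k k[X] B B[X])

/-- The chart of `ℙ¹ × ℙⁿ` where `x₀ - l x₁` and the quadratic form `F` do not vanish. -/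
def productChart : Spec (CommRingCat.of (Away (polyGrading n k) F)[X]) ⟶ pencilProd n k :=
  (isPullback_specMap_polynomial (Away (polyGrading n k) F)).isoPullback.hom ≫
    Limits.pullback.map _ _ _ _ (lineChart l) (Proj.awayι (polyGrading n k) F hF two_pos) (𝟙 _)
      (by rw [lineChart_projSpaceToSpec, Category.comp_id])
      (by rw [awayι_projToSpec, Category.comp_id])

instance isOpenImmersion_productChart : IsOpenImmersion (productChart l hF) := by
  rw [productChart]
  infer_instance

lemma range_productChart : Set.range (productChart l hF) =
    Limits.pullback.fst (projSpaceToSpec 1 k) (projSpaceToSpec n k) ⁻¹'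
      (Proj.basicOpen (polyGrading 1 k) (lineForm l)) ∩
    Limits.pullback.snd (projSpaceToSpec 1 k) (projSpaceToSpec n k) ⁻¹'
      (Proj.basicOpen (polyGrading n k) F) := by
  rw [← range_lineChart, ← Proj.opensRange_awayι (polyGrading n k) F hF two_pos,
    Scheme.Hom.coe_opensRange, productChart, Scheme.Hom.comp_base, TopCat.coe_comp, Set.range_comp,
    Set.range_eq_univ.mpr, Set.image_univ, Scheme.Pullback.range_map]
  exact Scheme.Hom.surjective _

lemma productChart_fst : productChart l hF ≫ Limits.pullback.fst _ _ =
    Spec.map (CommRingCat.ofHom (mapRingHom (algebraMap k (Away (polyGrading n k) F)))) ≫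
      lineChart l := by
  rw [productChart, Category.assoc, Limits.pullback.map, Limits.pullback.lift_fst, ← Category.assoc,
    IsPullback.isoPullback_hom_fst]

lemma productChart_snd : productChart l hF ≫ Limits.pullback.snd _ _ =
    Spec.map (CommRingCat.ofHom (C : _ →+* (Away (polyGrading n k) F)[X])) ≫
      Proj.awayι (polyGrading n k) F hF two_pos := by
  rw [productChart, Category.assoc, Limits.pullback.map, Limits.pullback.lift_snd, ← Category.assoc,
    IsPullback.isoPullback_hom_snd]

end ProductChart

/-! ### Reduced closed subschemes and gluing of charts -/

section Subscheme

variable {P : Scheme.{u}} (Z : TopologicalSpace.Closeds P)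

instance isReduced_subscheme_vanishingIdeal :
    IsReduced (Scheme.IdealSheafData.vanishingIdeal Z).subscheme := by
  have (U : (Scheme.IdealSheafData.vanishingIdeal Z).subschemeCover.openCover.I₀) : IsReduced
      ((Scheme.IdealSheafData.vanishingIdeal Z).subschemeCover.openCover.X U) := by
    let U' : P.affineOpens := U
    have : _root_.IsReduced (Γ(P, U') ⧸ (Scheme.IdealSheafData.vanishingIdeal Z).ideal U') := by
      rw [← Ideal.isRadical_iff_quotient_reduced]
      exact PrimeSpectrum.isRadical_vanishingIdeal _
    exact inferInstanceAs (IsReduced (Spec (CommRingCat.of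
      (Γ(P, U') ⧸ (Scheme.IdealSheafData.vanishingIdeal Z).ideal U'))))
  exact IsReduced.of_openCover _
    (Scheme.IdealSheafData.vanishingIdeal Z).subschemeCover.openCover

/-- In an affine chart in which `Z` is the zero locus of a radical ideal, the reduced closed
subscheme on `Z` is the spectrum of the quotient ring. -/
lemma exists_subscheme_chart {R : Type u} [CommRing R] (j : Spec (CommRingCat.of R) ⟶ P)
    [IsOpenImmersion j] {J : Ideal R} (hJ : J.IsRadical)
    (h : j ⁻¹' (Z : Set P) = PrimeSpectrum.zeroLocus J) :
    ∃ τ : Spec (CommRingCat.of (R ⧸ J)) ⟶ (Scheme.IdealSheafData.vanishingIdeal Z).subscheme,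
      IsOpenImmersion τ ∧
      τ ≫ (Scheme.IdealSheafData.vanishingIdeal Z).subschemeι =
        Spec.map (CommRingCat.ofHom (Ideal.Quotient.mk J)) ≫ j ∧
      Set.range τ = (Scheme.IdealSheafData.vanishingIdeal Z).subschemeι ⁻¹' Set.range j := by
  set ι := (Scheme.IdealSheafData.vanishingIdeal Z).subschemeι with hι
  have hred : IsReduced (Limits.pullback ι j) := isReduced_of_isOpenImmersion
    (Limits.pullback.fst ι j)
  obtain ⟨J', e, he⟩ := IsClosedImmersion.Spec_iff.mp
    (inferInstance : IsClosedImmersion (Limits.pullback.snd ι j))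
  have hrad : J'.IsRadical := by
    rw [Ideal.isRadical_iff_quotient_reduced]
    have : IsReduced (Spec (CommRingCat.of (R ⧸ J'))) := isReduced_of_isOpenImmersion e.inv
    exact (affine_isReduced_iff _).mp this
  -- Both ideals are radical and cut out the same closed set.
  have hJJ : J' = J := by
    have h1 : Set.range (Limits.pullback.snd ι j) = PrimeSpectrum.zeroLocus J := by
      rw [← h, Scheme.Pullback.range_snd, hι, Scheme.IdealSheafData.range_subschemeι]
      simp
    have h2 : Set.range (Limits.pullback.snd ι j) = PrimeSpectrum.zeroLocus J' := by
      rw [he, Scheme.Hom.comp_base, TopCat.coe_comp, Set.range_comp, Set.range_eq_univ.mpr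
        (Scheme.Hom.surjective _), Set.image_univ]
      exact (range_comap_of_surjective _ _ Ideal.Quotient.mk_surjective).trans
        (by rw [Ideal.mk_ker])
    have h3 := (PrimeSpectrum.zeroLocus_eq_iff).mp (h2.symm.trans h1)
    rwa [hrad.radical, hJ.radical] at h3
  subst hJJ
  refine ⟨e.inv ≫ Limits.pullback.fst ι j, inferInstance, ?_, ?_⟩
  · rw [Category.assoc, Limits.pullback.condition, he, Category.assoc, e.inv_hom_id_assoc]
  · rw [Scheme.Hom.comp_base, TopCat.coe_comp, Set.range_comp, Set.range_eq_univ.mpr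
      (Scheme.Hom.surjective _), Set.image_univ, Scheme.Pullback.range_fst]

/-- A scheme covered by irreducible open subschemes with a common point is irreducible. -/
lemma irreducibleSpace_of_forall_exists {X : Type*} [TopologicalSpace X] {ι : Type*}
    (U : ι → Set X) (hU : ∀ i, IsOpen (U i)) (hirr : ∀ i, IsIrreducible (U i))
    (hcov : ∀ x, ∃ i, x ∈ U i) (x₀ : X) (hx₀ : ∀ i, x₀ ∈ U i) : IrreducibleSpace X := by
  obtain ⟨i₀, -⟩ := hcov x₀
  rw [irreducibleSpace_def]
  have : closure (U i₀) = Set.univ := by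
    refine Set.eq_univ_of_forall fun x => mem_closure_iff.mpr fun V hV hxV => ?_
    obtain ⟨i, hi⟩ := hcov x
    obtain ⟨y, hy, hyV, hyU⟩ := (hirr i).isPreirreducible V (U i₀) hV (hU i₀) ⟨x, hi, hxV⟩
      ⟨x₀, hx₀ i, hx₀ i₀⟩
    exact ⟨y, hyV, hyU⟩
  have h := (hirr i₀).closure
  rwa [this] at h

lemma isIntegral_of_charts {X : Scheme.{u}} [IsReduced X] {ι : Type*} (T : ι → Scheme.{u})
    [∀ i, IsIntegral (T i)] (τ : ∀ i, T i ⟶ X) [∀ i, IsOpenImmersion (τ i)]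
    (hcov : ∀ x, ∃ i, x ∈ Set.range (τ i)) (x₀ : X) (hx₀ : ∀ i, x₀ ∈ Set.range (τ i)) :
    IsIntegral X := by
  have : IrreducibleSpace X := irreducibleSpace_of_forall_exists (fun i => Set.range (τ i))
    (fun i => (τ i).isOpenEmbedding.isOpen_range) (fun i => by
      have := (irreducibleSpace_def _).mp (inferInstance : IrreducibleSpace (T i))
      rw [← Set.image_univ]
      exact this.image _ (τ i).continuous.continuousOn) hcov x₀ hx₀
  exact isIntegral_of_irreducibleSpace_of_isReduced X

/-- The condition on ranges makes each square cartesian, so the `g i` are the restrictions of `f` to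
an open cover of the target. -/
lemma of_affine_charts {W : MorphismProperty Scheme.{u}} [IsZariskiLocalAtTarget W]
    {X Y : Scheme.{u}} (f : X ⟶ Y) {ι : Type u} (T V : ι → Scheme.{u}) (g : ∀ i, T i ⟶ V i)
    (τ : ∀ i, T i ⟶ X) (v : ∀ i, V i ⟶ Y) [∀ i, IsOpenImmersion (τ i)]
    [∀ i, IsOpenImmersion (v i)] (hcomm : ∀ i, τ i ≫ f = g i ≫ v i)
    (hrange : ∀ i, Set.range (τ i) = f ⁻¹' Set.range (v i))
    (hcov : ∀ y, ∃ i, y ∈ Set.range (v i)) (hg : ∀ i, W (g i)) : W f := by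
  have key (i : ι) : W (Limits.pullback.snd f (v i)) := by
    have hpb : IsPullback (g i) (τ i) (v i) f := IsOpenImmersion.isPullback (g i) (τ i) (v i) f
      (hcomm i) (TopologicalSpace.Opens.ext (hrange i).symm)
    rw [← hpb.flip.isoPullback_inv_snd]
    exact (W.cancel_left_of_respectsIso _ _).mpr (hg i)
  let 𝒰 : Y.OpenCover := Scheme.Cover.mkOfCovers ι V v (fun y => by
    obtain ⟨i, x, hx⟩ := hcov y
    exact ⟨i, x, hx⟩) (fun i => inferInstanceAs (IsOpenImmersion (v i)))
  exact IsZariskiLocalAtTarget.of_openCover 𝒰 key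

end Subscheme

/-! ### The monic equation of Z in a chart -/

section ChartPoly

open HomogeneousLocalization Polynomial Matrix

variable {n : ℕ} {k : Type u} [Field k]

/-- The quadratic form of the adjugate of `S` as a polynomial. -/
def dualPoly (S : Matrix (Fin (n + 1)) (Fin (n + 1)) k) : MvPolynomial (Fin (n + 1)) k :=
  dualForm (S.map MvPolynomial.C) MvPolynomial.X

lemma dualPoly_eq (S : Matrix (Fin (n + 1)) (Fin (n + 1)) k) : dualPoly S =
    ∑ r, ∑ s, MvPolynomial.C (S.adjugate r s) * (MvPolynomial.X r * MvPolynomial.X s) := by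
  have h := (MvPolynomial.C (σ := Fin (n + 1)) (R := k)).map_adjugate S
  simp only [RingHom.mapMatrix_apply] at h
  rw [dualPoly, dualForm, ← h, dotProduct]
  refine Finset.sum_congr rfl fun r _ => ?_
  rw [mulVec, dotProduct, Finset.mul_sum]
  refine Finset.sum_congr rfl fun s _ => ?_
  rw [map_apply]
  ring

lemma dualPoly_mem (S : Matrix (Fin (n + 1)) (Fin (n + 1)) k) : dualPoly S ∈ polyGrading n k 2 := by
  rw [dualPoly_eq]
  refine Submodule.sum_mem _ fun r _ => Submodule.sum_mem _ fun s _ => ?_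
  rw [← MvPolynomial.smul_eq_C_mul]
  exact Submodule.smul_mem _ _ (SetLike.mul_mem_graded (X_mem_polyGrading r) (X_mem_polyGrading s))

lemma aeval_dualPoly {R : Type*} [CommRing R] [Algebra k R]
    (S : Matrix (Fin (n + 1)) (Fin (n + 1)) k) (a : Fin (n + 1) → R) :
    MvPolynomial.aeval a (dualPoly S) = dualForm (S.map (algebraMap k R)) a := by
  have h := map_dualForm (MvPolynomial.aeval (R := k) a).toRingHom (S.map MvPolynomial.C)
    MvPolynomial.X
  refine h.trans ?_
  congr 1
  · ext i j
    exact MvPolynomial.aeval_C a _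
  · ext i
    exact MvPolynomial.aeval_X a i

/-- The functions `xᵣ xₛ / F` on the chart where the dual form `F` of `S` does not vanish. -/
def dualCoord (S : Matrix (Fin (n + 1)) (Fin (n + 1)) k) (r s : Fin (n + 1)) :
    Away (polyGrading n k) (dualPoly S) :=
  Away.mk (polyGrading n k) (dualPoly_mem S) 1 (MvPolynomial.X r * MvPolynomial.X s)
    (SetLike.mul_mem_graded (X_mem_polyGrading r) (X_mem_polyGrading s))

lemma awayEval_dualCoord {S : Matrix (Fin (n + 1)) (Fin (n + 1)) k} {R : Type*} [CommRing R]
    [Algebra k R] {a : Fin (n + 1) → R} (ha : IsUnit (MvPolynomial.aeval a (dualPoly S)))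
    (r s : Fin (n + 1)) :
    awayEval (𝒜 := polyGrading n k) (MvPolynomial.aeval a) ha (dualCoord S r s) *
      MvPolynomial.aeval a (dualPoly S) = a r * a s := by
  have h := awayEval_mk (𝒜 := polyGrading n k) (MvPolynomial.aeval a) ha (dualPoly_mem S) 1
    (MvPolynomial.X r * MvPolynomial.X s)
    (SetLike.mul_mem_graded (X_mem_polyGrading r) (X_mem_polyGrading s))
  rw [map_mul, MvPolynomial.aeval_X, MvPolynomial.aeval_X] at h
  exact (congrArg _ (pow_one _).symm).trans h

/-- This is the dual form of `S` divided by itself. It will be the leading coefficient of the chart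
equation. -/
lemma sum_dualCoord (S : Matrix (Fin (n + 1)) (Fin (n + 1)) k) :
    ∑ r, ∑ s, dualCoord S r s * algebraMap k _ (S.adjugate r s) = 1 := by
  let T := Localization.Away (dualPoly S)
  let f : MvPolynomial (Fin (n + 1)) k →ₐ[k] T := IsScalarTower.toAlgHom k _ T
  have hu : IsUnit (f (dualPoly S)) :=
    IsLocalization.map_units T (⟨dualPoly S, 1, pow_one _⟩ : Submonoid.powers (dualPoly S))
  refine HomogeneousLocalization.val_injective _ (hu.mul_right_cancel ?_)
  have hval : ∀ r s, (dualCoord S r s).val * f (dualPoly S) =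
      f (MvPolynomial.X r * MvPolynomial.X s) := fun r s => by
    rw [dualCoord, Away.val_mk, Localization.mk_eq_mk']
    exact (congrArg (_ * f ·) (pow_one (dualPoly S)).symm).trans
      (IsLocalization.mk'_spec T (MvPolynomial.X r * MvPolynomial.X s)
        (⟨dualPoly S ^ 1, 1, rfl⟩ : Submonoid.powers (dualPoly S)))
  have hsum : (∑ r, ∑ s, dualCoord S r s * algebraMap k _ (S.adjugate r s)).val =
      ∑ r, ∑ s, (dualCoord S r s).val * algebraMap k T (S.adjugate r s) := by
    rw [← HomogeneousLocalization.algebraMap_apply, map_sum]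
    refine Finset.sum_congr rfl fun r _ => ?_
    rw [map_sum]
    refine Finset.sum_congr rfl fun s _ => ?_
    rw [map_mul, ← IsScalarTower.algebraMap_apply]
    rfl
  rw [hsum, val_one, one_mul, Finset.sum_mul]
  refine Eq.trans ?_ (congrArg f (dualPoly_eq S)).symm
  rw [map_sum]
  refine Finset.sum_congr rfl fun r _ => ?_
  rw [map_sum, Finset.sum_mul]
  refine Finset.sum_congr rfl fun s _ => ?_
  rw [mul_right_comm, hval, map_mul f (MvPolynomial.C _), mul_comm]
  congr 1

variable (A S : Matrix (Fin (n + 1)) (Fin (n + 1)) k)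

/-- The equation of the locus of singular hyperplane sections of the members of the pencil
`A + t S`, in the chart where the dual form of `S` does not vanish. -/
def chartPoly : (Away (polyGrading n k) (dualPoly S))[X] :=
  ∑ r, ∑ s, C (dualCoord S r s) *
    (((X : k[X]) • S.map C + A.map C).adjugate r s).map (algebraMap k _)

lemma natDegree_chartPoly_le : (chartPoly A S).natDegree ≤ n :=
  natDegree_sum_le_of_forall_le _ _ fun r _ => natDegree_sum_le_of_forall_le _ _ fun s _ =>
    (natDegree_C_mul_le _ _).trans ((natDegree_map_le).trans (natDegree_adjugate_pencil_le A S r s))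

lemma coeff_chartPoly : (chartPoly A S).coeff n = 1 := by
  rw [chartPoly, finsetSum_coeff, ← sum_dualCoord S]
  refine Finset.sum_congr rfl fun r _ => ?_
  rw [finsetSum_coeff]
  refine Finset.sum_congr rfl fun s _ => ?_
  rw [coeff_C_mul, coeff_map, coeff_adjugate_pencil]

lemma monic_chartPoly : (chartPoly A S).Monic :=
  monic_of_natDegree_le_of_coeff_eq_one n (natDegree_chartPoly_le A S) (coeff_chartPoly A S)

/-- Multiplication by the dual form of `S` turns the coefficients `xᵣ xₛ / F` into `aᵣ aₛ`, and
specializing the parameter commutes with the adjugate. -/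
lemma eval₂_chartPoly {R : Type*} [CommRing R] [Algebra k R] {a : Fin (n + 1) → R}
    (ha : IsUnit (MvPolynomial.aeval a (dualPoly S))) (t : R) :
    (chartPoly A S).eval₂ (awayEval (𝒜 := polyGrading n k) (MvPolynomial.aeval a) ha).toRingHom t *
      MvPolynomial.aeval a (dualPoly S) =
      dualForm (A.map (algebraMap k R) + t • S.map (algebraMap k R)) a := by
  set g := awayEval (𝒜 := polyGrading n k) (MvPolynomial.aeval a) ha with hg
  have hpoly : ((X : k[X]) • S.map C + A.map C).map (eval₂RingHom (algebraMap k R) t) =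
      A.map (algebraMap k R) + t • S.map (algebraMap k R) := by
    ext i j
    simp [-X_mul_C, add_comm]
  have hadj := (eval₂RingHom (algebraMap k R) t).map_adjugate ((X : k[X]) • S.map C + A.map C)
  rw [RingHom.mapMatrix_apply, RingHom.mapMatrix_apply, hpoly] at hadj
  rw [chartPoly, ← coe_eval₂RingHom, map_sum, Finset.sum_mul, dualForm, dotProduct]
  refine Finset.sum_congr rfl fun r _ => ?_
  rw [map_sum, Finset.sum_mul, mulVec, dotProduct, Finset.mul_sum]
  refine Finset.sum_congr rfl fun s _ => ?_
  rw [map_mul, coe_eval₂RingHom, eval₂_C, mul_right_comm]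
  have h1 : g.toRingHom (dualCoord S r s) * MvPolynomial.aeval a (dualPoly S) = a r * a s :=
    awayEval_dualCoord ha r s
  have h2 : g.toRingHom.comp (algebraMap k _) = algebraMap k R := g.comp_algebraMap
  rw [h1, eval₂_map, h2, ← hadj]
  change _ = a r * (eval₂ (algebraMap k R) t _ * a s)
  ring

end ChartPoly

/-! ### Points of the charts in homogeneous coordinates -/

section PointsOfCharts

open HomogeneousLocalization Polynomial Matrix

variable {n : ℕ} {k : Type u} [Field k]

lemma exists_specMap_comp_eq {P : Scheme.{u}} {R K : Type u} [CommRing R] [Field K]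
    (j : Spec (CommRingCat.of R) ⟶ P) [IsOpenImmersion j] (p : Spec (CommRingCat.of K) ⟶ P)
    {w : Spec (CommRingCat.of R)} {x : Spec (CommRingCat.of K)} (h : p x = j w) :
    ∃ ψ : R →+* K, Spec.map (CommRingCat.ofHom ψ) ≫ j = p ∧ RingHom.ker ψ = w.asIdeal := by
  have hrange : Set.range p ⊆ Set.range j := by
    rintro _ ⟨y, rfl⟩
    rw [Subsingleton.elim y x]
    exact ⟨w, h.symm⟩
  obtain ⟨ψ, hψ⟩ := Spec.map_surjective (IsOpenImmersion.lift j p hrange)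
  have hp : Spec.map ψ ≫ j = p := by rw [hψ, IsOpenImmersion.lift_fac]
  refine ⟨ψ.hom, hp, ?_⟩
  have hw : Spec.map ψ x = w := j.isOpenEmbedding.injective (by
    rw [← Scheme.Hom.comp_apply, hp, h])
  rw [← hw, show x = ⟨⊥, Ideal.isPrime_bot⟩ from Subsingleton.elim _ _]
  rfl

/-- Every point of `ℙ¹ × ℙⁿ` has homogeneous coordinates in some field. -/
lemma exists_coords_pencilProd (z : pencilProd n k) :
    ∃ (K : Type u) (_ : Field K) (_ : Algebra k K) (u : Fin 2 → K) (hu : u ≠ 0)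
      (a : Fin (n + 1) → K) (ha : a ≠ 0) (p : Spec (CommRingCat.of K) ⟶ pencilProd n k),
      p ≫ Limits.pullback.fst _ _ = pointOfCoords k u hu ∧
      p ≫ Limits.pullback.snd _ _ = pointOfCoords k a ha ∧ ∀ x, p x = z := by
  let K := (pencilProd n k).residueField z
  let p : Spec (CommRingCat.of K) ⟶ pencilProd n k := (pencilProd n k).fromSpecResidueField z
  -- The structure is taken through the first projection; the pullback condition makes it compatible
  -- with the second.
  let : Algebra k K :=
    (Spec.preimage (p ≫ Limits.pullback.fst _ _ ≫ projSpaceToSpec 1 k)).hom.toAlgebra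
  have h1 : (p ≫ Limits.pullback.fst _ _) ≫ projSpaceToSpec 1 k =
      Spec.map (CommRingCat.ofHom (algebraMap k K)) := by
    rw [Category.assoc]
    exact (Spec.map_preimage _).symm
  have h2 : (p ≫ Limits.pullback.snd _ _) ≫ projSpaceToSpec n k =
      Spec.map (CommRingCat.ofHom (algebraMap k K)) := by
    rw [← h1, Category.assoc, Category.assoc, Limits.pullback.condition]
  obtain ⟨u, hu, hpu⟩ := exists_eq_pointOfCoords _ h1
  obtain ⟨a, ha, hpa⟩ := exists_eq_pointOfCoords _ h2
  exact ⟨K, inferInstance, inferInstance, u, hu, a, ha, p, hpu, hpa, fun x =>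
    (pencilProd n k).fromSpecResidueField_apply z x⟩

variable {K : Type u} [Field K] [Algebra k K] {l : k} {A B : Matrix (Fin (n + 1)) (Fin (n + 1)) k}

lemma awayι_comp_injective {R A : Type u} [Field R] [CommRing A] [Algebra R A]
    {𝒜 : ℕ → Submodule R A} [GradedAlgebra 𝒜] {x : A} {m : ℕ} (hx : x ∈ 𝒜 m) (hm : 0 < m)
    {T : Type u} [CommRing T] {f g : Away 𝒜 x →+* T}
    (h : Spec.map (CommRingCat.ofHom f) ≫ Proj.awayι 𝒜 x hx hm =
      Spec.map (CommRingCat.ofHom g) ≫ Proj.awayι 𝒜 x hx hm) : f = g :=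
  congrArg CommRingCat.Hom.hom (Spec.map_injective ((cancel_mono _).mp h))

lemma productChart_mem_snd {F : MvPolynomial (Fin (n + 1)) k} (hF : F ∈ polyGrading n k 2)
    {u : Fin 2 → K} {hu : u ≠ 0} {a : Fin (n + 1) → K} {ha : a ≠ 0}
    {p : Spec (CommRingCat.of K) ⟶ pencilProd n k}
    (h1 : p ≫ Limits.pullback.fst _ _ = pointOfCoords k u hu)
    (h2 : p ≫ Limits.pullback.snd _ _ = pointOfCoords k a ha) (x : Spec (CommRingCat.of K)) :
    p x ∈ Set.range (productChart l hF) ↔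
      u 0 - algebraMap k K l * u 1 ≠ 0 ∧ MvPolynomial.aeval a F ≠ 0 := by
  rw [range_productChart, Set.mem_inter_iff, Set.mem_preimage, Set.mem_preimage,
    ← Scheme.Hom.comp_apply, ← Scheme.Hom.comp_apply, h1, h2, SetLike.mem_coe, SetLike.mem_coe,
    specMap_pointOfCoords_mem_basicOpen_iff hu (lineForm_mem l) one_pos,
    specMap_pointOfCoords_mem_basicOpen_iff ha hF two_pos, aeval_lineForm]

/-- The coordinates of a point of a chart. -/
lemma productChart_coords {F : MvPolynomial (Fin (n + 1)) k} (hF : F ∈ polyGrading n k 2)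
    {u : Fin 2 → K} {hu : u ≠ 0} {a : Fin (n + 1) → K} {ha : a ≠ 0}
    {ψ : (Away (polyGrading n k) F)[X] →+* K}
    (h1 : (Spec.map (CommRingCat.ofHom ψ) ≫ productChart l hF) ≫ Limits.pullback.fst _ _ =
      pointOfCoords k u hu)
    (h2 : (Spec.map (CommRingCat.ofHom ψ) ≫ productChart l hF) ≫ Limits.pullback.snd _ _ =
      pointOfCoords k a ha)
    (hl : u 0 - algebraMap k K l * u 1 ≠ 0) (hFa : IsUnit (MvPolynomial.aeval a F)) :
    ψ.comp C = (awayEval (𝒜 := polyGrading n k) (MvPolynomial.aeval a) hFa).toRingHom ∧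
      ψ X * (u 0 - algebraMap k K l * u 1) = u 1 := by
  constructor
  · rw [Category.assoc, productChart_snd, pointOfCoords_eq ha hF two_pos hFa, ← Category.assoc,
      ← Spec.map_comp, ← CommRingCat.ofHom_comp] at h2
    exact awayι_comp_injective hF two_pos h2
  · have hlu : IsUnit (MvPolynomial.aeval u (lineForm l)) := by
      rw [aeval_lineForm]
      exact isUnit_iff_ne_zero.mpr hl
    rw [Category.assoc, productChart_fst, pointOfCoords_eq hu (lineForm_mem l) one_pos hlu,
      lineChart, ← Category.assoc, ← Category.assoc, ← Spec.map_comp, ← CommRingCat.ofHom_comp,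
      ← Spec.map_comp, ← CommRingCat.ofHom_comp] at h1
    have h3 := DFunLike.congr_fun (awayι_comp_injective (lineForm_mem l) one_pos h1) (lineCoord l 1)
    have h4 := awayEval_mk (𝒜 := polyGrading 1 k) (MvPolynomial.aeval u) hlu (lineForm_mem l) 1 _
      (X_mem_polyGrading 1)
    rw [MvPolynomial.aeval_X, pow_one] at h4
    have h5 : ψ X = awayEval (𝒜 := polyGrading 1 k) (MvPolynomial.aeval u) hlu (lineCoord l 1) := by
      refine Eq.trans ?_ h3
      change _ = ψ (mapRingHom _ (lineAlgEquiv l (lineCoord l 1)))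
      rw [lineAlgEquiv_lineCoord]
      simp [lineCoords]
    rw [h5, ← aeval_lineForm]
    exact h4

lemma chartPoly_eq_zero_iff {u : Fin 2 → K} {hu : u ≠ 0} {a : Fin (n + 1) → K} {ha : a ≠ 0}
    {ψ : (Away (polyGrading n k) (dualPoly (l • A + B)))[X] →+* K}
    (h1 : (Spec.map (CommRingCat.ofHom ψ) ≫ productChart l (dualPoly_mem (l • A + B))) ≫
      Limits.pullback.fst _ _ = pointOfCoords k u hu)
    (h2 : (Spec.map (CommRingCat.ofHom ψ) ≫ productChart l (dualPoly_mem (l • A + B))) ≫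
      Limits.pullback.snd _ _ = pointOfCoords k a ha) :
    ψ (chartPoly A (l • A + B)) = 0 ↔
      dualForm (u 0 • A.map (algebraMap k K) + u 1 • B.map (algebraMap k K)) a = 0 := by
  obtain ⟨hl, hF⟩ := (productChart_mem_snd (l := l) (dualPoly_mem (l • A + B)) h1 h2 default).mp
    ⟨_, (Scheme.Hom.comp_apply _ _ _).symm⟩
  obtain ⟨h3, h4⟩ := productChart_coords _ h1 h2 hl (isUnit_iff_ne_zero.mpr hF)
  have h5 := eval₂_chartPoly A (l • A + B) (isUnit_iff_ne_zero.mpr hF) (ψ X)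
  rw [← h3] at h5
  have h6 : (chartPoly A (l • A + B)).eval₂ (ψ.comp C) (ψ X) = ψ (chartPoly A (l • A + B)) :=
    DFunLike.congr_fun (Polynomial.ringHom_ext (f := eval₂RingHom (ψ.comp C) (ψ X)) (g := ψ)
      (fun a => by simp) (by simp)) _
  rw [h6] at h5
  -- With `δ = u₀ - l u₁` and `t = u₁ / δ`, the member is `δ (A + t (l A + B))`, so the dual forms
  -- differ by the unit `δ ^ n`.
  have h7 : u 0 • A.map (algebraMap k K) + u 1 • B.map (algebraMap k K) =
      (u 0 - algebraMap k K l * u 1) •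
        (A.map (algebraMap k K) + ψ X • (l • A + B).map (algebraMap k K)) := by
    ext i j
    simp only [Matrix.add_apply, Matrix.smul_apply, map_apply, smul_eq_mul, map_add, map_mul]
    linear_combination (-(algebraMap k K l * algebraMap k K (A i j) + algebraMap k K (B i j))) * h4
  rw [h7, dualForm_smul, ← h5, mul_eq_zero, mul_eq_zero, or_iff_left hF,
    or_iff_right (pow_ne_zero n hl)]

end PointsOfCharts

/-! ### Good members of the pencil and the locus of singular sections -/

section Locus

open HomogeneousLocalization Polynomial Matrix

variable {n : ℕ} {k : Type u} [Field k]

/-- The members of a pencil of quadrics, distinct from the first one, which are nondegenerate. -/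
def GoodParam (q₁ q₂ : MvPolynomial (Fin (n + 1)) k) : Type u :=
  {l : k // (l • gramMatrix q₁ + gramMatrix q₂).det ≠ 0 ∧
    dualPoly (l • gramMatrix q₁ + gramMatrix q₂) ≠ 0}

variable {q₁ q₂ : MvPolynomial (Fin (n + 1)) k}

/-- The matrix of a good member of the pencil. -/
def GoodParam.matrix (l : GoodParam q₁ q₂) : Matrix (Fin (n + 1)) (Fin (n + 1)) k :=
  l.1 • gramMatrix q₁ + gramMatrix q₂

/-- The coordinate ring of the locus of hyperplanes which are not tangent to a good member. -/
abbrev GoodParam.ring (l : GoodParam q₁ q₂) : Type u :=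
  Away (polyGrading n k) (dualPoly l.matrix)

/-- The chart of `ℙ¹ × ℙⁿ` attached to a good member. -/
def GoodParam.chart (l : GoodParam q₁ q₂) : Spec (CommRingCat.of l.ring[X]) ⟶ pencilProd n k :=
  productChart l.1 (dualPoly_mem l.matrix)

instance (l : GoodParam q₁ q₂) : IsOpenImmersion l.chart :=
  isOpenImmersion_productChart _ _

/-- The equation of the locus of singular sections in the chart attached to a good member. -/
def GoodParam.poly (l : GoodParam q₁ q₂) : l.ring[X] :=
  chartPoly (gramMatrix q₁) l.matrix

lemma GoodParam.poly_eq_zero_iff (l : GoodParam q₁ q₂) {K : Type u} [Field K] [Algebra k K]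
    {u : Fin 2 → K} {hu : u ≠ 0} {a : Fin (n + 1) → K} {ha : a ≠ 0} {ψ : l.ring[X] →+* K}
    (h1 : (Spec.map (CommRingCat.ofHom ψ) ≫ l.chart) ≫ Limits.pullback.fst _ _ =
      pointOfCoords k u hu)
    (h2 : (Spec.map (CommRingCat.ofHom ψ) ≫ l.chart) ≫ Limits.pullback.snd _ _ =
      pointOfCoords k a ha) :
    ψ l.poly = 0 ↔ dualForm (pencilMatrix q₁ q₂ u) a = 0 :=
  chartPoly_eq_zero_iff h1 h2

variable [CharZero k]

/-- For any field-valued point representing `w`, singularity means that the chart equation lies in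
the kernel of evaluation, which is the prime of `w`. The choice of the representing field is thus
irrelevant. -/
lemma GoodParam.preimage_singularSections (hn : 2 ≤ n) (h₁ : q₁.IsHomogeneous 2)
    (h₂ : q₂.IsHomogeneous 2) (l : GoodParam q₁ q₂) :
    l.chart ⁻¹' singularSections h₁ h₂ = PrimeSpectrum.zeroLocus {l.poly} := by
  ext w
  change l.chart w ∈ singularSections h₁ h₂ ↔ {l.poly} ⊆ (w.asIdeal : Set _)
  rw [Set.singleton_subset_iff]
  constructor
  · rintro ⟨K, _, _, u, hu, a, ha, p, h1, h2, ⟨x, hx⟩, hs⟩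
    obtain ⟨ψ, rfl, hψ⟩ := exists_specMap_comp_eq l.chart p hx
    rw [isSmoothIntersection_pencilForm_iff hn h₁ h₂ u ha, not_not,
      ← l.poly_eq_zero_iff h1 h2] at hs
    change l.poly ∈ w.asIdeal
    rw [← hψ]
    exact hs
  · intro hw
    obtain ⟨K, _, _, u, hu, a, ha, p, h1, h2, hx⟩ := exists_coords_pencilProd (l.chart w)
    obtain ⟨ψ, rfl, hψ⟩ := exists_specMap_comp_eq l.chart p (hx default)
    refine ⟨K, _, _, u, hu, a, ha, _, h1, h2, ⟨default, hx default⟩, ?_⟩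
    rw [isSmoothIntersection_pencilForm_iff hn h₁ h₂ u ha, not_not, ← l.poly_eq_zero_iff h1 h2]
    change l.poly ∈ w.asIdeal at hw
    rwa [← hψ] at hw

lemma exists_eval_algebraMap_ne_zero {E : Type*} [Field E] [Algebra k E] {p : E[X]} (hp : p ≠ 0) :
    ∃ l : k, p.eval (algebraMap k E l) ≠ 0 := by
  by_contra! h
  refine hp (Polynomial.eq_zero_of_infinite_isRoot p
    ((Set.infinite_range_of_injective (algebraMap k E).injective).mono ?_))
  rintro _ ⟨l, rfl⟩
  exact h l

/-- Each requirement on `l` is the nonvanishing of a nonzero polynomial over an algebraic closure of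
`K`; as `k` is infinite, a value in `k` avoids all the roots. -/
lemma exists_goodParam (hn : 2 ≤ n) {h₁ : q₁.IsHomogeneous 2} {h₂ : q₂.IsHomogeneous 2}
    (hX : IsSmoothIntersection h₁ h₂) {K : Type u} [Field K] [Algebra k K] {u : Fin 2 → K}
    (hu : u ≠ 0) {a : Fin (n + 1) → K} (ha : a ≠ 0) :
    ∃ l : GoodParam q₁ q₂, u 0 - algebraMap k K l.1 * u 1 ≠ 0 ∧
      MvPolynomial.aeval a (dualPoly l.matrix) ≠ 0 := by
  let E := AlgebraicClosure K
  set A := (gramMatrix q₁).map (algebraMap k E) with hA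
  set B := (gramMatrix q₂).map (algebraMap k E) with hB
  have hT : TransversePencil A B := hX.transversePencil hn E
  have hAs : A.IsSymm := (gramMatrix_isSymm q₁).map _
  have hBs : B.IsSymm := (gramMatrix_isSymm q₂).map _
  have hC : CharZero E := charZero_of_injective_algebraMap (algebraMap k E).injective
  let f := algebraMap K E
  have hf : Function.Injective f := f.injective
  have p1 : (C (f (u 0)) - X * C (f (u 1)) : E[X]) ≠ 0 := by
    intro h
    refine hu (funext fun i => ?_)
    have h0 := congrArg (eval 0) h
    have h1 := congrArg (eval 1) h
    simp only [eval_sub, eval_mul, eval_C, eval_X, eval_zero, zero_mul, sub_zero, one_mul] at h0 h1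
    rw [h0, zero_sub, neg_eq_zero] at h1
    fin_cases i
    · exact hf (h0.trans (map_zero f).symm)
    · exact hf (h1.trans (map_zero f).symm)
  have ha' : f ∘ a ≠ 0 := fun h => ha (funext fun i => hf ((congrFun h i).trans (map_zero f).symm))
  obtain ⟨l, hl⟩ := exists_eval_algebraMap_ne_zero (k := k)
    (mul_ne_zero (mul_ne_zero p1 (hT.det_ne_zero hAs)) (hT.dualForm_ne_zero hAs hBs ha'))
  rw [eval_mul, eval_mul] at hl
  have hl1 := left_ne_zero_of_mul (left_ne_zero_of_mul hl)
  have hl2 := right_ne_zero_of_mul (left_ne_zero_of_mul hl)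
  have hl3 := right_ne_zero_of_mul hl
  have hmap : (l • gramMatrix q₁ + gramMatrix q₂).map (algebraMap k E) =
      algebraMap k E l • A + B := by
    ext i j
    simp only [hA, hB, Matrix.add_apply, Matrix.smul_apply, map_apply, smul_eq_mul, map_add,
      map_mul]
  rw [← coe_evalRingHom, RingHom.map_det, RingHom.mapMatrix_apply, eval_pencil, ← hmap,
    ← RingHom.mapMatrix_apply, ← RingHom.map_det] at hl2
  rw [← coe_evalRingHom, map_dualForm, eval_pencil, ← hmap] at hl3
  have hl3' : MvPolynomial.aeval a (dualPoly (l • gramMatrix q₁ + gramMatrix q₂)) ≠ 0 := by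
    intro h
    refine hl3 ?_
    have h4 := congrArg f h
    rw [map_zero, aeval_dualPoly, map_dualForm] at h4
    exact (congrArg₂ dualForm (Matrix.ext fun i j => IsScalarTower.algebraMap_apply k K E _)
      (funext fun i => by simp [f])).trans h4
  refine ⟨⟨l, fun h => hl2 (by rw [h, map_zero]), fun h => hl3' (by rw [h, map_zero])⟩, ?_, hl3'⟩
  intro h
  refine hl1 ?_
  simp only [eval_sub, eval_mul, eval_C, eval_X]
  rw [IsScalarTower.algebraMap_apply k K E]
  change f _ - f _ * f _ = 0
  rw [← map_mul, ← map_sub, h, map_zero]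

/-- Over a hyperplane which is not tangent to a good member, all singular sections lie in the chart
of this member. -/
lemma GoodParam.mem_range_chart (hn : 2 ≤ n) {h₁ : q₁.IsHomogeneous 2}
    {h₂ : q₂.IsHomogeneous 2} (l : GoodParam q₁ q₂) {z : pencilProd n k}
    (hz : z ∈ singularSections h₁ h₂)
    (hzl : Limits.pullback.snd (projSpaceToSpec 1 k) (projSpaceToSpec n k) z ∈
      Proj.basicOpen (polyGrading n k) (dualPoly l.matrix)) : z ∈ Set.range l.chart := by
  obtain ⟨K, _, _, u, hu, a, ha, p, h1, h2, ⟨x, rfl⟩, hs⟩ := hz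
  rw [isSmoothIntersection_pencilForm_iff hn h₁ h₂ u ha, not_not] at hs
  rw [← Scheme.Hom.comp_apply, h2,
    specMap_pointOfCoords_mem_basicOpen_iff ha (dualPoly_mem _) two_pos] at hzl
  refine (productChart_mem_snd (dualPoly_mem _) h1 h2 x).mpr ⟨fun h => ?_, hzl⟩
  have hu0 : u 0 = algebraMap k K l.1 * u 1 := sub_eq_zero.mp h
  have hu1 : u 1 ≠ 0 := fun h1 => hu (funext fun i => by
    rw [h1, mul_zero] at hu0
    fin_cases i
    · exact hu0
    · exact h1)
  -- The only point of the pencil missed by the chart is the good member itself, whose section by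
  -- `a` is smooth.
  have hM : pencilMatrix q₁ q₂ u = u 1 • l.matrix.map (algebraMap k K) := by
    rw [pencilMatrix, hu0, GoodParam.matrix]
    ext i j
    simp only [Matrix.add_apply, Matrix.smul_apply, map_apply, smul_eq_mul, map_add, map_mul]
    ring
  rw [hM, dualForm_smul, ← aeval_dualPoly] at hs
  exact mul_ne_zero (pow_ne_zero n hu1) hzl hs

lemma exists_mem_range_chart (hn : 2 ≤ n) {h₁ : q₁.IsHomogeneous 2} {h₂ : q₂.IsHomogeneous 2}
    (hX : IsSmoothIntersection h₁ h₂) (z : pencilProd n k) :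
    ∃ l : GoodParam q₁ q₂, z ∈ Set.range l.chart := by
  obtain ⟨K, _, _, u, hu, a, ha, p, h1, h2, hx⟩ := exists_coords_pencilProd z
  obtain ⟨l, hl⟩ := exists_goodParam hn hX hu ha
  refine ⟨l, ?_⟩
  rw [← hx default]
  exact (productChart_mem_snd (dualPoly_mem _) h1 h2 default).mpr hl

theorem isClosed_singularSections (hn : 2 ≤ n) {h₁ : q₁.IsHomogeneous 2}
    {h₂ : q₂.IsHomogeneous 2} (hX : IsSmoothIntersection h₁ h₂) :
    IsClosed (singularSections h₁ h₂) := by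
  rw [← isOpen_compl_iff, isOpen_iff_forall_mem_open]
  intro z hz
  obtain ⟨l, w, rfl⟩ := exists_mem_range_chart hn hX z
  refine ⟨l.chart '' (l.chart ⁻¹' (singularSections h₁ h₂)ᶜ), Set.image_preimage_subset _ _, ?_,
    ⟨w, hz, rfl⟩⟩
  refine l.chart.isOpenEmbedding.isOpenMap _ ?_
  rw [Set.preimage_compl, l.preimage_singularSections hn h₁ h₂]
  exact (PrimeSpectrum.isClosed_zeroLocus _).isOpen_compl

lemma exists_mem_basicOpen_dualPoly (hn : 2 ≤ n) {h₁ : q₁.IsHomogeneous 2}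
    {h₂ : q₂.IsHomogeneous 2} (hX : IsSmoothIntersection h₁ h₂) (y : projSpace n k) :
    ∃ l : GoodParam q₁ q₂, y ∈ Proj.basicOpen (polyGrading n k) (dualPoly l.matrix) := by
  let K := (projSpace n k).residueField y
  let p : Spec (CommRingCat.of K) ⟶ projSpace n k := (projSpace n k).fromSpecResidueField y
  let : Algebra k K := (Spec.preimage (p ≫ projSpaceToSpec n k)).hom.toAlgebra
  obtain ⟨a, ha, hp⟩ := exists_eq_pointOfCoords p (Spec.map_preimage _).symm
  obtain ⟨l, -, hl⟩ := exists_goodParam hn hX (one_ne_zero (α := Fin 2 → K)) ha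
  refine ⟨l, ?_⟩
  have := (specMap_pointOfCoords_mem_basicOpen_iff ha (dualPoly_mem l.matrix) two_pos default).mpr
    hl
  rw [← hp] at this
  exact ((projSpace n k).fromSpecResidueField_apply y _) ▸ this

end Locus

/-! ### Generic roots and primality of the chart equation -/

section GenericRoots

open HomogeneousLocalization Polynomial Matrix

variable (n : ℕ) (k : Type u) [Field k]

/-- Homogeneous coordinates of the generic point of projective space, with `v 0 = 1`. -/
def genericCoords : Fin (n + 1) → genericField (projSpace n k) :=
  (exists_coords_genericPoint n k).choose

lemma genericCoords_ne_zero : genericCoords n k ≠ 0 :=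
  (exists_coords_genericPoint n k).choose_spec.choose

lemma genericCoords_zero : genericCoords n k 0 = 1 :=
  (exists_coords_genericPoint n k).choose_spec.choose_spec.1

lemma fromSpecResidueField_genericPoint :
    (projSpace n k).fromSpecResidueField (genericPoint (projSpace n k)) =
      pointOfCoords k (genericCoords n k) (genericCoords_ne_zero n k) :=
  (exists_coords_genericPoint n k).choose_spec.choose_spec.2.1

lemma aeval_genericCoords_ne_zero {m : ℕ} {F : MvPolynomial (Fin (n + 1)) k}
    (hF : F.IsHomogeneous m) (hF0 : F ≠ 0) : MvPolynomial.aeval (genericCoords n k) F ≠ 0 :=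
  (exists_coords_genericPoint n k).choose_spec.choose_spec.2.2.1 m F hF hF0

lemma algebraicIndependent_genericCoords :
    AlgebraicIndependent k (fun i : Fin n => genericCoords n k i.succ) :=
  (exists_coords_genericPoint n k).choose_spec.choose_spec.2.2.2.1

lemma adjoin_genericCoords : IntermediateField.adjoin k (Set.range (genericCoords n k)) = ⊤ :=
  (exists_coords_genericPoint n k).choose_spec.choose_spec.2.2.2.2

/-- Homogeneous coordinates of the geometric generic point of projective space. -/
def closureCoords : Fin (n + 1) → genericClosure (projSpace n k) :=
  algebraMap (genericField (projSpace n k)) (genericClosure (projSpace n k)) ∘ genericCoords n k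

lemma closureCoords_ne_zero : closureCoords n k ≠ 0 := fun h => by
  have := congrFun h 0
  rw [closureCoords, Function.comp_apply, genericCoords_zero, map_one] at this
  exact one_ne_zero this

lemma geometricGenericPoint_eq : geometricGenericPoint (projSpace n k) =
    pointOfCoords k (closureCoords n k) (closureCoords_ne_zero n k) := by
  rw [geometricGenericPoint, fromSpecResidueField_genericPoint]
  exact specMap_comp_pointOfCoords (IsScalarTower.toAlgHom k (genericField (projSpace n k))
    (genericClosure (projSpace n k))) _ (closureCoords_ne_zero n k)

variable {n k}

lemma aeval_closureCoords (F : MvPolynomial (Fin (n + 1)) k) :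
    MvPolynomial.aeval (closureCoords n k) F =
      algebraMap (genericField (projSpace n k)) _ (MvPolynomial.aeval (genericCoords n k) F) :=
  MvPolynomial.aeval_algebraMap_apply _ _ _

variable {q₁ q₂ : MvPolynomial (Fin (n + 1)) k} (l : GoodParam q₁ q₂)

lemma GoodParam.isUnit_aeval_genericCoords :
    IsUnit (MvPolynomial.aeval (genericCoords n k) (dualPoly l.matrix)) :=
  isUnit_iff_ne_zero.mpr (aeval_genericCoords_ne_zero n k (dualPoly_mem l.matrix) l.2.2)

lemma GoodParam.isUnit_aeval_closureCoords :
    IsUnit (MvPolynomial.aeval (closureCoords n k) (dualPoly l.matrix)) := by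
  rw [aeval_closureCoords]
  exact l.isUnit_aeval_genericCoords.map _

/-- The generic point of the chart of the dual space. -/
def GoodParam.toField : l.ring →ₐ[k] genericField (projSpace n k) :=
  awayEval (𝒜 := polyGrading n k) (MvPolynomial.aeval (genericCoords n k))
    l.isUnit_aeval_genericCoords

/-- The geometric generic point of the chart of the dual space. -/
def GoodParam.toClosure : l.ring →ₐ[k] genericClosure (projSpace n k) :=
  awayEval (𝒜 := polyGrading n k) (MvPolynomial.aeval (closureCoords n k))
    l.isUnit_aeval_closureCoords

lemma GoodParam.toClosure_eq : l.toClosure.toRingHom =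
    (algebraMap (genericField (projSpace n k)) (genericClosure (projSpace n k))).comp
      l.toField.toRingHom := by
  refine (awayEval_unique _ _ (dualPoly_mem l.matrix) _ fun m a ha => ?_).symm
  rw [aeval_closureCoords, aeval_closureCoords, ← map_pow]
  refine (map_mul (algebraMap (genericField (projSpace n k)) (genericClosure (projSpace n k)))
    _ _).symm.trans (congrArg _ ?_)
  exact awayEval_mk _ l.isUnit_aeval_genericCoords (dualPoly_mem l.matrix) m a ha

lemma GoodParam.toField_injective : Function.Injective l.toField := by
  rw [injective_iff_map_eq_zero]
  intro z hz
  obtain ⟨m, a, ha, rfl⟩ := Away.mk_surjective (polyGrading n k) (dualPoly_mem l.matrix) z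
  have h1 := awayEval_mk (𝒜 := polyGrading n k) (MvPolynomial.aeval (genericCoords n k))
    l.isUnit_aeval_genericCoords (dualPoly_mem l.matrix) m a ha
  have ha0 : a = 0 := by
    by_contra h
    refine aeval_genericCoords_ne_zero n k ha h (h1.symm.trans ?_)
    exact (congrArg (· * _) hz).trans (zero_mul _)
  refine HomogeneousLocalization.val_injective _ ?_
  rw [Away.val_mk, val_zero]
  simp only [ha0]
  exact Localization.mk_zero _

lemma GoodParam.monic_poly : l.poly.Monic := monic_chartPoly _ _

variable [CharZero k]

/-- The roots of the equation of the locus of singular sections at the geometric generic point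
are permuted arbitrarily by the Galois group. -/
theorem GoodParam.exists_roots_poly (hn : 2 ≤ n) {h₁ : q₁.IsHomogeneous 2}
    {h₂ : q₂.IsHomogeneous 2} (hX : IsSmoothIntersection h₁ h₂) :
    ∃ ρ : Fin n → genericClosure (projSpace n k), Function.Injective ρ ∧
      (∀ x, l.poly.eval₂ l.toClosure.toRingHom x = 0 ↔ ∃ j, ρ j = x) ∧
      ∀ π : Equiv.Perm (Fin n), ∃ σ : genericGalois (projSpace n k),
        (∀ x, IsIntegral k x → σ x = x) ∧ ∀ j, σ (ρ j) = ρ (π j) := by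
  obtain ⟨ρ, hρ, hroots, hσ⟩ := exists_roots_dualForm (L := genericClosure (projSpace n k))
    (algebraicIndependent_genericCoords n k) (genericCoords_zero n k) (adjoin_genericCoords n k)
    (gramMatrix_isSymm q₁) (gramMatrix_isSymm q₂) (fun Ω _ _ => hX.transversePencil hn Ω) l.1 l.2.1
    (by
      have := l.isUnit_aeval_genericCoords.ne_zero
      rwa [aeval_dualPoly] at this)
  refine ⟨ρ, hρ, fun x => ?_, hσ⟩
  rw [← hroots]
  have h := eval₂_chartPoly (gramMatrix q₁) l.matrix l.isUnit_aeval_closureCoords x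
  refine Iff.trans ?_ (Eq.congr_left h)
  rw [mul_eq_zero, or_iff_left l.isUnit_aeval_closureCoords.ne_zero]
  rfl

/-- The minimal polynomial of one root vanishes at all `n` conjugates, so its degree is at least
that of `p`, which it divides. -/
lemma irreducible_of_transitive {K L : Type*} [Field K] [Field L] [Algebra K L] {n : ℕ}
    {p : K[X]} (hp : p.Monic) (hdeg : p.natDegree ≤ n) (hn : n ≠ 0) {ρ : Fin n → L}
    (hρ : Function.Injective ρ) (hroot : ∀ j, aeval (ρ j) p = 0)
    (htrans : ∀ i j, ∃ σ : L ≃ₐ[K] L, σ (ρ i) = ρ j) : Irreducible p := by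
  classical
  let i₀ : Fin n := ⟨0, Nat.pos_of_ne_zero hn⟩
  have hint : IsIntegral K (ρ i₀) := ⟨p, hp, by rw [← aeval_def]; exact hroot i₀⟩
  have hmp := minpoly.monic hint
  have hdvd : minpoly K (ρ i₀) ∣ p := minpoly.dvd K _ (hroot i₀)
  have hcard : n ≤ (minpoly K (ρ i₀)).natDegree := by
    have hsub : Finset.univ.image ρ ⊆ ((minpoly K (ρ i₀)).aroots L).toFinset := by
      intro x hx
      obtain ⟨j, -, rfl⟩ := Finset.mem_image.mp hx
      obtain ⟨σ, hσ⟩ := htrans i₀ j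
      rw [Multiset.mem_toFinset, mem_aroots]
      refine ⟨hmp.ne_zero, ?_⟩
      rw [← hσ]
      change aeval ((σ : L →ₐ[K] L) (ρ i₀)) _ = 0
      rw [aeval_algHom_apply, minpoly.aeval, map_zero]
    have h1 := Finset.card_le_card hsub
    rw [Finset.card_image_of_injective _ hρ, Finset.card_univ, Fintype.card_fin] at h1
    exact h1.trans ((Multiset.toFinset_card_le _).trans ((card_roots' _).trans
      (natDegree_map _).le))
  have : minpoly K (ρ i₀) = p := (eq_of_monic_of_dvd_of_natDegree_le hmp hp hdvd
    (hdeg.trans hcard)).symm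
  exact this ▸ minpoly.irreducible hint

/-- Divisibility by a monic polynomial can be tested after an injective base change, so no normality
of `R` is required. -/
lemma prime_of_map_irreducible {R K : Type*} [CommRing R] [Field K] {f : R →+* K}
    (hf : Function.Injective f) {p : R[X]} (hp : p.Monic) (h : Irreducible (p.map f)) :
    Prime p := by
  have hpr := h.prime
  refine ⟨fun h0 => hpr.ne_zero (by rw [h0, Polynomial.map_zero]), fun hu => hpr.not_isUnit ?_,
    fun a b hab => ?_⟩
  · exact hu.map (mapRingHom f)
  · have := hpr.dvd_or_dvd (a := a.map f) (b := b.map f) (by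
      rw [← Polynomial.map_mul]
      exact (map_dvd_map f hf hp).mpr hab)
    rwa [map_dvd_map f hf hp, map_dvd_map f hf hp] at this

theorem GoodParam.isPrime_span_poly (hn : 2 ≤ n) {h₁ : q₁.IsHomogeneous 2}
    {h₂ : q₂.IsHomogeneous 2} (hX : IsSmoothIntersection h₁ h₂) :
    (Ideal.span {l.poly}).IsPrime := by
  obtain ⟨ρ, hρ, hroots, hσ⟩ := l.exists_roots_poly hn hX
  rw [Ideal.span_singleton_prime (by
    have : Nontrivial l.ring := l.toField.toRingHom.domain_nontrivial
    exact l.monic_poly.ne_zero)]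
  refine prime_of_map_irreducible (f := l.toField.toRingHom) l.toField_injective l.monic_poly ?_
  refine irreducible_of_transitive (l.monic_poly.map _)
    (natDegree_map_le.trans (natDegree_chartPoly_le _ _)) (by omega) hρ (fun j => ?_)
    fun i j => ?_
  · rw [aeval_def, eval₂_map, ← l.toClosure_eq]
    exact (hroots _).mpr ⟨j, rfl⟩
  · obtain ⟨σ, -, h⟩ := hσ (Equiv.swap i j)
    exact ⟨σ, by rw [h, Equiv.swap_apply_left]⟩

end GenericRoots

/-! ### Charts of Z; finiteness and flatness -/

section SingularScheme

open HomogeneousLocalization Polynomial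

variable {n : ℕ} {k : Type u} [Field k] {q₁ q₂ : MvPolynomial (Fin (n + 1)) k}
  (l : GoodParam q₁ q₂)

/-- The coordinate ring of the scheme of singular sections in the chart of a good member. -/
abbrev GoodParam.quotient : Type u := l.ring[X] ⧸ Ideal.span {l.poly}

/-- The quotient map of the coordinate ring of a chart. -/
def GoodParam.mk : l.ring[X] →+* l.quotient := Ideal.Quotient.mk _

lemma GoodParam.range_chart_subset : Set.range l.chart ⊆
    Limits.pullback.snd (projSpaceToSpec 1 k) (projSpaceToSpec n k) ⁻¹'
      (Proj.basicOpen (polyGrading n k) (dualPoly l.matrix)) :=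
  (range_productChart l.1 (dualPoly_mem l.matrix)).subset.trans Set.inter_subset_right

lemma GoodParam.finite_mk_comp_C : (l.mk.comp C).Finite :=
  RingHom.finite_algebraMap.mpr l.monic_poly.finite_quotient

lemma GoodParam.flat_mk_comp_C : (l.mk.comp C).Flat := by
  have : Module.Free l.ring l.quotient := l.monic_poly.free_quotient
  exact RingHom.flat_algebraMap_iff.mpr inferInstance

/-- The affine open subset of the dual space where the dual form of a good member does not
vanish. -/
def GoodParam.baseChart : Spec (CommRingCat.of l.ring) ⟶ projSpace n k :=
  Proj.awayι (polyGrading n k) (dualPoly l.matrix) (dualPoly_mem l.matrix) two_pos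

instance isOpenImmersion_baseChart : IsOpenImmersion l.baseChart := by
  rw [GoodParam.baseChart]
  infer_instance

lemma GoodParam.range_baseChart :
    Set.range l.baseChart = Proj.basicOpen (polyGrading n k) (dualPoly l.matrix) := by
  rw [GoodParam.baseChart, ← Scheme.Hom.coe_opensRange, Proj.opensRange_awayι]

variable [CharZero k]

/-- The chart of the scheme of singular sections attached to a good member of the pencil. -/
theorem GoodParam.exists_chart (hn : 2 ≤ n) {h₁ : q₁.IsHomogeneous 2} {h₂ : q₂.IsHomogeneous 2}
    (hX : IsSmoothIntersection h₁ h₂) :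
    ∃ τ : Spec (CommRingCat.of l.quotient) ⟶ singularScheme h₁ h₂, IsOpenImmersion τ ∧
      τ ≫ (singularIdeal h₁ h₂).subschemeι = Spec.map (CommRingCat.ofHom l.mk) ≫ l.chart ∧
      Set.range τ = singularProj h₁ h₂ ⁻¹'
        (Proj.basicOpen (polyGrading n k) (dualPoly l.matrix)) := by
  have hcl : closure (singularSections h₁ h₂) = singularSections h₁ h₂ :=
    (isClosed_singularSections hn hX).closure_eq
  obtain ⟨τ, hτ, h1, h2⟩ := exists_subscheme_chart
    ⟨closure (singularSections h₁ h₂), isClosed_closure⟩ l.chart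
    (J := Ideal.span {l.poly}) (l.isPrime_span_poly hn hX).isRadical (by
      change l.chart ⁻¹' (closure (singularSections h₁ h₂)) = _
      rw [hcl, l.preimage_singularSections hn h₁ h₂, PrimeSpectrum.zeroLocus_span])
  refine ⟨τ, hτ, h1, h2.trans (Set.Subset.antisymm (fun z hz => ?_) fun z hz => ?_)⟩
  · exact l.range_chart_subset hz
  · have hmem : (singularIdeal h₁ h₂).subschemeι z ∈ singularSections h₁ h₂ := by
      have : (singularIdeal h₁ h₂).subschemeι z ∈ Set.range (singularIdeal h₁ h₂).subschemeι :=
        ⟨z, rfl⟩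
      rw [Scheme.IdealSheafData.range_subschemeι] at this
      rw [← hcl]
      exact this
    exact l.mem_range_chart hn hmem hz

/-- The chart of the scheme of singular sections attached to a good member of the pencil. -/
def GoodParam.singularChart (hn : 2 ≤ n) {h₁ : q₁.IsHomogeneous 2} {h₂ : q₂.IsHomogeneous 2}
    (hX : IsSmoothIntersection h₁ h₂) :
    Spec (CommRingCat.of l.quotient) ⟶ singularScheme h₁ h₂ :=
  (l.exists_chart hn hX).choose

variable (hn : 2 ≤ n) {h₁ : q₁.IsHomogeneous 2} {h₂ : q₂.IsHomogeneous 2}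
  (hX : IsSmoothIntersection h₁ h₂)

instance isOpenImmersion_singularChart : IsOpenImmersion (l.singularChart hn hX) :=
  (l.exists_chart hn hX).choose_spec.1

lemma GoodParam.singularChart_subschemeι :
    l.singularChart hn hX ≫ (singularIdeal h₁ h₂).subschemeι =
      Spec.map (CommRingCat.ofHom l.mk) ≫ l.chart :=
  (l.exists_chart hn hX).choose_spec.2.1

lemma GoodParam.range_singularChart :
    Set.range (l.singularChart hn hX) = singularProj h₁ h₂ ⁻¹'
      (Proj.basicOpen (polyGrading n k) (dualPoly l.matrix)) :=
  (l.exists_chart hn hX).choose_spec.2.2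

lemma GoodParam.singularChart_singularProj :
    l.singularChart hn hX ≫ singularProj h₁ h₂ =
      Spec.map (CommRingCat.ofHom (l.mk.comp C)) ≫ l.baseChart := by
  rw [singularProj, ← Category.assoc, l.singularChart_subschemeι, Category.assoc,
    GoodParam.chart, productChart_snd, ← Category.assoc, ← Spec.map_comp, ← CommRingCat.ofHom_comp]
  rfl

theorem of_singularCharts (hn : 2 ≤ n) {h₁ : q₁.IsHomogeneous 2} {h₂ : q₂.IsHomogeneous 2}
    (hX : IsSmoothIntersection h₁ h₂) {W : MorphismProperty Scheme.{u}} [IsZariskiLocalAtTarget W]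
    (hW : ∀ l : GoodParam q₁ q₂, W (Spec.map (CommRingCat.ofHom (l.mk.comp C)))) :
    W (singularProj h₁ h₂) :=
  of_affine_charts (ι := GoodParam q₁ q₂) (singularProj h₁ h₂)
    (fun l => Spec (CommRingCat.of l.quotient)) (fun l => Spec (CommRingCat.of l.ring))
    (fun l => Spec.map (CommRingCat.ofHom (l.mk.comp C))) (fun l => l.singularChart hn hX)
    (fun l => l.baseChart) (fun l => l.singularChart_singularProj hn hX)
    (fun l => by rw [l.range_singularChart, l.range_baseChart])
    (fun y => by
      obtain ⟨l, hl⟩ := exists_mem_basicOpen_dualPoly hn hX y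
      exact ⟨l, by rw [l.range_baseChart]; exact hl⟩) hW

theorem isFinite_singularProj (hn : 2 ≤ n) {h₁ : q₁.IsHomogeneous 2}
    {h₂ : q₂.IsHomogeneous 2} (hX : IsSmoothIntersection h₁ h₂) :
    IsFinite (singularProj h₁ h₂) :=
  have : IsZariskiLocalAtTarget @IsFinite.{u} :=
    @HasAffineProperty.instIsZariskiLocalAtTarget _ _
      IsFinite.instHasAffinePropertyAndIsAffineFiniteCarrierObjOppositeOpensCarrierCarrierCommRingCatPresheafOpOpensTopHomAppTop
  of_singularCharts (W := @IsFinite.{u}) hn hX fun l =>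
    (IsFinite.SpecMap_iff (CommRingCat.ofHom (l.mk.comp C))).mpr l.finite_mk_comp_C

theorem flat_singularProj (hn : 2 ≤ n) {h₁ : q₁.IsHomogeneous 2}
    {h₂ : q₂.IsHomogeneous 2} (hX : IsSmoothIntersection h₁ h₂) :
    Flat (singularProj h₁ h₂) :=
  have : IsZariskiLocalAtTarget @Flat.{u} :=
    HasRingHomProperty.instIsZariskiLocalAtTarget (P := @Flat.{u})
  of_singularCharts (W := @Flat.{u}) hn hX fun l =>
    Flat.SpecMap_iff.mpr l.flat_mk_comp_C

end SingularScheme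

/-! ### The geometric generic fibre and its monodromy -/

section Monodromy

open HomogeneousLocalization Polynomial

variable {n : ℕ} {k : Type u} [Field k] {q₁ q₂ : MvPolynomial (Fin (n + 1)) k}
  (l : GoodParam q₁ q₂)

lemma geometricGenericPoint_mem (x : Spec (CommRingCat.of (genericClosure (projSpace n k)))) :
    geometricGenericPoint (projSpace n k) x ∈
      Proj.basicOpen (polyGrading n k) (dualPoly l.matrix) := by
  rw [geometricGenericPoint_eq, specMap_pointOfCoords_mem_basicOpen_iff _ (dualPoly_mem _) two_pos]
  exact l.isUnit_aeval_closureCoords.ne_zero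

lemma GoodParam.specMap_toClosure_baseChart :
    Spec.map (CommRingCat.ofHom l.toClosure.toRingHom) ≫ l.baseChart =
      geometricGenericPoint (projSpace n k) := by
  rw [geometricGenericPoint_eq, pointOfCoords_eq _ (dualPoly_mem l.matrix) two_pos
    l.isUnit_aeval_closureCoords]
  rfl

lemma GoodParam.quotient_hom_ext {T : Type*} [CommRing T] {f g : l.quotient →+* T}
    (hC : (f.comp l.mk).comp C = (g.comp l.mk).comp C) (hX : f (l.mk X) = g (l.mk X)) : f = g :=
  Ideal.Quotient.ringHom_ext (Polynomial.ringHom_ext (fun a => DFunLike.congr_fun hC a) hX)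

/-- The homomorphism from the coordinate ring of a chart to the algebraic closure of the function
field attached to a root of the equation of the chart. -/
def GoodParam.rootHom {x : genericClosure (projSpace n k)}
    (hx : l.poly.eval₂ l.toClosure.toRingHom x = 0) :
    l.quotient →+* genericClosure (projSpace n k) :=
  Ideal.Quotient.lift _ (eval₂RingHom l.toClosure.toRingHom x) fun a ha => by
    obtain ⟨b, rfl⟩ := Ideal.mem_span_singleton.mp ha
    rw [map_mul, coe_eval₂RingHom, hx, zero_mul]

lemma GoodParam.rootHom_mk_comp_C {x : genericClosure (projSpace n k)}
    (hx : l.poly.eval₂ l.toClosure.toRingHom x = 0) :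
    ((l.rootHom hx).comp l.mk).comp C = l.toClosure.toRingHom :=
  RingHom.ext fun _ => eval₂_C _ _

lemma GoodParam.rootHom_mk_X {x : genericClosure (projSpace n k)}
    (hx : l.poly.eval₂ l.toClosure.toRingHom x = 0) : l.rootHom hx (l.mk X) = x :=
  eval₂_X _ _

lemma GoodParam.eval₂_poly_eq_zero {ψ : l.quotient →+* genericClosure (projSpace n k)}
    (hC : (ψ.comp l.mk).comp C = l.toClosure.toRingHom) :
    l.poly.eval₂ l.toClosure.toRingHom (ψ (l.mk X)) = 0 := by
  have h : eval₂RingHom l.toClosure.toRingHom (ψ (l.mk X)) = ψ.comp l.mk :=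
    Polynomial.ringHom_ext (fun a => by rw [← hC]; simp) (by simp)
  have h1 := DFunLike.congr_fun h l.poly
  have h2 : l.mk l.poly = 0 := Ideal.Quotient.eq_zero_iff_mem.mpr (Ideal.mem_span_singleton_self _)
  rw [RingHom.comp_apply, h2, map_zero] at h1
  exact h1

lemma preimage_geometricGenericPoint_hom :
    (Spec.preimage (geometricGenericPoint (projSpace n k) ≫ projSpaceToSpec n k)).hom =
      algebraMap k (genericClosure (projSpace n k)) := by
  rw [geometricGenericPoint_eq, pointOfCoords_projSpaceToSpec, Spec.preimage_map]
  rfl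

variable [CharZero k] (hn : 2 ≤ n) {h₁ : q₁.IsHomogeneous 2} {h₂ : q₂.IsHomogeneous 2}
  (hX : IsSmoothIntersection h₁ h₂)

/-- The point of the geometric generic fibre attached to a root of the equation of the chart. -/
def GoodParam.fibrePoint {x : genericClosure (projSpace n k)}
    (hx : l.poly.eval₂ l.toClosure.toRingHom x = 0) : GenericFibre (singularProj h₁ h₂) :=
  ⟨Spec.map (CommRingCat.ofHom (l.rootHom hx)) ≫ l.singularChart hn hX, by
    rw [Category.assoc, l.singularChart_singularProj, ← Category.assoc, ← Spec.map_comp,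
      ← CommRingCat.ofHom_comp, ← RingHom.comp_assoc, l.rootHom_mk_comp_C,
      l.specMap_toClosure_baseChart]⟩

/-- The whole fibre lies in one chart, where a point is determined by the image of the coordinate
`X`, a root of the equation. -/
lemma GoodParam.exists_eq_fibrePoint (p : GenericFibre (singularProj h₁ h₂)) :
    ∃ (x : genericClosure (projSpace n k)) (hx : l.poly.eval₂ l.toClosure.toRingHom x = 0),
      p = l.fibrePoint hn hX hx := by
  have hp := p.2
  have hmem : p.1 default ∈ Set.range (l.singularChart hn hX) := by
    rw [l.range_singularChart, Set.mem_preimage, ← Scheme.Hom.comp_apply, hp]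
    exact geometricGenericPoint_mem l _
  obtain ⟨w, hw⟩ := hmem
  obtain ⟨ψ, hψ, -⟩ := exists_specMap_comp_eq (l.singularChart hn hX) p.1 hw.symm
  rw [← hψ, Category.assoc, l.singularChart_singularProj, ← Category.assoc, ← Spec.map_comp,
    ← CommRingCat.ofHom_comp, ← RingHom.comp_assoc, ← l.specMap_toClosure_baseChart] at hp
  have hC : (ψ.comp l.mk).comp C = l.toClosure.toRingHom :=
    awayι_comp_injective (dualPoly_mem l.matrix) two_pos hp
  refine ⟨_, l.eval₂_poly_eq_zero hC, Subtype.ext ?_⟩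
  rw [← hψ, GoodParam.fibrePoint]
  congr 3
  exact l.quotient_hom_ext (by rw [hC, l.rootHom_mk_comp_C]) (l.rootHom_mk_X _).symm

lemma GoodParam.eq_of_fibrePoint_eq {x y : genericClosure (projSpace n k)}
    (hx : l.poly.eval₂ l.toClosure.toRingHom x = 0) (hy : l.poly.eval₂ l.toClosure.toRingHom y = 0)
    (h : l.fibrePoint hn hX hx = l.fibrePoint hn hX hy) : x = y := by
  have h1 := Spec.map_injective ((cancel_mono (l.singularChart hn hX)).mp (congrArg Subtype.val h))
  have h2 : l.rootHom hx = l.rootHom hy := congrArg CommRingCat.Hom.hom h1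
  rw [← l.rootHom_mk_X hx, h2, l.rootHom_mk_X]

lemma GoodParam.smul_fibrePoint {x y : genericClosure (projSpace n k)}
    (hx : l.poly.eval₂ l.toClosure.toRingHom x = 0) (hy : l.poly.eval₂ l.toClosure.toRingHom y = 0)
    {σ : genericGalois (projSpace n k)} (h : σ x = y) :
    σ • l.fibrePoint hn hX hx = l.fibrePoint hn hX hy := by
  refine Subtype.ext ?_
  change Spec.map (CommRingCat.ofHom (σ : genericClosure (projSpace n k) →+*
    genericClosure (projSpace n k))) ≫ Spec.map (CommRingCat.ofHom (l.rootHom hx)) ≫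
      l.singularChart hn hX = Spec.map (CommRingCat.ofHom (l.rootHom hy)) ≫ l.singularChart hn hX
  rw [← Category.assoc, ← Spec.map_comp, ← CommRingCat.ofHom_comp]
  congr 3
  refine l.quotient_hom_ext ?_ ?_
  · refine RingHom.ext fun a => ?_
    change σ (((l.rootHom hx).comp l.mk).comp C a) = ((l.rootHom hy).comp l.mk).comp C a
    rw [l.rootHom_mk_comp_C, l.rootHom_mk_comp_C, l.toClosure_eq]
    exact σ.commutes _
  · rw [RingHom.comp_apply, l.rootHom_mk_X, l.rootHom_mk_X]
    exact h

theorem nonempty_goodParam (hn : 2 ≤ n) {h₁ : q₁.IsHomogeneous 2}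
    {h₂ : q₂.IsHomogeneous 2} (hX : IsSmoothIntersection h₁ h₂) : Nonempty (GoodParam q₁ q₂) := by
  obtain ⟨l, -⟩ := exists_goodParam hn hX (one_ne_zero (α := Fin 2 → k))
    (one_ne_zero (α := Fin (n + 1) → k))
  exact ⟨l⟩

/-- The geometric generic fibre has `n` points, and the geometric part of the Galois group permutes
them arbitrarily. -/
theorem exists_equiv_genericFibre (hn : 2 ≤ n) {h₁ : q₁.IsHomogeneous 2}
    {h₂ : q₂.IsHomogeneous 2} (hX : IsSmoothIntersection h₁ h₂) :
    ∃ e : Fin n ≃ GenericFibre (singularProj h₁ h₂), ∀ π : Equiv.Perm (Fin n),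
      ∃ σ ∈ geometricGalois (projSpaceToSpec n k), ∀ j, σ • e j = e (π j) := by
  obtain ⟨l⟩ := nonempty_goodParam hn hX
  obtain ⟨ρ, hρ, hroots, hσ⟩ := l.exists_roots_poly hn hX
  have hr : ∀ j, l.poly.eval₂ l.toClosure.toRingHom (ρ j) = 0 := fun j => (hroots _).mpr ⟨j, rfl⟩
  refine ⟨Equiv.ofBijective (fun j => l.fibrePoint hn hX (hr j)) ⟨fun i j h =>
    hρ (l.eq_of_fibrePoint_eq hn hX _ _ h), fun p => ?_⟩, fun π => ?_⟩
  · obtain ⟨x, hx, rfl⟩ := l.exists_eq_fibrePoint hn hX p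
    obtain ⟨j, rfl⟩ := (hroots x).mp hx
    exact ⟨j, rfl⟩
  · obtain ⟨σ, hσk, hσρ⟩ := hσ π
    refine ⟨σ, fun x hx => hσk x ?_, fun j => l.smul_fibrePoint hn hX _ _ (hσρ j)⟩
    rwa [preimage_geometricGenericPoint_hom] at hx

theorem isIntegral_singularScheme (hn : 2 ≤ n) {h₁ : q₁.IsHomogeneous 2}
    {h₂ : q₂.IsHomogeneous 2} (hX : IsSmoothIntersection h₁ h₂) :
      IsIntegral (singularScheme h₁ h₂) := by
  have hred : IsReduced (singularScheme h₁ h₂) := isReduced_subscheme_vanishingIdeal _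
  have hdom (l : GoodParam q₁ q₂) : IsIntegral (Spec (CommRingCat.of l.quotient)) := by
    have := l.isPrime_span_poly hn hX
    have : IsDomain l.quotient := Ideal.Quotient.isDomain _
    infer_instance
  obtain ⟨e, -⟩ := exists_equiv_genericFibre hn hX
  -- As `n > 0`, the geometric generic fibre has a point, and its image lies in all the charts.
  let p := e ⟨0, by omega⟩
  refine isIntegral_of_charts (ι := GoodParam q₁ q₂) (fun l => Spec (CommRingCat.of l.quotient))
    (fun l => l.singularChart hn hX) (fun z => ?_) (p.1 default) fun l => ?_
  · obtain ⟨l, hl⟩ := exists_mem_basicOpen_dualPoly hn hX (singularProj h₁ h₂ z)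
    exact ⟨l, by rw [l.range_singularChart]; exact hl⟩
  · rw [l.range_singularChart, Set.mem_preimage, ← Scheme.Hom.comp_apply, p.2]
    exact geometricGenericPoint_mem l _

lemma geometricMonodromyGroup_eq_top (hn : 2 ≤ n) {h₁ : q₁.IsHomogeneous 2}
    {h₂ : q₂.IsHomogeneous 2} (hX : IsSmoothIntersection h₁ h₂) :
    geometricMonodromyGroup (singularProj h₁ h₂) (projSpaceToSpec n k) = ⊤ := by
  obtain ⟨e, he⟩ := exists_equiv_genericFibre hn hX
  rw [eq_top_iff]
  intro π _
  obtain ⟨σ, hσ, hσe⟩ := he (e.permCongr.symm π)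
  refine ⟨σ, hσ, Equiv.ext fun p => ?_⟩
  obtain ⟨j, rfl⟩ := e.surjective p
  refine (hσe j).trans ?_
  simp [Equiv.permCongr_symm]

lemma monodromyGroup_eq_top (hn : 2 ≤ n) {h₁ : q₁.IsHomogeneous 2}
    {h₂ : q₂.IsHomogeneous 2} (hX : IsSmoothIntersection h₁ h₂) :
      monodromyGroup (singularProj h₁ h₂) = ⊤ := by
  rw [eq_top_iff, ← geometricMonodromyGroup_eq_top hn hX]
  exact Subgroup.map_le_range _ _

lemma nonempty_top_mulEquiv_perm (hn : 2 ≤ n) {h₁ : q₁.IsHomogeneous 2}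
    {h₂ : q₂.IsHomogeneous 2} (hX : IsSmoothIntersection h₁ h₂) :
    Nonempty ((⊤ : Subgroup (Equiv.Perm (GenericFibre (singularProj h₁ h₂)))) ≃*
      Equiv.Perm (Fin n)) := by
  obtain ⟨e, -⟩ := exists_equiv_genericFibre hn hX
  exact ⟨Subgroup.topEquiv.trans e.symm.permCongrHom⟩

end Monodromy

end QuadricPencil

end

open QuadricPencil

theorem mainTheorem5 (k : Type u) [Field k] [NumberField k] (n : ℕ) (hn : 2 ≤ n)
    (q₁ q₂ : MvPolynomial (Fin (n + 1)) k)
    (h₁ : q₁.IsHomogeneous 2) (h₂ : q₂.IsHomogeneous 2)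
    (hX : IsSmoothIntersection h₁ h₂) :
    IsClosed (singularSections h₁ h₂) ∧
    IsIntegral (singularScheme h₁ h₂) ∧
    IsFinite (singularProj h₁ h₂) ∧
    Flat (singularProj h₁ h₂) ∧
    Nat.card (GenericFibre (singularProj h₁ h₂)) = n ∧
    Nonempty (monodromyGroup (singularProj h₁ h₂) ≃* Equiv.Perm (Fin n)) ∧
    Nonempty (geometricMonodromyGroup (singularProj h₁ h₂) (projSpaceToSpec n k) ≃*
      Equiv.Perm (Fin n)) := by
  refine ⟨isClosed_singularSections hn hX, isIntegral_singularScheme hn hX,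
    isFinite_singularProj hn hX, flat_singularProj hn hX, ?_, ?_, ?_⟩
  · obtain ⟨e, -⟩ := exists_equiv_genericFibre hn hX
    rw [← Nat.card_congr e, Nat.card_eq_fintype_card, Fintype.card_fin]
  · rw [monodromyGroup_eq_top hn hX]
    exact nonempty_top_mulEquiv_perm hn hX
  · rw [geometricMonodromyGroup_eq_top hn hX]
    exact nonempty_top_mulEquiv_perm hn hX
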